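/- **Setting.** Let $a=(a_i)_{i\ge1}$, $b=(b_i)_{i\ge1}$ be strictly positive sequences. Put $Q_1=1$, $Q_{i+1}=\frac{a_i}{b_{i+1}}Q_i$; let $z_s\in[0,\infty]$ be the largest number such that $\sum_{i\ge1} iQ_iz^i<\infty$ for all $0\le z<z_s$, and $\varrho_s=\sum_{i\ge1} iQ_iz_s^i\in[0,\infty]$. Given $0\le\gamma<1$, $C_1,C_2>0$, assume that $0<z_s<\infty$, that $Q_i=z_s^{1-i}\alpha_i$ for all $i$ with $(\alpha_i)$ positive, non-increasing and $\lim_{i\to\infty}\alpha_{i+1}/\alpha_i=1$, and that $C_1i^\gamma\le a_i\le C_2i^\gamma$ for all $i\ge1$. For a mass $0<\varrho<\varrho_s$ let $\overline z\ge 0$ be the unique number with $\sum_i iQ_i\overline z^i=\varrho$ and $\mathcal Q_i=Q_i\overline z^i$. For a nonnegative sequence $c=(c_i)_{i\ge1}$ put (with $0\log0=0$) $$H(c|\mathcal Q)=\sum_{i\ge1}c_i\Big(\log\frac{c_i}{\overline z^iQ_i}-1\Big)+\sum_{i\ge1}\overline z^iQ_i,\qquad \overline D(c)=\sum_{i\ge1}a_iQ_i\Big(\sqrt{\tfrac{c_1c_i}{Q_i}}-\sqrt{\tfrac{c_{i+1}}{Q_{i+1}}}\Big)^2,\qquad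 M^{\exp}_\mu(c)=\sum_{i\ge1}e^{\mu i}c_i .$$ The mass of $c$ is $\sum_i ic_i$. With $W_i=a_ic_1c_i-b_{i+1}c_{i+1}$, the Becker–Döring equations on $[0,\infty)$ are $c_i'=W_{i-1}-W_i$ for $i\ge2$ and $c_1'=-W_1-\sum_{k\ge1}W_k$; solutions are nonnegative with mass bounded on bounded time intervals (and with $\sum_k W_k$ convergent), and the mass of a solution is that of its initial datum. **Theorem.** Fix $\gamma\in[0,1)$, $C_1,C_2>0$, $z_s\in(0,\infty)$, $(\alpha_i)$ as above, and $\varrho>0$, $\mu>0$, $M\ge0$. (i) (Functional inequality.) There exist $K_1,K_2,\varepsilon>0$, depending only on $\gamma,C_1,C_2,z_s,(\alpha_i),\varrho,\mu,M$, such that for all coefficients $a,b$ as above with $\varrho<\varrho_s$ and every positive sequence $c$ with mass $\varrho$ and $M^{\exp}_\mu(c)\le M$, the series defining $H(c|\mathcal Q)$ converge and $$\overline D(c)\ \ge\ \min\left(\frac{K_1H(c|\mathcal Q)}{\left|\log\big(K_2H(c|\mathcal Q)\big)\right|^{1-\gamma}},\ \varepsilon\right),$$ where the quotient is read as $0$ if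 $H(c|\mathcal Q)=0$ and as $+\infty$ if $K_2H(c|\mathcal Q)=1$. (ii) (Rate of convergence.) There exists $K>0$, depending only on $\gamma,C_1,C_2,z_s,(\alpha_i),\varrho,\mu,M$, and for every $H_0\in\mathbb R$ there exists $C>0$, depending only on these quantities and $H_0$, such that for all coefficients $a,b$ as above with $\varrho<\varrho_s$ and every solution $c(t)$ of the Becker–Döring equations with mass $\varrho$, $M^{\exp}_\mu(c(0))\le M$ and $H(c(0)|\mathcal Q)\le H_0$, for all $t\ge0$ the series defining $H(c(t)|\mathcal Q)$ converge and $$H(c(t)|\mathcal Q)\le C\,e^{-Kt^{1/(2-\gamma)}} .$$ -/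

import Mathlib

open Filter
open scoped ENNReal NNReal Topology

namespace BeckerDoring

noncomputable section

/-- The detailed balance coefficients: `Q 1 = 1` and `Q (i+1) = a i / b (i+1) * Q i`.
Cluster sizes are the positive integers `ℕ+`. -/
def detailedBalance (a b : ℕ+ → ℝ) (i : ℕ+) : ℝ :=
  PNat.recOn i 1 (fun j q => a j / b (j + 1) * q)

theorem detailedBalance_one (a b : ℕ+ → ℝ) : detailedBalance a b 1 = 1 := by
  simp [detailedBalance]

theorem detailedBalance_succ (a b : ℕ+ → ℝ) (i : ℕ+) :
    detailedBalance a b (i + 1) = a i / b (i + 1) * detailedBalance a b i := by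
  simp [detailedBalance, PNat.recOn_succ]

/-- The critical monomer density: the largest `r ∈ [0,∞]` such that `∑ i Q_i z^i < ∞`
for all `0 ≤ z < r`. -/
def criticalDensity (Q : ℕ+ → ℝ) : ℝ≥0∞ :=
  sSup {r : ℝ≥0∞ | ∀ z : ℝ≥0, (z : ℝ≥0∞) < r →
    Summable (fun i : ℕ+ => (i : ℝ) * Q i * (z : ℝ) ^ (i : ℕ))}

/-- The critical mass `ϱ_s = ∑ i Q_i z_s^i ∈ [0,∞]`, with `z_s` the critical monomer density. -/
def criticalMass (Q : ℕ+ → ℝ) : ℝ≥0∞ :=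
  ∑' i : ℕ+, ((i : ℕ) : ℝ≥0∞) * ENNReal.ofReal (Q i) * criticalDensity Q ^ (i : ℕ)

/-- The sequence `c` has (finite) mass `ϱ`, i.e. `∑ i c_i = ϱ`. -/
def HasMass (c : ℕ+ → ℝ) (ϱ : ℝ) : Prop :=
  HasSum (fun i : ℕ+ => (i : ℝ) * c i) ϱ

/-- The equilibrium monomer density for the mass `ϱ`: the number `z ≥ 0` such that
`∑ i Q_i z^i = ϱ`. For positive `Q` there is at most one such `z`, see
`equilibriumDensity_eq`. -/
def equilibriumDensity (Q : ℕ+ → ℝ) (ϱ : ℝ) : ℝ :=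
  sInf {z : ℝ | 0 ≤ z ∧ HasMass (fun i => Q i * z ^ (i : ℕ)) ϱ}

theorem equilibriumDensity_eq {Q : ℕ+ → ℝ} (hQ : ∀ i, 0 < Q i) {ϱ z : ℝ} (hz : 0 ≤ z)
    (h : HasMass (fun i => Q i * z ^ (i : ℕ)) ϱ) : equilibriumDensity Q ϱ = z := by
  have key : ∀ x y : ℝ, 0 ≤ x → x < y → HasMass (fun i => Q i * x ^ (i : ℕ)) ϱ →
      HasMass (fun i => Q i * y ^ (i : ℕ)) ϱ → False := by
    intro x y hx hxy h1 h2
    have hi : ∀ i : ℕ+, (0 : ℝ) < (i : ℝ) := fun i => by exact_mod_cast i.pos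
    refine lt_irrefl ϱ (hasSum_lt (i := (1 : ℕ+)) (fun i => ?_) ?_ h1 h2)
    · exact mul_le_mul_of_nonneg_left (mul_le_mul_of_nonneg_left
        (pow_le_pow_left₀ hx hxy.le _) (hQ i).le) (hi i).le
    · exact mul_lt_mul_of_pos_left (mul_lt_mul_of_pos_left
        (pow_lt_pow_left₀ hxy hx (PNat.ne_zero 1)) (hQ 1)) (hi 1)
  have hset : {x : ℝ | 0 ≤ x ∧ HasMass (fun i => Q i * x ^ (i : ℕ)) ϱ} = {z} := by
    ext x
    simp only [Set.mem_ofPred_eq, Set.mem_singleton_iff]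
    constructor
    · rintro ⟨hx, hx2⟩
      rcases lt_trichotomy x z with hlt | heq | hgt
      · exact (key x z hx hlt hx2 h).elim
      · exact heq
      · exact (key z x hz hgt h hx2).elim
    · rintro rfl
      exact ⟨hz, h⟩
  rw [equilibriumDensity, hset, csInf_singleton]

/-- The terms `c_i (log (c_i / (z^i Q_i)) - 1)` of the relative free energy
(with `0 log 0 = 0`). -/
def relFreeEnergyTerm (Q : ℕ+ → ℝ) (z : ℝ) (c : ℕ+ → ℝ) (i : ℕ+) : ℝ :=
  c i * (Real.log (c i / (z ^ (i : ℕ) * Q i)) - 1)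

/-- The relative free energy `H(c|𝒬)`, where `𝒬_i = Q_i z^i` and `z` is the equilibrium
monomer density for the mass `ϱ`. -/
def relFreeEnergy (Q : ℕ+ → ℝ) (ϱ : ℝ) (c : ℕ+ → ℝ) : ℝ :=
  (∑' i : ℕ+, relFreeEnergyTerm Q (equilibriumDensity Q ϱ) c i)
    + ∑' i : ℕ+, equilibriumDensity Q ϱ ^ (i : ℕ) * Q i

/-- Both series defining `H(c|𝒬)` converge. -/
def RelFreeEnergyConverges (Q : ℕ+ → ℝ) (ϱ : ℝ) (c : ℕ+ → ℝ) : Prop :=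
  Summable (relFreeEnergyTerm Q (equilibriumDensity Q ϱ) c) ∧
    Summable (fun i : ℕ+ => equilibriumDensity Q ϱ ^ (i : ℕ) * Q i)

/-- The lower free energy dissipation
`∑ a_i Q_i (√(c_1 c_i / Q_i) - √(c_{i+1} / Q_{i+1}))²`, a series of nonnegative terms,
as an element of `[0,∞]`. -/
def lowerDissipation (a Q : ℕ+ → ℝ) (c : ℕ+ → ℝ) : ℝ≥0∞ :=
  ∑' i : ℕ+, ENNReal.ofReal
    (a i * Q i * (Real.sqrt (c 1 * c i / Q i) - Real.sqrt (c (i + 1) / Q (i + 1))) ^ 2)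

/-- The exponential moment `∑ e^{μ i} c_i ∈ [0,∞]` of a nonnegative sequence. -/
def expMoment (μ : ℝ) (c : ℕ+ → ℝ) : ℝ≥0∞ :=
  ∑' i : ℕ+, ENNReal.ofReal (Real.exp (μ * i) * c i)

/-- The net rate `W_i = a_i c_1 c_i - b_{i+1} c_{i+1}`. -/
def netRate (a b : ℕ+ → ℝ) (c : ℕ+ → ℝ) (i : ℕ+) : ℝ :=
  a i * c 1 * c i - b (i + 1) * c (i + 1)

/-- `c` is a (global, nonnegative) solution of the Becker-Döring equations on `[0,∞)`.
As usual, a solution has locally bounded mass; conservation of mass is not part of the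
definition. The equations are required for all `t ≥ 0` (with the one-sided derivative at
`t = 0`). The values of `c` at negative times are irrelevant. -/
structure IsSolution (a b : ℕ+ → ℝ) (c : ℝ → ℕ+ → ℝ) : Prop where
  nonneg : ∀ t : ℝ, 0 ≤ t → ∀ i, 0 ≤ c t i
  mass_bounded : ∀ T : ℝ, ∃ B : ℝ≥0, ∀ t ∈ Set.Icc 0 T,
    ∑' i : ℕ+, ENNReal.ofReal ((i : ℝ) * c t i) ≤ B
  summable_netRate : ∀ t : ℝ, 0 ≤ t → Summable (netRate a b (c t))
  deriv_succ : ∀ t : ℝ, 0 ≤ t → ∀ i : ℕ+,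
    HasDerivWithinAt (fun s => c s (i + 1))
      (netRate a b (c t) i - netRate a b (c t) (i + 1)) (Set.Ici 0) t
  deriv_one : ∀ t : ℝ, 0 ≤ t →
    HasDerivWithinAt (fun s => c s 1)
      (-netRate a b (c t) 1 - ∑' k : ℕ+, netRate a b (c t) k) (Set.Ici 0) t

/-- The standing assumptions on `α`: it is positive and non-increasing, and
`α_{i+1} / α_i → 1`. -/
structure IsAdmissibleProfile (α : ℕ+ → ℝ) : Prop where
  pos : ∀ i, 0 < α i
  antitone : Antitone α
  tendsto_ratio : Tendsto (fun i : ℕ+ => α (i + 1) / α i) atTop (𝓝 1)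

/-- The assumptions on the coefficients: `a_i, b_i > 0`, the critical monomer density is the
number `zs`, `Q_i = zs^{1-i} α_i`, and `C₁ i^γ ≤ a_i ≤ C₂ i^γ`. -/
structure IsAdmissibleCoeff (γ C₁ C₂ zs : ℝ) (α a b : ℕ+ → ℝ) : Prop where
  a_pos : ∀ i, 0 < a i
  b_pos : ∀ i, 0 < b i
  criticalDensity_eq : criticalDensity (detailedBalance a b) = ENNReal.ofReal zs
  balance_eq : ∀ i : ℕ+, detailedBalance a b i = zs ^ (1 - (i : ℤ)) * α i
  lower_bound : ∀ i : ℕ+, C₁ * (i : ℝ) ^ γ ≤ a i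
  upper_bound : ∀ i : ℕ+, a i ≤ C₂ * (i : ℝ) ^ γ

end

end BeckerDoring

/-! Clusters are indexed from zero, so `c 0` is the monomer density. Let z be the equilibrium
density and ν n = Q n * c 0 ^ (n + 1) the detailed balance state with the same monomers as `c`.

Functional inequality. Among the states Q n * y ^ (n + 1), the equilibrium of equal mass minimises
the relative entropy (`Profile.entropy_le_of_le`), so ν may replace it in an upper bound. Since log
(c n / ν n) grows at most linearly, the n-th entropy term is at most a constant times (n + 1) p n,
where p n = (√(c n) - √(ν n))². If c 0 stays below a level smaller than zs, p obeys a contractive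
recursion driven by the dissipation D, with p 0 = 0, and a discrete Hardy inequality bounds ∑ (n +
1)^γ p n by a multiple of D (`Profile.exists_sum_le_dissip`). The missing weight (n + 1)^(1-γ) is at
most N^(1-γ) below a cut-off N; exponential decay handles the rest. Taking N of order |log H|
produces the logarithm (`Profile.exists_functional_inequality`). If c 0 is far from z, a small D
would force c close to ν, which has the wrong mass; hence D is bounded below.

Rate of convergence. The functional inequality can be used along a solution once exponential decay
in the cluster size holds uniformly in time (`Profile.exists_uniform_exp`). The entropy is bounded
by the mass and controls the integrated dissipation (`Flow.entropy_add_le`), and D is bounded below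
when c 0 exceeds z by a fixed amount, so such times have bounded total length (`Flow.integral_le`).
At these times the exponent of the moment is lowered, by a bounded total amount; at the others the
moment is damped. Inserting the functional inequality into the entropy inequality gives a
differential inequality in integrated form, solved by halving the entropy along times growing like
n^(2-γ) (`exists_stretched_exponential_decay`).

The coefficients Q, and with them z, are determined by zs and α, and the rates enter only through
their two-sided bounds. This makes all constants uniform in a and b. -/

namespace BeckerDoring

/-! ### Elementary inequalities for relative entropy; a discrete Hardy inequality -/

/-- The relative entropy density `x log (x / y) - x + y`. -/
noncomputable def ent (x y : ℝ) : ℝ := x * Real.log (x / y) - x + y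

theorem ent_zero_left (y : ℝ) : ent 0 y = y := by simp [ent]

theorem ent_nonneg {x y : ℝ} (hx : 0 ≤ x) (hy : 0 < y) : 0 ≤ ent x y := by
  rcases hx.eq_or_lt with rfl | hx
  · rw [ent_zero_left]; exact hy.le
  · have h := Real.one_sub_inv_le_log_of_pos (div_pos hx hy)
    have h2 := mul_le_mul_of_nonneg_left h hx.le
    have h3 : x * (1 - (x / y)⁻¹) = x - y := by field_simp
    unfold ent; linarith

theorem ent_le_of_log_le {x y L : ℝ} (hx : 0 ≤ x) (hlog : Real.log (x / y) ≤ L) :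
    ent x y ≤ L * x + y := by
  unfold ent
  nlinarith [mul_le_mul_of_nonneg_left hlog hx]

/-- With x = s² and y = t²: for s ≤ 2t, log r ≤ r - 1 gives the factor ((s + t)/t)² ≤ 9; for s > 2t,
s² ≤ 4 (s - t)² and the bound on the logarithm is enough. -/
theorem ent_le_sq_sqrt_sub {x y L : ℝ} (hx : 0 ≤ x) (hy : 0 < y) (hL : 1 ≤ L)
    (hlog : Real.log (x / y) ≤ L) : ent x y ≤ 9 * L * (√x - √y) ^ 2 := by
  obtain ⟨s, hs, rfl⟩ : ∃ s, 0 ≤ s ∧ x = s ^ 2 := ⟨√x, Real.sqrt_nonneg _, (Real.sq_sqrt hx).symm⟩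
  obtain ⟨t, ht, rfl⟩ : ∃ t, 0 < t ∧ y = t ^ 2 :=
    ⟨√y, Real.sqrt_pos.2 hy, (Real.sq_sqrt hy.le).symm⟩
  rw [Real.sqrt_sq hs, Real.sqrt_sq ht.le]
  rcases le_or_gt s (2 * t) with hst | hst
  · have h1 : s ^ 2 * Real.log (s ^ 2 / t ^ 2) ≤ s ^ 2 * (s ^ 2 / t ^ 2 - 1) := by
      rcases hs.eq_or_lt with rfl | hs
      · simp
      · exact mul_le_mul_of_nonneg_left (Real.log_le_sub_one_of_pos (by positivity)) (by positivity)
    have h2 : s ^ 2 * (s ^ 2 / t ^ 2 - 1) - s ^ 2 + t ^ 2 = (s - t) ^ 2 * ((s + t) / t) ^ 2 := by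
      field_simp; ring
    have h3 : ((s + t) / t) ^ 2 ≤ 9 := by
      have : (s + t) / t ≤ 3 := by rw [div_le_iff₀ ht]; linarith
      have h0 : 0 ≤ (s + t) / t := by positivity
      nlinarith
    have h4 := mul_le_mul_of_nonneg_left h3 (sq_nonneg (s - t))
    have h5 : (s - t) ^ 2 * 9 * 1 ≤ (s - t) ^ 2 * 9 * L :=
      mul_le_mul_of_nonneg_left hL (by positivity)
    unfold ent; nlinarith
  · have h1 : s ^ 2 * Real.log (s ^ 2 / t ^ 2) ≤ s ^ 2 * L :=
      mul_le_mul_of_nonneg_left hlog (by positivity)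
    have h2 : s ^ 2 / 4 ≤ (s - t) ^ 2 := by nlinarith
    have h3 : s ^ 2 / 4 * L ≤ (s - t) ^ 2 * L := mul_le_mul_of_nonneg_right h2 (by linarith)
    have h4 : 0 ≤ s ^ 2 * L := by positivity
    unfold ent; nlinarith

theorem ent_change_reference {x y₁ y₂ : ℝ} (h₁ : 0 < y₁) (h₂ : 0 < y₂) :
    ent x y₁ = ent x y₂ + x * Real.log (y₂ / y₁) + (y₁ - y₂) := by
  by_cases hx : x = 0
  · subst hx; simp [ent]
  · unfold ent
    rw [Real.log_div hx h₁.ne', Real.log_div hx h₂.ne', Real.log_div h₂.ne' h₁.ne']; ring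

theorem sq_sqrt_sub_sqrt_le_add {x y : ℝ} (hx : 0 ≤ x) (hy : 0 ≤ y) : (√x - √y) ^ 2 ≤ x + y := by
  nlinarith [Real.sq_sqrt hx, Real.sq_sqrt hy, mul_nonneg (Real.sqrt_nonneg x) (Real.sqrt_nonneg y)]

/-- Compares the lower dissipation with the true one, flux times logarithm. It follows from log
(s/t) ≥ 1 - t/s for the square roots s ≥ t. -/
theorem sq_sqrt_sub_sqrt_le_mul_log {x y : ℝ} (hx : 0 < x) (hy : 0 < y) :
    (√x - √y) ^ 2 ≤ (x - y) * (Real.log x - Real.log y) := by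
  wlog hxy : y ≤ x generalizing x y
  · have := this hy hx (le_of_not_ge hxy); nlinarith
  obtain ⟨s, hs, rfl⟩ : ∃ s, 0 < s ∧ x = s ^ 2 :=
    ⟨√x, Real.sqrt_pos.2 hx, (Real.sq_sqrt hx.le).symm⟩
  obtain ⟨t, ht, rfl⟩ : ∃ t, 0 < t ∧ y = t ^ 2 :=
    ⟨√y, Real.sqrt_pos.2 hy, (Real.sq_sqrt hy.le).symm⟩
  rw [Real.sqrt_sq hs.le, Real.sqrt_sq ht.le, Real.log_pow, Real.log_pow]
  have hst : t ≤ s := by nlinarith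
  have h := Real.one_sub_inv_le_log_of_pos (div_pos hs ht)
  rw [Real.log_div hs.ne' ht.ne'] at h
  have h1 : (s ^ 2 - t ^ 2) * (1 - (s / t)⁻¹) ≤ (s ^ 2 - t ^ 2) * (Real.log s - Real.log t) :=
    mul_le_mul_of_nonneg_left h (by nlinarith)
  have h2 : (s ^ 2 - t ^ 2) * (1 - (s / t)⁻¹) = (s - t) ^ 2 * ((s + t) / s) := by
    field_simp; ring
  have h3 : 1 ≤ (s + t) / s := by rw [le_div_iff₀ hs]; linarith
  have h4 := mul_le_mul_of_nonneg_left h3 (sq_nonneg (s - t))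
  push_cast
  nlinarith [sq_nonneg (s - t)]

/-- A discrete Hardy inequality: summing a contractive recursion against a weight of at most linear
growth. -/
theorem sum_weight_le_of_contraction {p q w : ℕ → ℝ} {θ : ℝ} (hθ0 : 0 ≤ θ) (hθ1 : θ < 1)
    (hp0 : p 0 = 0) (hp : ∀ n, 0 ≤ p n) (hq : ∀ n, 0 ≤ q n)
    (hrec : ∀ n, p (n + 1) ≤ θ * p n + q n) (hw : ∀ n, 1 ≤ w n) (hw' : ∀ n, w (n + 1) ≤ w n + 1)
    (N : ℕ) :
    ∑ n ∈ Finset.range (N + 1), w n * p n ≤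
      3 / (1 - θ) ^ 2 * ∑ n ∈ Finset.range N, w n * q n := by
  have h1θ : 0 < 1 - θ := by linarith
  set S := ∑ n ∈ Finset.range (N + 1), p n with hS
  set P := ∑ n ∈ Finset.range (N + 1), w n * p n with hP
  set Y := ∑ n ∈ Finset.range N, w n * q n with hY
  have hYq : ∑ n ∈ Finset.range N, q n ≤ Y :=
    Finset.sum_le_sum fun n _ => by nlinarith [hw n, hq n]
  -- Summing the recursion without weights controls S by Y / (1 - θ); this pays for the increments
  -- of `w`, each at most 1.
  have hS1 : S ≤ θ * ∑ n ∈ Finset.range N, p n + ∑ n ∈ Finset.range N, q n := by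
    rw [hS, Finset.sum_range_succ', hp0, add_zero, Finset.mul_sum, ← Finset.sum_add_distrib]
    exact Finset.sum_le_sum fun n _ => hrec n
  have hS2 : ∑ n ∈ Finset.range N, p n ≤ S := by
    rw [hS, Finset.sum_range_succ]; linarith [hp N]
  have hP1 : P ≤ θ * ∑ n ∈ Finset.range N, w n * p n + θ * ∑ n ∈ Finset.range N, p n + Y
      + ∑ n ∈ Finset.range N, q n := by
    rw [hP, Finset.sum_range_succ', hp0, mul_zero, add_zero, Finset.mul_sum, Finset.mul_sum, hY,
      ← Finset.sum_add_distrib, ← Finset.sum_add_distrib, ← Finset.sum_add_distrib]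
    refine Finset.sum_le_sum fun n _ => ?_
    have h1 : w (n + 1) * p (n + 1) ≤ (w n + 1) * (θ * p n + q n) :=
      mul_le_mul (hw' n) (hrec n) (hp _) (by linarith [hw n])
    nlinarith
  have hP2 : ∑ n ∈ Finset.range N, w n * p n ≤ P := by
    rw [hP, Finset.sum_range_succ]
    linarith [mul_nonneg (zero_le_one.trans (hw N)) (hp N)]
  have hY0 : 0 ≤ Y := Finset.sum_nonneg fun n _ => mul_nonneg (zero_le_one.trans (hw n)) (hq n)
  have hS3 : (1 - θ) * S ≤ Y := by nlinarith
  have hS0 : 0 ≤ S := Finset.sum_nonneg fun n _ => hp n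
  -- Multiplying by 1 - θ once more and using (1 - θ) S ≤ Y gives Y + 2 Y, the origin of the
  -- constant 3.
  have hP3 : (1 - θ) * P ≤ S + 2 * Y := by nlinarith
  rw [div_mul_eq_mul_div, le_div_iff₀ (by positivity)]
  nlinarith [mul_le_mul_of_nonneg_left hP3 h1θ.le]

/-! ### The setting with cluster sizes shifted to start at zero -/

/-- Detailed balance coefficients, indexed by `n` for the cluster size `n + 1`, together with the
equilibrium monomer density `z` of mass `ϱ`. -/
structure Profile (zs B z ϱ : ℝ) (Q : ℕ → ℝ) : Prop where
  z_pos : 0 < z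
  z_lt : z < zs
  Q_zero : Q 0 = 1
  Q_pos : ∀ n, 0 < Q n
  ratio_lower : ∀ n, zs * Q (n + 1) ≤ Q n
  ratio_upper : ∀ n, Q n ≤ B * Q (n + 1)
  mass : HasSum (fun n : ℕ => ((n : ℝ) + 1) * (Q n * z ^ (n + 1))) ϱ

/-- Attachment rates comparable to a power of the cluster size `n + 1`. -/
structure Rates (γ C₁ C₂ : ℝ) (a : ℕ → ℝ) : Prop where
  lower : ∀ n : ℕ, C₁ * ((n : ℝ) + 1) ^ γ ≤ a n
  upper : ∀ n : ℕ, a n ≤ C₂ * ((n : ℝ) + 1) ^ γ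

/-- A nonnegative sequence of mass `ϱ` with exponential decay. -/
structure State (ϱ μ M : ℝ) (c : ℕ → ℝ) : Prop where
  nonneg : ∀ n, 0 ≤ c n
  mass : HasSum (fun n : ℕ => ((n : ℝ) + 1) * c n) ϱ
  decay : ∀ n : ℕ, c n ≤ M * Real.exp (-μ * n)

/-- The terms of the lower dissipation. -/
noncomputable def dissip (a Q c : ℕ → ℝ) (n : ℕ) : ℝ :=
  a n * Q n * (√(c 0 * c n / Q n) - √(c (n + 1) / Q (n + 1))) ^ 2

/-- The relative entropy with respect to the equilibrium `Q n * z ^ (n + 1)`. -/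
noncomputable def entropy (Q : ℕ → ℝ) (z : ℝ) (c : ℕ → ℝ) : ℝ :=
  ∑' n, ent (c n) (Q n * z ^ (n + 1))

section
variable {γ C₁ C₂ : ℝ} {a : ℕ → ℝ}

theorem Rates.const_le (ha : Rates γ C₁ C₂ a) (hγ : 0 ≤ γ) (hC₁ : 0 < C₁) (n : ℕ) : C₁ ≤ a n := by
  refine le_trans ?_ (ha.lower n)
  have : (1 : ℝ) ≤ ((n : ℝ) + 1) ^ γ := Real.one_le_rpow (by linarith [n.cast_nonneg (α := ℝ)]) hγ
  nlinarith

theorem Rates.pos (ha : Rates γ C₁ C₂ a) (hγ : 0 ≤ γ) (hC₁ : 0 < C₁) (n : ℕ) : 0 < a n :=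
  hC₁.trans_le (ha.const_le hγ hC₁ n)

end

section
variable {zs B z ϱ : ℝ} {Q : ℕ → ℝ}

theorem Profile.zs_pos (hQ : Profile zs B z ϱ Q) : 0 < zs := hQ.z_pos.trans hQ.z_lt

theorem Profile.zs_le (hQ : Profile zs B z ϱ Q) : zs ≤ B := by
  have h1 := hQ.ratio_lower 0
  have h2 := hQ.ratio_upper 0
  exact le_of_mul_le_mul_right (h1.trans h2) (hQ.Q_pos 1)

theorem Profile.B_pos (hQ : Profile zs B z ϱ Q) : 0 < B := hQ.zs_pos.trans_le hQ.zs_le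

theorem Profile.eq_pos (hQ : Profile zs B z ϱ Q) (n : ℕ) : 0 < Q n * z ^ (n + 1) :=
  mul_pos (hQ.Q_pos n) (pow_pos hQ.z_pos _)

theorem Profile.rho_pos (hQ : Profile zs B z ϱ Q) : 0 < ϱ := by
  have := hQ.mass.tsum_eq
  rw [← this]
  refine hQ.mass.summable.tsum_pos (fun n => ?_) 0 ?_
  · exact mul_nonneg (by positivity) (hQ.eq_pos n).le
  · exact mul_pos (by positivity) (hQ.eq_pos 0)

theorem Profile.Q_mul_pow_le (hQ : Profile zs B z ϱ Q) (n : ℕ) : Q n * zs ^ n ≤ 1 := by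
  induction n with
  | zero => simp [hQ.Q_zero]
  | succ n ih =>
    have := mul_le_mul_of_nonneg_right (hQ.ratio_lower n) (pow_nonneg hQ.zs_pos.le n)
    rw [pow_succ]; linarith

theorem Profile.one_le_Q_mul_pow (hQ : Profile zs B z ϱ Q) (n : ℕ) : 1 ≤ Q n * B ^ n := by
  induction n with
  | zero => simp [hQ.Q_zero]
  | succ n ih =>
    have := mul_le_mul_of_nonneg_right (hQ.ratio_upper n) (pow_nonneg hQ.B_pos.le n)
    rw [pow_succ]; linarith

theorem Profile.ratio_mem (hQ : Profile zs B z ϱ Q) (n : ℕ) :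
    zs ≤ Q n / Q (n + 1) ∧ Q n / Q (n + 1) ≤ B := by
  rw [le_div_iff₀ (hQ.Q_pos _), div_le_iff₀ (hQ.Q_pos _)]
  exact ⟨hQ.ratio_lower n, hQ.ratio_upper n⟩

end

section
variable {ϱ : ℝ} {c : ℕ → ℝ}

theorem le_of_hasMass (hc : ∀ n, 0 ≤ c n) (hm : HasSum (fun n : ℕ => ((n : ℝ) + 1) * c n) ϱ)
    (n : ℕ) : ((n : ℝ) + 1) * c n ≤ ϱ :=
  le_hasSum hm n fun m _ => mul_nonneg (by positivity) (hc m)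

theorem le_of_hasMass' (hc : ∀ n, 0 ≤ c n) (hm : HasSum (fun n : ℕ => ((n : ℝ) + 1) * c n) ϱ)
    (n : ℕ) : c n ≤ ϱ := by
  have := le_of_hasMass hc hm n
  nlinarith [hc n, n.cast_nonneg (α := ℝ), mul_nonneg (n.cast_nonneg (α := ℝ)) (hc n)]

theorem summable_of_hasMass (hc : ∀ n, 0 ≤ c n)
    (hm : HasSum (fun n : ℕ => ((n : ℝ) + 1) * c n) ϱ) : Summable c :=
  Summable.of_nonneg_of_le hc
    (fun n => by nlinarith [hc n, mul_nonneg (n.cast_nonneg (α := ℝ)) (hc n)]) hm.summable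

end

/-! ### A priori entropy bounds; dissipation when the monomer density is far from equilibrium -/

section
variable {zs B z ϱ : ℝ} {Q : ℕ → ℝ}

/-- `Q n` is at least B^(-n), so the logarithm grows at most linearly in n, uniformly for x below
the mass and y away from 0. -/
theorem Profile.exists_log_le (hQ : Profile zs B z ϱ Q) :
    ∃ K : ℝ, 1 ≤ K ∧ ∀ (x y : ℝ) (n : ℕ), 0 ≤ x → x ≤ ϱ → z / 2 ≤ y →
      Real.log (x / (Q n * y ^ (n + 1))) ≤ K * ((n : ℝ) + 1) := by
  refine ⟨1 + |Real.log ϱ| + |Real.log B| + |Real.log (z / 2)|, ?_, fun x y n hx hxϱ hy => ?_⟩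
  · linarith [abs_nonneg (Real.log ϱ), abs_nonneg (Real.log B), abs_nonneg (Real.log (z / 2))]
  have hz := hQ.z_pos
  have hB := hQ.B_pos
  have hy0 : 0 < y := by linarith
  have hn : (0 : ℝ) ≤ n := n.cast_nonneg
  rcases hx.eq_or_lt with rfl | hx
  -- For x = 0 the convention log 0 = 0 leaves only the sign of the right side to check.
  · simp only [zero_div, Real.log_zero]; positivity
  · rw [Real.log_div hx.ne' (mul_pos (hQ.Q_pos n) (pow_pos hy0 _)).ne',
      Real.log_mul (hQ.Q_pos n).ne' (pow_pos hy0 _).ne', Real.log_pow]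
    have h1 : Real.log x ≤ |Real.log ϱ| := (Real.log_le_log hx hxϱ).trans (le_abs_self _)
    have h2 : 0 ≤ Real.log (Q n) + n * Real.log B := by
      have := Real.log_nonneg (hQ.one_le_Q_mul_pow n)
      rwa [Real.log_mul (hQ.Q_pos n).ne' (pow_pos hB _).ne', Real.log_pow] at this
    have h3 : Real.log (z / 2) ≤ Real.log y := Real.log_le_log (by positivity) hy
    have h4 := neg_abs_le (Real.log (z / 2))
    have h5 := le_abs_self (Real.log B)
    have h6 : n * Real.log B ≤ n * |Real.log B| := mul_le_mul_of_nonneg_left h5 hn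
    have h7 : ((n : ℝ) + 1) * (-Real.log y) ≤ ((n : ℝ) + 1) * |Real.log (z / 2)| :=
      mul_le_mul_of_nonneg_left (by linarith) (by linarith)
    push_cast
    nlinarith [abs_nonneg (Real.log ϱ), abs_nonneg (Real.log B), abs_nonneg (Real.log (z / 2)),
      mul_nonneg hn (abs_nonneg (Real.log ϱ))]

theorem Profile.summable_eq (hQ : Profile zs B z ϱ Q) :
    Summable fun n : ℕ => Q n * z ^ (n + 1) :=
  summable_of_hasMass (fun n => (hQ.eq_pos n).le) hQ.mass

/-- The linear bound on the logarithm is summed against the mass. The resulting bound depends on the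
sequence only through its mass, hence holds at all times for solutions. -/
theorem Profile.exists_entropy_le (hQ : Profile zs B z ϱ Q) :
    ∃ H : ℝ, 0 < H ∧ ∀ c : ℕ → ℝ, (∀ n, 0 ≤ c n) →
      HasSum (fun n : ℕ => ((n : ℝ) + 1) * c n) ϱ →
      Summable (fun n => ent (c n) (Q n * z ^ (n + 1))) ∧ 0 ≤ entropy Q z c ∧
        entropy Q z c ≤ H := by
  obtain ⟨K, hK, hlog⟩ := hQ.exists_log_le
  have hz := hQ.z_pos
  refine ⟨K * ϱ + ∑' n : ℕ, Q n * z ^ (n + 1), ?_, fun c hc hm => ?_⟩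
  · have h1 : 0 < K * ϱ := mul_pos (by linarith) hQ.rho_pos
    have h2 : 0 ≤ ∑' n : ℕ, Q n * z ^ (n + 1) := tsum_nonneg fun n => (hQ.eq_pos n).le
    linarith
  have h0 : ∀ n, 0 ≤ ent (c n) (Q n * z ^ (n + 1)) := fun n => ent_nonneg (hc n) (hQ.eq_pos n)
  have hle : ∀ n : ℕ, ent (c n) (Q n * z ^ (n + 1)) ≤
      K * (((n : ℝ) + 1) * c n) + Q n * z ^ (n + 1) := fun n => by
    refine (ent_le_of_log_le (hc n)
      (hlog _ z n (hc n) (le_of_hasMass' hc hm n) (by linarith))).trans (le_of_eq (by ring))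
  have hs := (hm.mul_left K).add hQ.summable_eq.hasSum
  have hsum := Summable.of_nonneg_of_le h0 hle hs.summable
  exact ⟨hsum, tsum_nonneg h0, hasSum_le hle hsum.hasSum hs⟩

/-- Among all `Q n * y ^ (n + 1)`, the relative entropy is smallest for the equilibrium with the
same mass. -/
theorem Profile.entropy_le_of_le (hQ : Profile zs B z ϱ Q) {c f : ℕ → ℝ} {y X : ℝ} (hy : 0 < y)
    (hc : ∀ n, 0 ≤ c n) (hm : HasSum (fun n : ℕ => ((n : ℝ) + 1) * c n) ϱ)
    (hf : ∀ n, ent (c n) (Q n * y ^ (n + 1)) ≤ f n) (hX : HasSum f X) : entropy Q z c ≤ X := by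
  obtain ⟨_, _, h⟩ := hQ.exists_entropy_le
  obtain ⟨hsum, -⟩ := h c hc hm
  have hz := hQ.z_pos
  -- Changing the reference state costs E log(ν/E) + E - ν ≤ 0, with E the equilibrium and ν the
  -- other state, plus a multiple of (n + 1)(c n - E n) that sums to zero because the masses agree.
  have key : ∀ n : ℕ, ent (c n) (Q n * z ^ (n + 1)) ≤ f n +
      (((n : ℝ) + 1) * c n - ((n : ℝ) + 1) * (Q n * z ^ (n + 1))) * Real.log (y / z) := by
    intro n
    have hν : 0 < Q n * y ^ (n + 1) := mul_pos (hQ.Q_pos n) (pow_pos hy _)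
    rw [ent_change_reference (hQ.eq_pos n) hν]
    have hr : Q n * y ^ (n + 1) / (Q n * z ^ (n + 1)) = (y / z) ^ (n + 1) := by
      rw [div_pow, mul_div_mul_left _ _ (hQ.Q_pos n).ne']
    have hyz : 0 < (y / z) ^ (n + 1) := pow_pos (div_pos hy hz) _
    have h1 := Real.log_le_sub_one_of_pos hyz
    have h2 : Q n * y ^ (n + 1) = Q n * z ^ (n + 1) * (y / z) ^ (n + 1) := by
      rw [← hr, mul_div_cancel₀ _ (hQ.eq_pos n).ne']
    rw [hr]
    have h3 := mul_le_mul_of_nonneg_left h1 (hQ.eq_pos n).le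
    rw [Real.log_pow] at h3 ⊢
    push_cast at h3 ⊢
    have := hf n
    nlinarith
  have hs := hX.add ((hm.sub hQ.mass).mul_right (Real.log (y / z)))
  have := hasSum_le key hsum.hasSum hs
  simpa [entropy] using this

/-- If the dissipation is small, then the sequence is close to the detailed balance state with the
same monomer density. -/
theorem Profile.exists_abs_sub_le (hQ : Profile zs B z ϱ Q) {C₁ : ℝ} (hC₁ : 0 < C₁) (n : ℕ) :
    ∃ L : ℝ, 0 ≤ L ∧ ∀ a c : ℕ → ℝ, (∀ k, C₁ ≤ a k) → (∀ k, 0 ≤ c k) → (∀ k, c k ≤ ϱ) →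
      ∀ D : ℝ, (∀ k < n, dissip a Q c k ≤ D) → |c n - Q n * c 0 ^ (n + 1)| ≤ L * √D := by
  have hϱ := hQ.rho_pos
  induction n with
  | zero => exact ⟨0, le_rfl, fun a c _ _ _ D _ => by simp [hQ.Q_zero]⟩
  | succ n ih =>
    obtain ⟨L, hL, ih⟩ := ih
    have hq := hQ.Q_pos n
    have hq' := hQ.Q_pos (n + 1)
    set S := √(ϱ * ϱ / Q n) + √(ϱ / Q (n + 1)) with hS
    have hS0 : 0 ≤ S := by positivity
    refine ⟨Q (n + 1) * (S / √(C₁ * Q n) + ϱ / Q n * L), by positivity,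
      fun a c ha hc hcϱ D hD => ?_⟩
    have h1 := ih a c ha hc hcϱ D fun k hk => hD k (hk.trans n.lt_succ_self)
    have h2 := hD n n.lt_succ_self
    have hc0 := hc 0
    have hcn := hc n
    have hcn' := hc (n + 1)
    set X := √(c 0 * c n / Q n) with hX
    set Y := √(c (n + 1) / Q (n + 1)) with hY
    have hX0 : 0 ≤ X := Real.sqrt_nonneg _
    have hY0 : 0 ≤ Y := Real.sqrt_nonneg _
    have hX2 : X ^ 2 = c 0 * c n / Q n := Real.sq_sqrt (by positivity)
    have hY2 : Y ^ 2 = c (n + 1) / Q (n + 1) := Real.sq_sqrt (by positivity)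
    have hXY : |Y - X| ≤ √D / √(C₁ * Q n) := by
      rw [le_div_iff₀ (by positivity), ← Real.sqrt_sq_eq_abs, ← Real.sqrt_mul (by positivity)]
      refine Real.sqrt_le_sqrt (le_trans ?_ h2)
      have : (C₁ * Q n) * (X - Y) ^ 2 ≤ (a n * Q n) * (X - Y) ^ 2 := by
        gcongr; exact ha n
      calc (Y - X) ^ 2 * (C₁ * Q n) = (C₁ * Q n) * (X - Y) ^ 2 := by ring
        _ ≤ _ := this
    have hXS : Y + X ≤ S := by
      rw [hS, add_comm]
      refine add_le_add (Real.sqrt_le_sqrt ?_) (Real.sqrt_le_sqrt ?_)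
      · have := mul_le_mul (hcϱ 0) (hcϱ n) hcn hϱ.le
        gcongr
      · gcongr; exact hcϱ _
    have h3 : |Y ^ 2 - X ^ 2| ≤ S / √(C₁ * Q n) * √D := by
      have : Y ^ 2 - X ^ 2 = (Y + X) * (Y - X) := by ring
      rw [this, abs_mul, abs_of_nonneg (by positivity : 0 ≤ Y + X)]
      calc (Y + X) * |Y - X| ≤ S * (√D / √(C₁ * Q n)) := by gcongr
        _ = _ := by ring
    -- The error splits into a new part, controlled by the n-th dissipation term, and the old error
    -- multiplied by a bounded factor.
    have h4 : c (n + 1) - Q (n + 1) * c 0 ^ (n + 1 + 1) =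
        Q (n + 1) * ((Y ^ 2 - X ^ 2) + c 0 / Q n * (c n - Q n * c 0 ^ (n + 1))) := by
      rw [hX2, hY2]; field_simp; ring
    rw [h4, abs_mul, abs_of_pos hq', mul_assoc]
    refine mul_le_mul_of_nonneg_left ((abs_add_le _ _).trans ?_) hq'.le
    rw [abs_mul, abs_of_nonneg (by positivity : 0 ≤ c 0 / Q n), add_mul, mul_assoc _ L]
    refine add_le_add h3 (mul_le_mul ?_ h1 (abs_nonneg _) (by positivity))
    gcongr; exact hcϱ 0

theorem Profile.exists_sum_abs_sub_le (hQ : Profile zs B z ϱ Q) {C₁ : ℝ} (hC₁ : 0 < C₁) (N : ℕ) :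
    ∃ L : ℝ, 0 < L ∧ ∀ a c : ℕ → ℝ, (∀ k, C₁ ≤ a k) → (∀ k, 0 ≤ c k) → (∀ k, c k ≤ ϱ) →
      |∑ n ∈ Finset.range N, ((n : ℝ) + 1) * c n -
        ∑ n ∈ Finset.range N, ((n : ℝ) + 1) * (Q n * c 0 ^ (n + 1))| ≤
        L * √(∑ n ∈ Finset.range N, dissip a Q c n) := by
  choose L hL0 hL using fun n => hQ.exists_abs_sub_le hC₁ n
  -- The summand 1 only makes `L` positive, so that one can divide by it later.
  refine ⟨1 + ∑ n ∈ Finset.range N, ((n : ℝ) + 1) * L n, ?_, fun a c ha hc hcϱ => ?_⟩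
  · have : 0 ≤ ∑ n ∈ Finset.range N, ((n : ℝ) + 1) * L n :=
      Finset.sum_nonneg fun n _ => mul_nonneg (by positivity) (hL0 n)
    linarith
  have hd : ∀ n, 0 ≤ dissip a Q c n := fun n =>
    mul_nonneg (mul_nonneg (hC₁.le.trans (ha n)) (hQ.Q_pos n).le) (sq_nonneg _)
  set D := ∑ n ∈ Finset.range N, dissip a Q c n with hD
  rw [← Finset.sum_sub_distrib]
  refine (Finset.abs_sum_le_sum_abs _ _).trans ?_
  have : ∑ n ∈ Finset.range N, |((n : ℝ) + 1) * c n - ((n : ℝ) + 1) * (Q n * c 0 ^ (n + 1))| ≤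
      ∑ n ∈ Finset.range N, ((n : ℝ) + 1) * L n * √D := by
    refine Finset.sum_le_sum fun n hn => ?_
    rw [← mul_sub, abs_mul, abs_of_nonneg (by positivity : (0 : ℝ) ≤ (n : ℝ) + 1), mul_assoc]
    refine mul_le_mul_of_nonneg_left (hL n a c ha hc hcϱ D fun k hk => ?_) (by positivity)
    exact Finset.single_le_sum (f := dissip a Q c) (fun k _ => hd k)
      (Finset.mem_range.2 (hk.trans (Finset.mem_range.1 hn)))
  rw [← Finset.sum_mul] at this
  linarith [Real.sqrt_nonneg D]

theorem le_of_half_le_mul_sqrt {δ L D : ℝ} (hδ : 0 < δ) (hL : 0 < L) (h : δ / 2 ≤ L * √D) :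
    (δ / (2 * L)) ^ 2 ≤ D := by
  have h1 : δ / (2 * L) ≤ √D := by rw [div_le_iff₀ (by positivity)]; linarith
  have h2 : 0 < √D := lt_of_lt_of_le (by positivity) h1
  exact (Real.le_sqrt' (by positivity)).1 h1

/-- If the monomer density is too large, then finitely many terms of the dissipation are bounded
below. -/
theorem Profile.exists_le_dissip_of_large (hQ : Profile zs B z ϱ Q) {C₁ δ : ℝ} (hC₁ : 0 < C₁)
    (hδ : 0 < δ) :
    ∃ (N : ℕ) (ε : ℝ), 0 < ε ∧ ∀ a c : ℕ → ℝ, (∀ k, C₁ ≤ a k) → (∀ k, 0 ≤ c k) →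
      HasSum (fun n : ℕ => ((n : ℝ) + 1) * c n) ϱ → z + δ ≤ c 0 →
      ε ≤ ∑ n ∈ Finset.range N, dissip a Q c n := by
  -- The first N sizes carry all but δ/2 of the equilibrium mass. Raising the monomer density by δ
  -- adds at least δ, already through the monomer term (hence N ≥ 1), so the comparison state
  -- exceeds the mass of `c` by δ/2.
  obtain ⟨N, hN⟩ := ((hQ.mass.tendsto_sum_nat.eventually_const_lt
    (show ϱ - δ / 2 < ϱ by linarith)).and (eventually_ge_atTop 1)).exists
  obtain ⟨L, hL, h⟩ := hQ.exists_sum_abs_sub_le hC₁ N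
  refine ⟨N, (δ / (2 * L)) ^ 2, by positivity, fun a c ha hc hm hc0 => ?_⟩
  refine le_of_half_le_mul_sqrt hδ hL ?_
  have h1 := h a c ha hc (le_of_hasMass' hc hm)
  have h2 := neg_abs_le (∑ n ∈ Finset.range N, ((n : ℝ) + 1) * c n -
        ∑ n ∈ Finset.range N, ((n : ℝ) + 1) * (Q n * c 0 ^ (n + 1)))
  have h3 : ∑ n ∈ Finset.range N, ((n : ℝ) + 1) * c n ≤ ϱ :=
    sum_le_hasSum _ (fun n _ => mul_nonneg (by positivity) (hc n)) hm
  have h4 : ∑ n ∈ Finset.range N, ((n : ℝ) + 1) * (Q n * z ^ (n + 1)) + δ ≤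
      ∑ n ∈ Finset.range N, ((n : ℝ) + 1) * (Q n * c 0 ^ (n + 1)) := by
    obtain ⟨N, rfl⟩ : ∃ k, N = k + 1 := ⟨N - 1, by omega⟩
    rw [Finset.sum_range_succ', Finset.sum_range_succ' (fun n : ℕ => ((n : ℝ) + 1) * (Q n * c 0 ^ (n + 1)))]
    have : ∑ n ∈ Finset.range N, (((n + 1 : ℕ) : ℝ) + 1) * (Q (n + 1) * z ^ (n + 1 + 1)) ≤
        ∑ n ∈ Finset.range N, (((n + 1 : ℕ) : ℝ) + 1) * (Q (n + 1) * c 0 ^ (n + 1 + 1)) := by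
      refine Finset.sum_le_sum fun n _ => ?_
      have := hQ.Q_pos (n + 1)
      have := hQ.z_pos
      gcongr
      linarith
    simp only [hQ.Q_zero, Nat.cast_zero, zero_add, pow_one, one_mul]
    linarith
  linarith [hN.1]

/-- No sign of μ is needed: if the series diverges, its remainders are 0 by convention. -/
theorem exists_mul_exp_neg_le (μ : ℝ) {ε : ℝ} (hε : 0 < ε) :
    ∃ N : ℕ, ∑' n : ℕ, ((n + N : ℕ) + 1 : ℝ) * Real.exp (-μ * (n + N : ℕ)) ≤ ε := by
  have := tendsto_sum_nat_add fun n : ℕ => ((n : ℝ) + 1) * Real.exp (-μ * n)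
  exact (this.eventually_le_const hε).exists

theorem summable_mul_exp_neg {μ : ℝ} (hμ : 0 < μ) :
    Summable fun n : ℕ => ((n : ℝ) + 1) * Real.exp (-μ * n) := by
  have h1 := Real.summable_pow_mul_exp_neg_nat_mul 1 hμ
  have h0 := Real.summable_pow_mul_exp_neg_nat_mul 0 hμ
  refine (h1.add h0).congr fun n => ?_
  simp only [pow_one, pow_zero]; ring

/-- Counterpart of `Profile.exists_le_dissip_of_large`: the comparison state now misses at least δ
of the mass. Exponential decay is needed because only finitely many sizes are compared, and mass at
large sizes would go unseen. -/
theorem Profile.exists_le_dissip_of_small (hQ : Profile zs B z ϱ Q) {C₁ δ μ M : ℝ} (hC₁ : 0 < C₁)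
    (hδ : 0 < δ) (hμ : 0 < μ) (hM : 0 ≤ M) :
    ∃ (N : ℕ) (ε : ℝ), 0 < ε ∧ ∀ a c : ℕ → ℝ, (∀ k, C₁ ≤ a k) → State ϱ μ M c → c 0 ≤ z - δ →
      ε ≤ ∑ n ∈ Finset.range N, dissip a Q c n := by
  -- M + 1 instead of M admits M = 0. One size more than `N₀` is compared below so that the monomers
  -- are always included.
  obtain ⟨N₀, hN₀⟩ := exists_mul_exp_neg_le μ (show 0 < δ / (2 * (M + 1)) by positivity)
  obtain ⟨L, hL, h⟩ := hQ.exists_sum_abs_sub_le hC₁ (N₀ + 1)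
  refine ⟨N₀ + 1, (δ / (2 * L)) ^ 2, by positivity, fun a c ha hc hc0 => ?_⟩
  refine le_of_half_le_mul_sqrt hδ hL ?_
  have hm := hc.mass
  have h1 := h a c ha hc.nonneg (le_of_hasMass' hc.nonneg hm)
  have h2 := le_abs_self (∑ n ∈ Finset.range (N₀ + 1), ((n : ℝ) + 1) * c n -
        ∑ n ∈ Finset.range (N₀ + 1), ((n : ℝ) + 1) * (Q n * c 0 ^ (n + 1)))
  have h3 : ϱ - δ / 2 ≤ ∑ n ∈ Finset.range N₀, ((n : ℝ) + 1) * c n := by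
    have e1 := hm.summable.sum_add_tsum_nat_add N₀
    rw [hm.tsum_eq] at e1
    have hs := ((summable_nat_add_iff N₀).2 (summable_mul_exp_neg hμ)).mul_left M
    have e2 : ∑' n : ℕ, (((n + N₀ : ℕ) : ℝ) + 1) * c (n + N₀) ≤
        ∑' n : ℕ, M * ((((n + N₀ : ℕ) : ℝ) + 1) * Real.exp (-μ * (n + N₀ : ℕ))) := by
      refine Summable.tsum_le_tsum (fun n => ?_) ((summable_nat_add_iff N₀).2 hm.summable) hs
      have := mul_le_mul_of_nonneg_left (hc.decay (n + N₀))
        (by positivity : (0 : ℝ) ≤ ((n + N₀ : ℕ) : ℝ) + 1)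
      linarith
    rw [tsum_mul_left] at e2
    have e3 := mul_le_mul_of_nonneg_left hN₀ hM
    have e4 : M * (δ / (2 * (M + 1))) ≤ δ / 2 := by
      rw [mul_div_assoc', div_le_div_iff₀ (by positivity) (by positivity)]; nlinarith
    linarith
  have h3' : ∑ n ∈ Finset.range N₀, ((n : ℝ) + 1) * c n ≤
      ∑ n ∈ Finset.range (N₀ + 1), ((n : ℝ) + 1) * c n := by
    rw [Finset.sum_range_succ]
    linarith [mul_nonneg (by positivity : (0 : ℝ) ≤ (N₀ : ℝ) + 1) (hc.nonneg N₀)]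
  have h5 : ∑ n ∈ Finset.range (N₀ + 1), ((n : ℝ) + 1) * (Q n * z ^ (n + 1)) ≤ ϱ :=
    sum_le_hasSum _ (fun n _ => mul_nonneg (by positivity) (hQ.eq_pos n).le) hQ.mass
  have h4 : ∑ n ∈ Finset.range (N₀ + 1), ((n : ℝ) + 1) * (Q n * c 0 ^ (n + 1)) + δ ≤
      ∑ n ∈ Finset.range (N₀ + 1), ((n : ℝ) + 1) * (Q n * z ^ (n + 1)) := by
    rw [Finset.sum_range_succ', Finset.sum_range_succ' (fun n : ℕ => ((n : ℝ) + 1) * (Q n * z ^ (n + 1)))]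
    have : ∑ n ∈ Finset.range N₀, (((n + 1 : ℕ) : ℝ) + 1) * (Q (n + 1) * c 0 ^ (n + 1 + 1)) ≤
        ∑ n ∈ Finset.range N₀, (((n + 1 : ℕ) : ℝ) + 1) * (Q (n + 1) * z ^ (n + 1 + 1)) := by
      refine Finset.sum_le_sum fun n _ => ?_
      have := hQ.Q_pos (n + 1)
      have := hc.nonneg 0
      gcongr
      linarith
    simp only [hQ.Q_zero, Nat.cast_zero, zero_add, pow_one, one_mul]
    linarith
  linarith

end

/-! ### Weighted spectral gap near equilibrium and the functional inequality -/

theorem add_one_rpow_le {x γ : ℝ} (hx : 0 ≤ x) (hγ0 : 0 ≤ γ) (hγ1 : γ ≤ 1) :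
    (x + 1) ^ γ ≤ x ^ γ + 1 := by
  lift x to ℝ≥0 using hx
  have := NNReal.rpow_add_le_add_rpow x 1 hγ0 hγ1
  rw [NNReal.one_rpow] at this
  exact_mod_cast this

theorem sq_sub_le_young {x y w s : ℝ} (hs : 0 < s) :
    (y - w) ^ 2 ≤ (1 + s) * (x - w) ^ 2 + (1 + 1 / s) * (x - y) ^ 2 := by
  have h : 0 ≤ (s * (x - w) + (x - y)) ^ 2 / s := by positivity
  have e : (s * (x - w) + (x - y)) ^ 2 / s =
      s * (x - w) ^ 2 + 2 * (x - w) * (x - y) + 1 / s * (x - y) ^ 2 := by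
    field_simp; ring
  nlinarith

section
variable {γ C₁ C₂ zs B z ϱ : ℝ} {Q : ℕ → ℝ}

theorem Profile.dissip_nonneg (hQ : Profile zs B z ϱ Q) {a : ℕ → ℝ} (ha : ∀ n, 0 ≤ a n)
    (c : ℕ → ℝ) (n : ℕ) : 0 ≤ dissip a Q c n :=
  mul_nonneg (mul_nonneg (ha n) (hQ.Q_pos n).le) (sq_nonneg _)

/-- Weighted spectral gap inequality around the detailed balance state with monomer density
`c 0`. -/
theorem Profile.exists_sum_le_dissip (hQ : Profile zs B z ϱ Q) (hγ0 : 0 ≤ γ) (hγ1 : γ < 1)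
    (hC₁ : 0 < C₁) :
    ∃ A : ℝ, 0 < A ∧ ∀ a c : ℕ → ℝ, Rates γ C₁ C₂ a → (∀ k, 0 ≤ c k) → 0 < c 0 →
      c 0 ≤ (z + zs) / 2 → ∀ N : ℕ,
      ∑ n ∈ Finset.range (N + 1), ((n : ℝ) + 1) ^ γ * (√(c n) - √(Q n * c 0 ^ (n + 1))) ^ 2 ≤
        A * ∑ n ∈ Finset.range N, dissip a Q c n := by
  have hz := hQ.z_pos
  have hzs := hQ.zs_pos
  -- θ bounds c 0 / zs, hence also c 0 * Q (n + 1) / Q n.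
  set θ := (z + zs) / (2 * zs) with hθ
  have hθ0 : 0 < θ := by positivity
  have hθ1 : θ < 1 := by rw [hθ, div_lt_one (by positivity)]; linarith [hQ.z_lt]
  -- This Young parameter keeps the contraction factor θ (1 + s) = (1 + θ)/2 below 1.
  set s := (1 - θ) / (2 * θ) with hs
  have hs0 : 0 < s := div_pos (by linarith) (by positivity)
  have hθs : θ * (1 + s) = (1 + θ) / 2 := by rw [hs]; field_simp; ring
  set κ := 1 / zs * (1 + 1 / s) with hκ
  have hκ0 : 0 < κ := by positivity
  refine ⟨3 / (1 - (1 + θ) / 2) ^ 2 * (κ / C₁), ?_, fun a c ha hc hc0 hcs N => ?_⟩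
  · have : 0 < 1 - (1 + θ) / 2 := by linarith
    positivity
  set y := c 0 with hy
  set g : ℕ → ℝ := fun n => Q n * (√(y * c n / Q n) - √(c (n + 1) / Q (n + 1))) ^ 2 with hg
  have hg0 : ∀ n, 0 ≤ g n := fun n => mul_nonneg (hQ.Q_pos n).le (sq_nonneg _)
  -- The state Q n * y ^ (n + 1) has no dissipation, so deviations from it are passed from n to n +
  -- 1 with factor y * Q (n + 1) / Q n, up to the n-th dissipation term divided by its rate.
  have hrec : ∀ n : ℕ, (√(c (n + 1)) - √(Q (n + 1) * y ^ (n + 1 + 1))) ^ 2 ≤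
      (1 + θ) / 2 * (√(c n) - √(Q n * y ^ (n + 1))) ^ 2 + κ * g n := by
    intro n
    have hq := hQ.Q_pos n
    have hq' := hQ.Q_pos (n + 1)
    have hcn := hc n
    have hcn' := hc (n + 1)
    have e1 : √(c (n + 1)) = √(Q (n + 1)) * √(c (n + 1) / Q (n + 1)) := by
      rw [← Real.sqrt_mul hq'.le, mul_div_cancel₀ _ hq'.ne']
    have e2 : √(Q (n + 1) * y ^ (n + 1 + 1)) = √(Q (n + 1)) * √(y * y ^ (n + 1)) := by
      rw [← Real.sqrt_mul hq'.le]; congr 1; ring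
    have e3 : √(y * c n / Q n) = √y / √(Q n) * √(c n) := by
      rw [← Real.sqrt_div hc0.le, ← Real.sqrt_mul (by positivity)]; congr 1; ring
    have e4 : √(y * y ^ (n + 1)) = √y / √(Q n) * √(Q n * y ^ (n + 1)) := by
      rw [← Real.sqrt_div hc0.le, ← Real.sqrt_mul (by positivity)]; congr 1; field_simp
    have h1 := sq_sub_le_young (x := √(y * c n / Q n)) (y := √(c (n + 1) / Q (n + 1)))
      (w := √(y * y ^ (n + 1))) hs0
    have h2 : (√(y * c n / Q n) - √(y * y ^ (n + 1))) ^ 2 =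
        y / Q n * (√(c n) - √(Q n * y ^ (n + 1))) ^ 2 := by
      rw [e3, e4, ← mul_sub, mul_pow, div_pow, Real.sq_sqrt hc0.le, Real.sq_sqrt hq.le]
    rw [e1, e2, ← mul_sub, mul_pow, Real.sq_sqrt hq'.le]
    have hqq : Q (n + 1) ≤ 1 / zs * Q n := by
      rw [one_div, inv_mul_eq_div, le_div_iff₀ hzs]; linarith [hQ.ratio_lower n]
    have h3 : Q (n + 1) * (y / Q n) ≤ θ := by
      calc Q (n + 1) * (y / Q n) ≤ 1 / zs * Q n * (y / Q n) := by gcongr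
        _ = y / zs := by field_simp
        _ ≤ (z + zs) / 2 / zs := by gcongr
        _ = θ := by rw [hθ]; field_simp
    set P := (√(c n) - √(Q n * y ^ (n + 1))) ^ 2 with hP
    set G := (√(y * c n / Q n) - √(c (n + 1) / Q (n + 1))) ^ 2 with hG
    have hP0 : 0 ≤ P := sq_nonneg _
    have hG0 : 0 ≤ G := sq_nonneg _
    calc Q (n + 1) * (√(c (n + 1) / Q (n + 1)) - √(y * y ^ (n + 1))) ^ 2
        ≤ Q (n + 1) * ((1 + s) * (y / Q n * P) + (1 + 1 / s) * G) := by
          rw [h2] at h1; gcongr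
      _ = Q (n + 1) * (y / Q n) * ((1 + s) * P) + Q (n + 1) * ((1 + 1 / s) * G) := by ring
      _ ≤ θ * ((1 + s) * P) + 1 / zs * Q n * ((1 + 1 / s) * G) := by gcongr
      _ = (1 + θ) / 2 * P + κ * g n := by simp only [← hθs, hκ, hg]; ring
  have hw : ∀ n : ℕ, (1 : ℝ) ≤ ((n : ℝ) + 1) ^ γ := fun n =>
    Real.one_le_rpow (by linarith [n.cast_nonneg (α := ℝ)]) hγ0
  have hw' : ∀ n : ℕ, (((n + 1 : ℕ) : ℝ) + 1) ^ γ ≤ ((n : ℝ) + 1) ^ γ + 1 := fun n => by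
    push_cast; exact add_one_rpow_le (by positivity) hγ0 hγ1.le
  -- The recursion starts at zero because the comparison state has the monomer density of `c`.
  have hp0 : (√(c 0) - √(Q 0 * y ^ (0 + 1))) ^ 2 = 0 := by
    rw [hQ.Q_zero]; simp [hy]
  refine (sum_weight_le_of_contraction (by linarith) (by linarith) hp0 (fun n => sq_nonneg _)
    (fun n => mul_nonneg hκ0.le (hg0 n)) hrec hw hw' N).trans ?_
  rw [mul_assoc]
  have h3 : 0 ≤ 3 / (1 - (1 + θ) / 2) ^ 2 := by positivity
  refine mul_le_mul_of_nonneg_left ?_ h3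
  rw [Finset.mul_sum]
  refine Finset.sum_le_sum fun n _ => ?_
  have h1 := ha.lower n
  have h2 : dissip a Q c n = a n * g n := by simp only [dissip, hg, hy]; ring
  rw [h2, div_mul_eq_mul_div, le_div_iff₀ hC₁]
  have := mul_le_mul_of_nonneg_right h1 (mul_nonneg hκ0.le (hg0 n))
  linarith

/-- Interpolation between the weighted spectral gap inequality and the exponential decay. -/
theorem Profile.exists_entropy_le_interpolation (hQ : Profile zs B z ϱ Q) (hγ0 : 0 ≤ γ)
    (hγ1 : γ < 1) (hC₁ : 0 < C₁) {μ M : ℝ} (hμ : 0 < μ) (hM : 0 ≤ M) :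
    ∃ A₁ A₂ lam : ℝ, 0 < A₁ ∧ 0 < A₂ ∧ 0 < lam ∧ ∀ a c : ℕ → ℝ, Rates γ C₁ C₂ a →
      State ϱ μ M c → z / 2 ≤ c 0 → c 0 ≤ (z + zs) / 2 →
      ∀ D : ℝ, (∀ N, ∑ n ∈ Finset.range N, dissip a Q c n ≤ D) → ∀ N : ℕ, 1 ≤ N →
      entropy Q z c ≤ A₁ * (N : ℝ) ^ (1 - γ) * D + A₂ * Real.exp (-lam * N) := by
  obtain ⟨K, hK, hlog⟩ := hQ.exists_log_le
  obtain ⟨A, hA, hgap⟩ := hQ.exists_sum_le_dissip (C₂ := C₂) hγ0 hγ1 hC₁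
  have hz := hQ.z_pos
  have hzs := hQ.zs_pos
  set θ := (z + zs) / 2 / zs with hθ
  have hθ0 : 0 < θ := by positivity
  have hθ1 : θ < 1 := by rw [hθ, div_lt_one (by positivity)]; linarith [hQ.z_lt]
  have hlogθ : 0 < -Real.log θ := by linarith [Real.log_neg hθ0 hθ1]
  -- Half of the common decay rate of `c` and ν; the other half makes `G` summable.
  set lam := min μ (-Real.log θ) / 2 with hlam
  have hlam0 : 0 < lam := by have := lt_min hμ hlogθ; positivity
  have hlam1 : 2 * lam ≤ μ := by rw [hlam]; linarith [min_le_left μ (-Real.log θ)]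
  have hlam2 : 2 * lam ≤ -Real.log θ := by rw [hlam]; linarith [min_le_right μ (-Real.log θ)]
  set E := 9 * K * (M + zs) with hE
  have hE0 : 0 < E := by positivity
  set G : ℕ → ℝ := fun n => E * (((n : ℝ) + 1) * Real.exp (-lam * n)) with hG
  have hGs : Summable G := (summable_mul_exp_neg hlam0).mul_left E
  have hG0 : ∀ n, 0 < G n := fun n => by positivity
  refine ⟨9 * K * A, ∑' n, G n, lam, by positivity, hGs.tsum_pos (fun n => (hG0 n).le) 0 (hG0 0),
    hlam0, fun a c ha hc hc0 hcs D hD N hN => ?_⟩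
  set y := c 0 with hy
  have hy0 : 0 < y := by linarith
  set p : ℕ → ℝ := fun n => (√(c n) - √(Q n * y ^ (n + 1))) ^ 2 with hp
  have hp0 : ∀ n, 0 ≤ p n := fun n => sq_nonneg _
  set f : ℕ → ℝ := fun n => 9 * (K * ((n : ℝ) + 1)) * p n with hf
  have hf0 : ∀ n, 0 ≤ f n := fun n => by have := hp0 n; positivity
  have hν0 : ∀ n : ℕ, 0 < Q n * y ^ (n + 1) := fun n => mul_pos (hQ.Q_pos n) (pow_pos hy0 _)
  have hent : ∀ n, ent (c n) (Q n * y ^ (n + 1)) ≤ f n := fun n => by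
    refine ent_le_sq_sqrt_sub (hc.nonneg n) (hν0 n) ?_
      (hlog _ _ n (hc.nonneg n) (le_of_hasMass' hc.nonneg hc.mass n) hc0)
    nlinarith [n.cast_nonneg (α := ℝ)]
  have hdecay : ∀ n : ℕ, p n ≤ (M + zs) * Real.exp (-(2 * lam) * n) := by
    intro n
    refine (sq_sqrt_sub_sqrt_le_add (hc.nonneg n) (hν0 n).le).trans ?_
    rw [add_mul]
    refine add_le_add ((hc.decay n).trans ?_) ?_
    · refine mul_le_mul_of_nonneg_left (Real.exp_le_exp.2 ?_) hM
      nlinarith [n.cast_nonneg (α := ℝ)]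
    · have h1 : y ^ (n + 1) ≤ (θ * zs) ^ (n + 1) := by
        refine pow_le_pow_left₀ hy0.le ?_ _
        rw [hθ, div_mul_cancel₀ _ hzs.ne']; exact hcs
      have h2 : θ ^ (n + 1) ≤ Real.exp (-(2 * lam) * n) := by
        calc θ ^ (n + 1) ≤ θ ^ n := pow_le_pow_of_le_one hθ0.le hθ1.le n.le_succ
          _ = Real.exp (Real.log θ * n) := by
            rw [← Real.rpow_natCast, Real.rpow_def_of_pos hθ0]
          _ ≤ _ := Real.exp_le_exp.2 (by
            have := mul_le_mul_of_nonneg_right hlam2 (n.cast_nonneg (α := ℝ)); linarith)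
      calc Q n * y ^ (n + 1) ≤ Q n * (θ * zs) ^ (n + 1) :=
            mul_le_mul_of_nonneg_left h1 (hQ.Q_pos n).le
        _ = (Q n * zs ^ n) * (zs * θ ^ (n + 1)) := by rw [mul_pow, pow_succ zs]; ring
        _ ≤ 1 * (zs * Real.exp (-(2 * lam) * n)) := by
          refine mul_le_mul (hQ.Q_mul_pow_le n) ?_ (by positivity) zero_le_one
          gcongr
        _ = _ := one_mul _
  have hfG : ∀ n : ℕ, f n ≤ G n * Real.exp (-lam * n) := by
    intro n
    have e : Real.exp (-(2 * lam) * n) = Real.exp (-lam * n) * Real.exp (-lam * n) := by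
      rw [← Real.exp_add]; congr 1; ring
    have h1 := mul_le_mul_of_nonneg_left (hdecay n)
      (by positivity : 0 ≤ 9 * (K * ((n : ℝ) + 1)))
    rw [e] at h1
    refine h1.trans (le_of_eq ?_)
    simp only [hG, hE]; ring
  have hexp1 : ∀ n : ℕ, Real.exp (-lam * n) ≤ 1 := fun n =>
    Real.exp_le_one_iff.2 (by nlinarith [n.cast_nonneg (α := ℝ)])
  have hfs : Summable f := Summable.of_nonneg_of_le hf0
    (fun n => (hfG n).trans (mul_le_of_le_one_right (hG0 n).le (hexp1 n))) hGs
  have hX := hQ.entropy_le_of_le hy0 hc.nonneg hc.mass hent hfs.hasSum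
  refine hX.trans ?_
  rw [← hfs.sum_add_tsum_nat_add N]
  refine add_le_add ?_ ?_
  · obtain ⟨N, rfl⟩ : ∃ k, N = k + 1 := ⟨N - 1, by omega⟩
    have h1 := (hgap a c ha hc.nonneg hy0 hcs N).trans (mul_le_mul_of_nonneg_left (hD N) hA.le)
    have h2 : ∑ n ∈ Finset.range (N + 1), f n ≤
        9 * K * ((N + 1 : ℕ) : ℝ) ^ (1 - γ) *
          ∑ n ∈ Finset.range (N + 1), ((n : ℝ) + 1) ^ γ * p n := by
      rw [Finset.mul_sum]
      refine Finset.sum_le_sum fun n hn => ?_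
      have hn' : (n : ℝ) + 1 ≤ ((N + 1 : ℕ) : ℝ) := by
        exact_mod_cast Finset.mem_range.1 hn
      -- The weight lacking in the spectral gap estimate costs at most the (1 - γ)-th power of the
      -- cut-off.
      have h3 : (n : ℝ) + 1 ≤ ((N + 1 : ℕ) : ℝ) ^ (1 - γ) * ((n : ℝ) + 1) ^ γ := by
        calc (n : ℝ) + 1 = ((n : ℝ) + 1) ^ (1 - γ) * ((n : ℝ) + 1) ^ γ := by
              rw [← Real.rpow_add (by positivity)]; simp
          _ ≤ _ := by gcongr
      have := mul_le_mul_of_nonneg_left h3 (by have := hp0 n; positivity : 0 ≤ 9 * K * p n)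
      calc f n = 9 * K * p n * ((n : ℝ) + 1) := by simp only [hf]; ring
        _ ≤ _ := this
        _ = _ := by ring
    refine h2.trans ?_
    have := mul_le_mul_of_nonneg_left h1
      (by positivity : 0 ≤ 9 * K * ((N + 1 : ℕ) : ℝ) ^ (1 - γ))
    refine this.trans (le_of_eq (by ring))
  · have hs1 := (summable_nat_add_iff N).2 hfs
    have hs2 := (summable_nat_add_iff N).2 hGs
    calc ∑' n, f (n + N) ≤ ∑' n, G (n + N) * Real.exp (-lam * N) := by
          refine Summable.tsum_le_tsum (fun n => (hfG _).trans ?_) hs1 (hs2.mul_right _)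
          refine mul_le_mul_of_nonneg_left (Real.exp_le_exp.2 ?_) (hG0 _).le
          push_cast; nlinarith [n.cast_nonneg (α := ℝ)]
      _ = (∑' n, G (n + N)) * Real.exp (-lam * N) := tsum_mul_right
      _ ≤ _ := by
        refine mul_le_mul_of_nonneg_right ?_ (Real.exp_pos _).le
        rw [← hGs.sum_add_tsum_nat_add N]
        have := Finset.sum_nonneg fun n (_ : n ∈ Finset.range N) => (hG0 n).le
        linarith

/-- The functional inequality between entropy and dissipation. -/
theorem Profile.exists_functional_inequality (hQ : Profile zs B z ϱ Q) (hγ0 : 0 ≤ γ)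
    (hγ1 : γ < 1) (hC₁ : 0 < C₁) {μ M : ℝ} (hμ : 0 < μ) (hM : 0 ≤ M) :
    ∃ K₁ K₂ ε : ℝ, 0 < K₁ ∧ 0 < K₂ ∧ 0 < ε ∧
      (∀ c : ℕ → ℝ, (∀ n, 0 ≤ c n) → HasSum (fun n : ℕ => ((n : ℝ) + 1) * c n) ϱ →
        K₂ * entropy Q z c ≤ Real.exp (-1)) ∧
      ∀ a c : ℕ → ℝ, Rates γ C₁ C₂ a → State ϱ μ M c → ∀ D : ℝ,
        (∀ N, ∑ n ∈ Finset.range N, dissip a Q c n ≤ D) → 0 < entropy Q z c →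
        min (K₁ * entropy Q z c / |Real.log (K₂ * entropy Q z c)| ^ (1 - γ)) ε ≤ D := by
  obtain ⟨H₁, hH₁, hH⟩ := hQ.exists_entropy_le
  obtain ⟨A₁, A₂, lam, hA₁, hA₂, hlam, hint⟩ :=
    hQ.exists_entropy_le_interpolation (C₂ := C₂) hγ0 hγ1 hC₁ hμ hM
  have hz := hQ.z_pos
  have hzlt := hQ.z_lt
  obtain ⟨N₁, ε₁, hε₁, hlarge⟩ := hQ.exists_le_dissip_of_large hC₁
    (show 0 < (zs - z) / 2 by linarith)
  obtain ⟨N₂, ε₂, hε₂, hsmall⟩ := hQ.exists_le_dissip_of_small hC₁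
    (show 0 < z / 2 by linarith) hμ hM
  set ℓ₀ := max 1 lam with hℓ₀
  -- The second summand forces K₂ H ≤ exp (-ℓ₀), so ℓ = -log (K₂ H) is at least 1 and at least
  -- `lam`. The first gives A₂ K₂ H ≤ H/2, so the exponential remainder can be absorbed.
  set A₃ := A₂ + H₁ * Real.exp ℓ₀ with hA₃
  have hA₃0 : 0 < A₃ := by positivity
  set K₂ := 1 / (2 * A₃) with hK₂
  have hK₂0 : 0 < K₂ := by positivity
  have hbound : ∀ c : ℕ → ℝ, (∀ n, 0 ≤ c n) → HasSum (fun n : ℕ => ((n : ℝ) + 1) * c n) ϱ →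
        K₂ * entropy Q z c ≤ Real.exp (-ℓ₀) := fun c hc hm => by
    have h1 := (hH c hc hm).2.2
    rw [hK₂, div_mul_eq_mul_div, div_le_iff₀ (by positivity), one_mul, hA₃]
    have : Real.exp (-ℓ₀) * Real.exp ℓ₀ = 1 := by rw [← Real.exp_add]; simp
    have h2 : 0 < Real.exp (-ℓ₀) * A₂ := by positivity
    calc entropy Q z c ≤ 2 * H₁ * 1 := by linarith
      _ = 2 * H₁ * (Real.exp (-ℓ₀) * Real.exp ℓ₀) := by rw [this]
      _ ≤ _ := by nlinarith
  refine ⟨1 / (2 * A₁ * (2 / lam) ^ (1 - γ)), K₂, min ε₁ ε₂, by positivity, hK₂0,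
    lt_min hε₁ hε₂, fun c hc hm => (hbound c hc hm).trans
      (Real.exp_le_exp.2 (neg_le_neg (le_max_left _ _))), fun a c ha hc D hD hpos => ?_⟩
  have ha1 := ha.const_le hγ0 hC₁
  rcases le_or_gt (z + (zs - z) / 2) (c 0) with h | h
  · exact (min_le_right _ _).trans ((min_le_left _ _).trans
      ((hlarge a c ha1 hc.nonneg hc.mass h).trans (hD _)))
  rcases le_or_gt (c 0) (z - z / 2) with h' | h'
  · exact (min_le_right _ _).trans ((min_le_right _ _).trans
      ((hsmall a c ha1 hc h').trans (hD _)))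
  refine (min_le_left _ _).trans ?_
  set H := entropy Q z c with hHdef
  have hKH : 0 < K₂ * H := by positivity
  set ℓ := -Real.log (K₂ * H) with hℓ
  have hℓℓ : ℓ₀ ≤ ℓ := by
    have := Real.log_le_log hKH (hbound c hc.nonneg hc.mass)
    rw [Real.log_exp] at this; linarith
  have hℓ1 : 1 ≤ ℓ := (le_max_left _ _).trans hℓℓ
  have hℓ2 : lam ≤ ℓ := (le_max_right _ _).trans hℓℓ
  have habs : |Real.log (K₂ * H)| = ℓ := by
    rw [abs_of_nonpos (by linarith)]
  rw [habs]
  -- The smallest cut-off with exp (-lam N) ≤ K₂ H; rounding at most doubles ℓ / lam because ℓ ≥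
  -- lam.
  set N := ⌈ℓ / lam⌉₊ with hN
  have hN1 : ℓ / lam ≤ N := Nat.le_ceil _
  have hone : 1 ≤ ℓ / lam := by rw [le_div_iff₀ hlam]; linarith
  have hN2 : (N : ℝ) ≤ 2 / lam * ℓ := by
    have := (Nat.ceil_lt_add_one (by positivity : 0 ≤ ℓ / lam)).le
    calc (N : ℝ) ≤ ℓ / lam + 1 := this
      _ ≤ ℓ / lam + ℓ / lam := by linarith
      _ = _ := by ring
  have hN3 : 1 ≤ N := by exact_mod_cast (hone.trans hN1)
  have hD0 : 0 ≤ D := by simpa using hD 0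
  have h1 := hint a c ha hc (by linarith) (by linarith) D hD N hN3
  have h2 : A₂ * Real.exp (-lam * N) ≤ H / 2 := by
    have e1 : Real.exp (-lam * N) ≤ K₂ * H := by
      rw [← Real.exp_log hKH]
      refine Real.exp_le_exp.2 ?_
      rw [div_le_iff₀ hlam] at hN1
      linarith
    have e2 : A₃ * (K₂ * H) = H / 2 := by rw [hK₂]; field_simp
    have e3 : A₂ ≤ A₃ := by rw [hA₃]; have := mul_pos hH₁ (Real.exp_pos ℓ₀); linarith
    calc A₂ * Real.exp (-lam * N) ≤ A₃ * (K₂ * H) := by gcongr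
      _ = _ := e2
  have h3 : (N : ℝ) ^ (1 - γ) ≤ (2 / lam) ^ (1 - γ) * ℓ ^ (1 - γ) := by
    rw [← Real.mul_rpow (by positivity) (by positivity)]
    exact Real.rpow_le_rpow (by positivity) hN2 (by linarith)
  have h4 : A₁ * (N : ℝ) ^ (1 - γ) * D ≤ A₁ * ((2 / lam) ^ (1 - γ) * ℓ ^ (1 - γ)) * D := by gcongr
  have hℓp : 0 < ℓ ^ (1 - γ) := Real.rpow_pos_of_pos (by linarith) _
  rw [div_le_iff₀ hℓp, div_mul_eq_mul_div, div_le_iff₀ (by positivity)]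
  linarith

end

/-! ### Solutions: termwise differentiation, tails and conservation of mass -/

/-- The net rate of attachment, in terms of the detailed balance coefficients. -/
noncomputable def flux (a Q c : ℕ → ℝ) (n : ℕ) : ℝ :=
  a n * (c 0 * c n - Q n / Q (n + 1) * c (n + 1))

/-- The number of clusters of size at least `n + 1`. -/
noncomputable def tail (c : ℕ → ℝ) (n : ℕ) : ℝ := ∑' m, c (m + n)

/-- Solutions of the Becker-Döring equations, indexed by `n` for the cluster size `n + 1`. -/
structure Sol (a Q : ℕ → ℝ) (c : ℝ → ℕ → ℝ) : Prop where
  nonneg : ∀ t, 0 ≤ t → ∀ n, 0 ≤ c t n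
  summable : ∀ t, 0 ≤ t → Summable fun n : ℕ => ((n : ℝ) + 1) * c t n
  mass_le : ∀ T, ∃ R : ℝ, 0 ≤ R ∧ ∀ t ∈ Set.Icc 0 T, ∑' n : ℕ, ((n : ℝ) + 1) * c t n ≤ R
  deriv_succ : ∀ t, 0 ≤ t → ∀ n, HasDerivWithinAt (fun s => c s (n + 1))
    (flux a Q (c t) n - flux a Q (c t) (n + 1)) (Set.Ici 0) t
  deriv_zero : ∀ t, 0 ≤ t → HasDerivWithinAt (fun s => c s 0)
    (-flux a Q (c t) 0 - ∑' k, flux a Q (c t) k) (Set.Ici 0) t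

section calculus

theorem sub_le_of_deriv_le {f f' : ℝ → ℝ} {s t K : ℝ} (hs : 0 ≤ s) (hst : s ≤ t)
    (hf : ∀ x ∈ Set.Icc s t, HasDerivWithinAt f (f' x) (Set.Ici 0) x)
    (hK : ∀ x ∈ Set.Icc s t, f' x ≤ K) : f t - f s ≤ K * (t - s) := by
  have hB : ∀ x, HasDerivAt (fun x => f s + K * (x - s)) K x := fun x => by
    simpa using (((hasDerivAt_id x).sub_const s).const_mul K).const_add (f s)
  have := image_le_of_deriv_right_le_deriv_boundary (f := f) (f' := f') (a := s) (b := t)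
    (B := fun x => f s + K * (x - s)) (B' := fun _ => K)
    (fun x hx => (hf x hx).continuousWithinAt.mono fun y hy => hs.trans hy.1)
    (fun x hx => (hf x ⟨hx.1, hx.2.le⟩).mono fun y hy => hs.trans (hx.1.trans hy)) (by simp)
    (fun x _ => (hB x).continuousAt.continuousWithinAt) (fun x _ => (hB x).hasDerivWithinAt)
    (fun x hx => hK x ⟨hx.1, hx.2.le⟩) (x := t) ⟨hst, le_rfl⟩
  linarith

/-- Raising the barrier to A + ε (1 + t) makes its slope strictly larger than that of `f` at
contact; then ε tends to 0. -/
theorem le_of_deriv_nonpos_above {f f' : ℝ → ℝ} {T A : ℝ}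
    (hf : ∀ x ∈ Set.Icc 0 T, HasDerivWithinAt f (f' x) (Set.Ici 0) x) (h0 : f 0 ≤ A)
    (h : ∀ x ∈ Set.Icc 0 T, A ≤ f x → f' x ≤ 0) : ∀ t ∈ Set.Icc 0 T, f t ≤ A := by
  intro t ht
  have key : ∀ ε : ℝ, 0 < ε → f t ≤ A + ε * (1 + t) := by
    intro ε hε
    have hB : ∀ x, HasDerivAt (fun x => A + ε * (1 + x)) ε x := fun x => by
      simpa using (((hasDerivAt_id x).const_add 1).const_mul ε).const_add A
    refine image_le_of_deriv_right_lt_deriv_boundary (f := f) (f' := f') (a := 0) (b := T)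
      (fun x hx => (hf x hx).continuousWithinAt.mono fun y hy => hy.1)
      (fun x hx => (hf x ⟨hx.1, hx.2.le⟩).mono fun y hy => hx.1.trans hy) ?_ hB
      (fun x hx hfx => ?_) ht
    · linarith
    · have : 0 ≤ ε * (1 + x) := mul_nonneg hε.le (by linarith [hx.1])
      exact (h x ⟨hx.1, hx.2.le⟩ (by linarith)).trans_lt hε
  have hlim : Tendsto (fun ε : ℝ => A + ε * (1 + t)) (𝓝[>] 0) (𝓝 (A + 0 * (1 + t))) :=
    Tendsto.mono_left (by fun_prop : Continuous fun ε : ℝ => A + ε * (1 + t)).continuousAt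
      nhdsWithin_le_nhds
  have := ge_of_tendsto hlim (eventually_mem_nhdsWithin.mono key)
  linarith

/-- The mean value inequality for f N - f M, as M tends to infinity, makes f N - g Lipschitz with
constant ε N. No continuity of the derivatives is needed. -/
theorem hasDerivWithinAt_of_uniform_limit {f f' : ℕ → ℝ → ℝ} {g g' : ℝ → ℝ} {s : Set ℝ}
    {ε : ℕ → ℝ} (hs : Convex ℝ s) (hf : ∀ N, ∀ t ∈ s, HasDerivWithinAt (f N) (f' N t) s t)
    (hε : ∀ N, ∀ t ∈ s, |f' N t - g' t| ≤ ε N) (hε0 : Tendsto ε atTop (𝓝 0))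
    (hg : ∀ t ∈ s, Tendsto (fun N => f N t) atTop (𝓝 (g t))) :
    ∀ t ∈ s, HasDerivWithinAt g (g' t) s t := by
  intro x hx
  have key : ∀ N, ∀ y ∈ s, |(f N y - g y) - (f N x - g x)| ≤ ε N * |y - x| := by
    intro N y hy
    have h1 : ∀ M, |(f N y - f M y) - (f N x - f M x)| ≤ (ε N + ε M) * |y - x| := by
      intro M
      refine hs.norm_image_sub_le_of_norm_hasDerivWithin_le (f := fun t => f N t - f M t)
        (f' := fun t => f' N t - f' M t) (fun t ht => (hf N t ht).sub (hf M t ht))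
        (fun t ht => ?_) hx hy
      have e : f' N t - f' M t = (f' N t - g' t) - (f' M t - g' t) := by ring
      rw [Real.norm_eq_abs, e]
      exact (abs_sub _ _).trans (add_le_add (hε N t ht) (hε M t ht))
    have l1 : Tendsto (fun M => |(f N y - f M y) - (f N x - f M x)|) atTop
        (𝓝 |(f N y - g y) - (f N x - g x)|) :=
      ((tendsto_const_nhds.sub (hg y hy)).sub (tendsto_const_nhds.sub (hg x hx))).abs
    have l2 : Tendsto (fun M => (ε N + ε M) * |y - x|) atTop (𝓝 ((ε N + 0) * |y - x|)) :=
      (tendsto_const_nhds.add hε0).mul tendsto_const_nhds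
    simpa using le_of_tendsto_of_tendsto' l1 l2 h1
  rw [hasDerivWithinAt_iff_isLittleO, Asymptotics.isLittleO_iff]
  intro η hη
  obtain ⟨N, hN⟩ := (hε0.eventually_le_const (show 0 < η / 3 by positivity)).exists
  have h1 := Asymptotics.isLittleO_iff.1 (hasDerivWithinAt_iff_isLittleO.1 (hf N x hx))
    (show 0 < η / 3 by positivity)
  filter_upwards [h1, self_mem_nhdsWithin] with y hy1 hy2
  have h2 := key N y hy2
  have h3 := hε N x hx
  simp only [smul_eq_mul, Real.norm_eq_abs] at hy1 ⊢
  have e : g y - g x - (y - x) * g' x = (f N y - f N x - (y - x) * f' N x) -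
      ((f N y - g y) - (f N x - g x)) + (y - x) * (f' N x - g' x) := by ring
  rw [e]
  have h4 : |(y - x) * (f' N x - g' x)| ≤ η / 3 * |y - x| := by
    rw [abs_mul, mul_comm]; exact mul_le_mul_of_nonneg_right (h3.trans hN) (abs_nonneg _)
  have h5 : ε N * |y - x| ≤ η / 3 * |y - x| := mul_le_mul_of_nonneg_right hN (abs_nonneg _)
  refine (abs_add_le _ _).trans ?_
  have := abs_sub (f N y - f N x - (y - x) * f' N x) ((f N y - g y) - (f N x - g x))
  linarith

theorem HasDerivWithinAt.Ici_of_Icc {f : ℝ → ℝ} {f' t : ℝ}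
    (h : HasDerivWithinAt f f' (Set.Icc 0 (t + 1)) t) : HasDerivWithinAt f f' (Set.Ici 0) t := by
  refine h.mono_of_mem_nhdsWithin ?_
  have : Set.Ici (0 : ℝ) ∩ Set.Iio (t + 1) ∈ 𝓝[Set.Ici 0] t :=
    inter_mem_nhdsWithin _ (Iio_mem_nhds (by linarith))
  exact Filter.mem_of_superset this fun y hy => ⟨hy.1, hy.2.le⟩

end calculus

section tail
variable {ϱ : ℝ} {c : ℕ → ℝ}

theorem tail_nonneg (hc : ∀ n, 0 ≤ c n) (n : ℕ) : 0 ≤ tail c n := tsum_nonneg fun _ => hc _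

theorem tail_eq_add (hs : Summable c) (n : ℕ) : tail c n = c n + tail c (n + 1) := by
  have := ((summable_nat_add_iff n).2 hs).tsum_eq_zero_add
  simp only [zero_add] at this
  rw [tail, this, tail]
  congr 2; ext m; congr 1; omega

theorem le_tail (hc : ∀ n, 0 ≤ c n) (hs : Summable c) (n : ℕ) : c n ≤ tail c n := by
  rw [tail_eq_add hs]; linarith [tail_nonneg hc (n + 1)]

theorem tail_succ_le (hc : ∀ n, 0 ≤ c n) (hs : Summable c) (n : ℕ) : tail c (n + 1) ≤ tail c n := by
  rw [tail_eq_add hs n]; linarith [hc n]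

theorem tail_le_of_hasMass (hc : ∀ n, 0 ≤ c n)
    (hm : HasSum (fun n : ℕ => ((n : ℝ) + 1) * c n) ϱ) (n : ℕ) : tail c n ≤ ϱ := by
  have hs := summable_of_hasMass hc hm
  have h0 : tail c n ≤ tail c 0 := antitone_nat_of_succ_le (tail_succ_le hc hs) n.zero_le
  refine h0.trans (hasSum_le (fun m => ?_) hs.hasSum hm)
  nlinarith [hc m, mul_nonneg (m.cast_nonneg (α := ℝ)) (hc m)]

theorem sum_tail_eq (hs : Summable c) (N : ℕ) :
    ∑ k ∈ Finset.range N, tail c k =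
      ∑ n ∈ Finset.range N, ((n : ℝ) + 1) * c n + N * tail c N := by
  induction N with
  | zero => simp
  | succ N ih =>
    rw [Finset.sum_range_succ, Finset.sum_range_succ, ih, tail_eq_add hs N]; push_cast; ring

/-- Abel summation writes the mass as the sum of all tails; the boundary term N * tail c N is
dominated by a remainder of the mass series. -/
theorem tendsto_sum_tail (hc : ∀ n, 0 ≤ c n)
    (hm : HasSum (fun n : ℕ => ((n : ℝ) + 1) * c n) ϱ) :
    Tendsto (fun N => ∑ k ∈ Finset.range N, tail c k) atTop (𝓝 ϱ) := by
  have hs := summable_of_hasMass hc hm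
  simp only [sum_tail_eq hs]
  have h0 : Tendsto (fun N : ℕ => (N : ℝ) * tail c N) atTop (𝓝 0) := by
    refine squeeze_zero (fun N => mul_nonneg N.cast_nonneg (tail_nonneg hc N)) (fun N => ?_)
      (tendsto_sum_nat_add fun n : ℕ => ((n : ℝ) + 1) * c n)
    rw [tail, ← tsum_mul_left]
    refine Summable.tsum_le_tsum (fun n => ?_) (((summable_nat_add_iff N).2 hs).mul_left _)
      ((summable_nat_add_iff N).2 hm.summable)
    refine mul_le_mul_of_nonneg_right ?_ (hc _)
    push_cast; linarith [n.cast_nonneg (α := ℝ)]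
  simpa using hm.tendsto_sum_nat.add h0

end tail

section flux
variable {γ C₁ C₂ zs B z ϱ R : ℝ} {a Q c : ℕ → ℝ}

theorem tendsto_add_one_rpow_sub_one (hγ1 : γ < 1) :
    Tendsto (fun N : ℕ => ((N : ℝ) + 1) ^ (γ - 1)) atTop (𝓝 0) := by
  have h := (tendsto_rpow_neg_atTop (show 0 < 1 - γ by linarith)).comp
    (tendsto_atTop_add_const_right _ (1 : ℝ) (tendsto_natCast_atTop_atTop (R := ℝ)))
  refine h.congr fun N => ?_
  simp only [Function.comp, neg_sub]

theorem abs_flux_le (hQ : Profile zs B z ϱ Q) (ha : Rates γ C₁ C₂ a) (hγ0 : 0 ≤ γ)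
    (hC₁ : 0 < C₁) (hc : ∀ n, 0 ≤ c n) (hR : c 0 ≤ R) (n : ℕ) :
    |flux a Q c n| ≤ C₂ * (R + B) * (((n : ℝ) + 1) ^ γ * (c n + c (n + 1))) := by
  have hR0 : 0 ≤ R := (hc 0).trans hR
  have hB := hQ.B_pos
  have hr := hQ.ratio_mem n
  have hr0 : 0 ≤ Q n / Q (n + 1) := hQ.zs_pos.le.trans hr.1
  have ha0 := (ha.pos hγ0 hC₁ n).le
  have h1 : c 0 * c n ≤ R * c n := mul_le_mul_of_nonneg_right hR (hc n)
  have h2 : Q n / Q (n + 1) * c (n + 1) ≤ B * c (n + 1) :=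
    mul_le_mul_of_nonneg_right hr.2 (hc _)
  have h3 : |c 0 * c n - Q n / Q (n + 1) * c (n + 1)| ≤ (R + B) * (c n + c (n + 1)) := by
    have h4 := mul_nonneg (hc 0) (hc n)
    have h5 := mul_nonneg hr0 (hc (n + 1))
    have h6 := mul_nonneg hR0 (hc (n + 1))
    have h7 := mul_nonneg hB.le (hc n)
    have h8 := mul_nonneg hR0 (hc n)
    have h9 := mul_nonneg hB.le (hc (n + 1))
    rw [abs_le]; constructor <;> nlinarith
  rw [flux, abs_mul, abs_of_nonneg ha0]
  calc a n * |c 0 * c n - Q n / Q (n + 1) * c (n + 1)|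
      ≤ (C₂ * ((n : ℝ) + 1) ^ γ) * ((R + B) * (c n + c (n + 1))) :=
        mul_le_mul (ha.upper n) h3 (abs_nonneg _) (ha0.trans (ha.upper n))
    _ = _ := by ring

/-- The rates grow like (n + 1)^γ, while the mass controls the weight n + 1. The difference gives (N
+ 1)^(γ-1), uniformly over sequences of bounded mass. -/
theorem summable_flux_and_tsum_le (hQ : Profile zs B z ϱ Q) (ha : Rates γ C₁ C₂ a) (hγ0 : 0 ≤ γ)
    (hγ1 : γ ≤ 1) (hC₁ : 0 < C₁) (hC₂ : 0 < C₂) (hc : ∀ n, 0 ≤ c n)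
    (hs : Summable fun n : ℕ => ((n : ℝ) + 1) * c n)
    (hR : ∑' n : ℕ, ((n : ℝ) + 1) * c n ≤ R) :
    Summable (fun n => |flux a Q c n|) ∧
      ∀ N : ℕ, ∑' n, |flux a Q c (n + N)| ≤ 2 * C₂ * (R + B) * R * ((N : ℝ) + 1) ^ (γ - 1) := by
  have hm := hs.hasSum
  have hB := hQ.B_pos
  have hR0 : c 0 ≤ R := (le_of_hasMass' hc hm 0).trans hR
  have hR00 : 0 ≤ R := (hc 0).trans hR0
  have hRB : 0 < R + B := by linarith
  set g : ℕ → ℝ := fun n => ((n : ℝ) + 1) * c n + (((n + 1 : ℕ) : ℝ) + 1) * c (n + 1) with hg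
  have hgs : Summable g := hs.add ((summable_nat_add_iff 1).2 hs)
  have hterm : ∀ n : ℕ, 0 ≤ ((n : ℝ) + 1) * c n := fun n => mul_nonneg (by positivity) (hc n)
  have hg0 : ∀ n, 0 ≤ g n := fun n => add_nonneg (hterm n) (hterm (n + 1))
  have hgsum : ∑' n, g n ≤ 2 * R := by
    rw [hs.tsum_add ((summable_nat_add_iff 1).2 hs)]
    have := hs.tsum_eq_zero_add
    have := hterm 0
    linarith
  have hbd : ∀ N n : ℕ, N ≤ n → |flux a Q c n| ≤ C₂ * (R + B) * ((N : ℝ) + 1) ^ (γ - 1) * g n := by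
    intro N n hNn
    refine (abs_flux_le hQ ha hγ0 hC₁ hc hR0 n).trans ?_
    rw [mul_assoc (C₂ * (R + B))]
    refine mul_le_mul_of_nonneg_left ?_ (by positivity)
    have h1 : ((n : ℝ) + 1) ^ γ ≤ ((N : ℝ) + 1) ^ (γ - 1) * ((n : ℝ) + 1) := by
      calc ((n : ℝ) + 1) ^ γ = ((n : ℝ) + 1) ^ (γ - 1) * ((n : ℝ) + 1) := by
            rw [← Real.rpow_add_one (by positivity)]; simp
        _ ≤ _ := by
          refine mul_le_mul_of_nonneg_right ?_ (by positivity)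
          refine Real.rpow_le_rpow_of_nonpos (by positivity) ?_ (by linarith)
          have : (N : ℝ) ≤ n := by exact_mod_cast hNn
          linarith
    have h2 : ((n : ℝ) + 1) * (c n + c (n + 1)) ≤ g n := by
      simp only [hg]; push_cast; linarith [hc (n + 1)]
    calc ((n : ℝ) + 1) ^ γ * (c n + c (n + 1))
        ≤ ((N : ℝ) + 1) ^ (γ - 1) * ((n : ℝ) + 1) * (c n + c (n + 1)) :=
          mul_le_mul_of_nonneg_right h1 (add_nonneg (hc _) (hc _))
      _ ≤ _ := by rw [mul_assoc]; gcongr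
  have hfs : Summable fun n => |flux a Q c n| :=
    Summable.of_nonneg_of_le (fun n => abs_nonneg _) (fun n => hbd 0 n n.zero_le)
      (hgs.mul_left _)
  refine ⟨hfs, fun N => ?_⟩
  have h1 : ∑' n, |flux a Q c (n + N)| ≤
      ∑' n, C₂ * (R + B) * ((N : ℝ) + 1) ^ (γ - 1) * g (n + N) :=
    Summable.tsum_le_tsum (fun n => hbd N _ (Nat.le_add_left _ _))
      ((summable_nat_add_iff N).2 hfs) (((summable_nat_add_iff N).2 hgs).mul_left _)
  rw [tsum_mul_left] at h1
  have h2 : ∑' n, g (n + N) ≤ 2 * R := by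
    have := hgs.sum_add_tsum_nat_add N
    have := Finset.sum_nonneg fun n (_ : n ∈ Finset.range N) => hg0 n
    linarith
  have h3 := mul_le_mul_of_nonneg_left h2
    (by positivity : 0 ≤ C₂ * (R + B) * ((N : ℝ) + 1) ^ (γ - 1))
  linarith

end flux

section solution
variable {γ C₁ C₂ zs B z ϱ : ℝ} {a Q : ℕ → ℝ} {c : ℝ → ℕ → ℝ}

/-- On bounded time intervals, the remainders of the series of net rates tend to zero uniformly. -/
theorem Sol.exists_flux_bound (hQ : Profile zs B z ϱ Q) (ha : Rates γ C₁ C₂ a) (hγ0 : 0 ≤ γ)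
    (hγ1 : γ < 1) (hC₁ : 0 < C₁) (hC₂ : 0 < C₂) (hc : Sol a Q c) (T : ℝ) :
    ∃ δ : ℕ → ℝ, Tendsto δ atTop (𝓝 0) ∧ ∀ t ∈ Set.Icc 0 T,
      Summable (fun n => |flux a Q (c t) n|) ∧ ∀ N, ∑' n, |flux a Q (c t) (n + N)| ≤ δ N := by
  obtain ⟨R, hR0, hR⟩ := hc.mass_le T
  refine ⟨fun N => 2 * C₂ * (R + B) * R * ((N : ℝ) + 1) ^ (γ - 1), ?_, fun t ht =>
    summable_flux_and_tsum_le hQ ha hγ0 hγ1.le hC₁ hC₂ (hc.nonneg t ht.1) (hc.summable t ht.1)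
      (hR t ht)⟩
  simpa using (tendsto_add_one_rpow_sub_one hγ1).const_mul (2 * C₂ * (R + B) * R)

theorem Sol.summable_coeff (hc : Sol a Q c) {t : ℝ} (ht : 0 ≤ t) : Summable (c t) :=
  summable_of_hasMass (hc.nonneg t ht) (hc.summable t ht).hasSum

theorem Sol.summable_flux (hQ : Profile zs B z ϱ Q) (ha : Rates γ C₁ C₂ a) (hγ0 : 0 ≤ γ)
    (hγ1 : γ < 1) (hC₁ : 0 < C₁) (hC₂ : 0 < C₂) (hc : Sol a Q c) {t : ℝ} (ht : 0 ≤ t) :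
    Summable (flux a Q (c t)) := by
  obtain ⟨δ, -, h⟩ := hc.exists_flux_bound hQ ha hγ0 hγ1 hC₁ hC₂ t
  exact (h t ⟨ht, le_rfl⟩).1.of_abs

/-- Partial sums telescope to a difference of two fluxes, the second of which vanishes uniformly in
time. -/
theorem Sol.hasDerivWithinAt_tail_succ (hQ : Profile zs B z ϱ Q) (ha : Rates γ C₁ C₂ a)
    (hγ0 : 0 ≤ γ) (hγ1 : γ < 1) (hC₁ : 0 < C₁) (hC₂ : 0 < C₂) (hc : Sol a Q c) {t : ℝ}
    (ht : 0 ≤ t) (n : ℕ) :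
    HasDerivWithinAt (fun s => tail (c s) (n + 1)) (flux a Q (c t) n) (Set.Ici 0) t := by
  obtain ⟨δ, hδ0, hδ⟩ := hc.exists_flux_bound hQ ha hγ0 hγ1 hC₁ hC₂ (t + 1)
  refine HasDerivWithinAt.Ici_of_Icc ?_
  refine hasDerivWithinAt_of_uniform_limit (convex_Icc 0 (t + 1))
    (f := fun N s => ∑ m ∈ Finset.range N, c s (m + (n + 1)))
    (f' := fun N s => flux a Q (c s) n - flux a Q (c s) (n + N))
    (g' := fun s => flux a Q (c s) n) (ε := fun N => δ (n + N)) (fun N s hs => ?_)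
    (fun N s hs => ?_) ?_ (fun s hs => ?_) t ⟨ht, by linarith⟩
  · have : flux a Q (c s) n - flux a Q (c s) (n + N) =
        ∑ m ∈ Finset.range N, (flux a Q (c s) (n + m) - flux a Q (c s) (n + (m + 1))) := by
      rw [Finset.sum_range_sub' fun m => flux a Q (c s) (n + m)]; simp
    rw [this]
    refine HasDerivWithinAt.fun_sum fun m _ => ?_
    have := (hc.deriv_succ s hs.1 (n + m)).mono (t := Set.Ici 0)
      (s := Set.Icc 0 (t + 1)) fun y hy => hy.1
    rw [show m + (n + 1) = n + m + 1 by omega]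
    exact this
  · have h := hδ s hs
    have h1 := (((summable_nat_add_iff (n + N)).2 h.1).le_tsum 0 fun _ _ => abs_nonneg _).trans
      (h.2 (n + N))
    rw [zero_add] at h1
    simpa using h1
  · exact hδ0.comp (tendsto_atTop_mono (fun N => Nat.le_add_left N n) tendsto_id)
  · exact ((summable_nat_add_iff (n + 1)).2 (hc.summable_coeff hs.1)).hasSum.tendsto_sum_nat

theorem Sol.hasDerivWithinAt_tail_zero (hQ : Profile zs B z ϱ Q) (ha : Rates γ C₁ C₂ a)
    (hγ0 : 0 ≤ γ) (hγ1 : γ < 1) (hC₁ : 0 < C₁) (hC₂ : 0 < C₂) (hc : Sol a Q c) {t : ℝ}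
    (ht : 0 ≤ t) :
    HasDerivWithinAt (fun s => tail (c s) 0) (-∑' k, flux a Q (c t) k) (Set.Ici 0) t := by
  have h := (hc.deriv_zero t ht).add
    (hc.hasDerivWithinAt_tail_succ hQ ha hγ0 hγ1 hC₁ hC₂ ht 0)
  have e : -flux a Q (c t) 0 - ∑' k, flux a Q (c t) k + flux a Q (c t) 0 =
      -∑' k, flux a Q (c t) k := by ring
  rw [e] at h
  refine h.congr (fun s hs => ?_) ?_
  · exact tail_eq_add (hc.summable_coeff hs) 0
  · exact tail_eq_add (hc.summable_coeff ht) 0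

/-- The mass is the sum of the tails, and the derivative of a partial sum of tails is minus a
remainder of the flux series, which tends to zero uniformly in time. -/
theorem Sol.hasMass (hQ : Profile zs B z ϱ Q) (ha : Rates γ C₁ C₂ a)
    (hγ0 : 0 ≤ γ) (hγ1 : γ < 1) (hC₁ : 0 < C₁) (hC₂ : 0 < C₂) (hc : Sol a Q c)
    (h0 : HasSum (fun n : ℕ => ((n : ℝ) + 1) * c 0 n) ϱ) {t : ℝ} (ht : 0 ≤ t) :
    HasSum (fun n : ℕ => ((n : ℝ) + 1) * c t n) ϱ := by
  obtain ⟨δ, hδ0, hδ⟩ := hc.exists_flux_bound hQ ha hγ0 hγ1 hC₁ hC₂ t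
  have hd : ∀ N : ℕ, ∀ s ∈ Set.Icc 0 t,
      HasDerivWithinAt (fun s => ∑ k ∈ Finset.range (N + 1), tail (c s) k)
        (-∑' k, flux a Q (c s) (k + N)) (Set.Icc 0 t) s := by
    intro N s hs
    simp only [Finset.sum_range_succ']
    have h1 := (HasDerivWithinAt.fun_sum (u := Finset.range N) fun k _ =>
      hc.hasDerivWithinAt_tail_succ hQ ha hγ0 hγ1 hC₁ hC₂ hs.1 k).add
        (hc.hasDerivWithinAt_tail_zero hQ ha hγ0 hγ1 hC₁ hC₂ hs.1)
    have e := (hc.summable_flux hQ ha hγ0 hγ1 hC₁ hC₂ hs.1).sum_add_tsum_nat_add N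
    have e' : ∑ k ∈ Finset.range N, flux a Q (c s) k + -∑' k, flux a Q (c s) k =
      -∑' k, flux a Q (c s) (k + N) := by rw [← e]; ring
    rw [e'] at h1
    exact h1.mono Set.Icc_subset_Ici_self
  have hb : ∀ N : ℕ, |∑ k ∈ Finset.range (N + 1), tail (c t) k -
      ∑ k ∈ Finset.range (N + 1), tail (c 0) k| ≤ δ N * (t - 0) := by
    intro N
    have hle : ∀ s ∈ Set.Ico 0 t, ‖-∑' k, flux a Q (c s) (k + N)‖ ≤ δ N := fun s hs => by
      have h := hδ s ⟨hs.1, hs.2.le⟩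
      have hs' : Summable fun k => ‖flux a Q (c s) (k + N)‖ := (summable_nat_add_iff N).2 h.1
      have h1 := norm_tsum_le_tsum_norm hs'
      have h2 := h.2 N
      rw [norm_neg]
      simp only [Real.norm_eq_abs] at h1 ⊢
      exact h1.trans h2
    have := norm_image_sub_le_of_norm_deriv_le_segment' (hd N) hle t ⟨ht, le_rfl⟩
    rwa [Real.norm_eq_abs] at this
  have hm := (hc.summable t ht).hasSum
  have l1 := ((tendsto_sum_tail (hc.nonneg t ht) hm).comp (tendsto_add_atTop_nat 1)).sub
    ((tendsto_sum_tail (hc.nonneg 0 le_rfl) h0).comp (tendsto_add_atTop_nat 1))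
  have l2 : Tendsto (fun N => δ N * (t - 0)) atTop (𝓝 0) := by simpa using hδ0.mul_const (t - 0)
  have l3 := squeeze_zero_norm (fun N => (Real.norm_eq_abs _).trans_le (hb N)) l2
  have := tendsto_nhds_unique l1 l3
  rwa [sub_eq_zero.1 this] at hm

end solution

/-! ### Positivity and the entropy inequality -/

/-- A solution with mass `ϱ` and its coefficients. -/
structure Flow (γ C₁ C₂ zs B z ϱ : ℝ) (a Q : ℕ → ℝ) (c : ℝ → ℕ → ℝ) : Prop where
  γ_nonneg : 0 ≤ γ
  γ_lt : γ < 1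
  C₁_pos : 0 < C₁
  C₂_pos : 0 < C₂
  profile : Profile zs B z ϱ Q
  rates : Rates γ C₁ C₂ a
  sol : Sol a Q c
  mass_zero : HasSum (fun n : ℕ => ((n : ℝ) + 1) * c 0 n) ϱ

theorem Rates.le_linear {γ C₁ C₂ : ℝ} {a : ℕ → ℝ} (ha : Rates γ C₁ C₂ a) (hγ1 : γ ≤ 1)
    (hC₂ : 0 < C₂) (n : ℕ) : a n ≤ C₂ * ((n : ℝ) + 1) := by
  refine (ha.upper n).trans (mul_le_mul_of_nonneg_left ?_ hC₂.le)
  calc ((n : ℝ) + 1) ^ γ ≤ ((n : ℝ) + 1) ^ (1 : ℝ) :=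
        Real.rpow_le_rpow_of_exponent_le (by linarith [n.cast_nonneg (α := ℝ)]) hγ1
    _ = _ := Real.rpow_one _

theorem hasDerivAt_ent {x y : ℝ} (hx : 0 < x) (hy : 0 < y) :
    HasDerivAt (fun x => ent x y) (Real.log (x / y)) x := by
  have h1 : HasDerivAt (fun x : ℝ => Real.log (x / y)) (1 / y / (x / y)) x :=
    ((hasDerivAt_id x).div_const y).log (div_pos hx hy).ne'
  have h2 := (((hasDerivAt_id x).mul h1).sub (hasDerivAt_id x)).add_const y
  have e : 1 * Real.log (x / y) + id x * (1 / y / (x / y)) - 1 = Real.log (x / y) := by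
    have : x * (1 / y / (x / y)) = 1 := by field_simp
    rw [id, this]; ring
  rw [e] at h2
  exact h2

namespace Flow

variable {γ C₁ C₂ zs B z ϱ : ℝ} {a Q : ℕ → ℝ} {c : ℝ → ℕ → ℝ}

theorem nonneg (hF : Flow γ C₁ C₂ zs B z ϱ a Q c) {t : ℝ} (ht : 0 ≤ t) (n : ℕ) : 0 ≤ c t n :=
  hF.sol.nonneg t ht n

theorem rate_pos (hF : Flow γ C₁ C₂ zs B z ϱ a Q c) (n : ℕ) : 0 < a n :=
  hF.rates.pos hF.γ_nonneg hF.C₁_pos n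

theorem hasMass (hF : Flow γ C₁ C₂ zs B z ϱ a Q c) {t : ℝ} (ht : 0 ≤ t) :
    HasSum (fun n : ℕ => ((n : ℝ) + 1) * c t n) ϱ :=
  hF.sol.hasMass hF.profile hF.rates hF.γ_nonneg hF.γ_lt hF.C₁_pos hF.C₂_pos hF.mass_zero ht

theorem le_mass (hF : Flow γ C₁ C₂ zs B z ϱ a Q c) {t : ℝ} (ht : 0 ≤ t) (n : ℕ) : c t n ≤ ϱ :=
  le_of_hasMass' (hF.sol.nonneg t ht) (hF.hasMass ht) n

theorem summable_flux (hF : Flow γ C₁ C₂ zs B z ϱ a Q c) {t : ℝ} (ht : 0 ≤ t) :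
    Summable (flux a Q (c t)) :=
  hF.sol.summable_flux hF.profile hF.rates hF.γ_nonneg hF.γ_lt hF.C₁_pos hF.C₂_pos ht

theorem flux_le (hF : Flow γ C₁ C₂ zs B z ϱ a Q c) {t : ℝ} (ht : 0 ≤ t) (n : ℕ) :
    flux a Q (c t) n ≤ a n * (c t 0 * c t n) := by
  have h := mul_nonneg (hF.profile.zs_pos.le.trans (hF.profile.ratio_mem n).1)
    (hF.nonneg ht (n + 1))
  exact mul_le_mul_of_nonneg_left (by linarith) (hF.rate_pos n).le

theorem le_flux (hF : Flow γ C₁ C₂ zs B z ϱ a Q c) {t : ℝ} (ht : 0 ≤ t) (n : ℕ) :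
    -(a n * B * c t (n + 1)) ≤ flux a Q (c t) n := by
  have h := mul_le_mul_of_nonneg_right (hF.profile.ratio_mem n).2 (hF.nonneg ht (n + 1))
  have h2 := mul_nonneg (hF.nonneg ht 0) (hF.nonneg ht n)
  have := mul_le_mul_of_nonneg_left (show -(B * c t (n + 1)) ≤ c t 0 * c t n -
    Q n / Q (n + 1) * c t (n + 1) by linarith) (hF.rate_pos n).le
  unfold flux; linarith

/-- The loss terms for each size contain its own density as a factor, and the mass bounds the other
factor. Consequently exp (K t) c m is nondecreasing. -/
theorem exists_deriv_ge (hF : Flow γ C₁ C₂ zs B z ϱ a Q c) (m : ℕ) :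
    ∃ K : ℝ, ∀ t, 0 ≤ t → ∃ d, HasDerivWithinAt (fun s => c s m) d (Set.Ici 0) t ∧
      -K * c t m ≤ d := by
  cases m with
  | zero =>
    refine ⟨a 0 * ϱ + C₂ * ϱ, fun t ht => ⟨_, hF.sol.deriv_zero t ht, ?_⟩⟩
    have h0 := hF.nonneg ht 0
    have h1 := hF.flux_le ht 0
    have h2 : a 0 * (c t 0 * c t 0) ≤ a 0 * (ϱ * c t 0) := by
      have := hF.rate_pos 0
      have := hF.le_mass ht 0
      gcongr
    have h3 : ∑' k, flux a Q (c t) k ≤ C₂ * c t 0 * ϱ := by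
      refine hasSum_le (fun k => ?_) (hF.summable_flux ht).hasSum
        ((hF.hasMass ht).mul_left (C₂ * c t 0))
      refine (hF.flux_le ht k).trans ?_
      have := mul_le_mul_of_nonneg_right (hF.rates.le_linear hF.γ_lt.le hF.C₂_pos k)
        (mul_nonneg h0 (hF.nonneg ht k))
      linarith
    linarith
  | succ m =>
    refine ⟨a m * B + a (m + 1) * ϱ, fun t ht => ⟨_, hF.sol.deriv_succ t ht m, ?_⟩⟩
    have h1 := hF.le_flux ht m
    have h2 := hF.flux_le ht (m + 1)
    have h3 : a (m + 1) * (c t 0 * c t (m + 1)) ≤ a (m + 1) * (ϱ * c t (m + 1)) := by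
      have := hF.rate_pos (m + 1)
      have := hF.le_mass ht 0
      have := hF.nonneg ht (m + 1)
      gcongr
    linarith

theorem exists_le_exp_mul (hF : Flow γ C₁ C₂ zs B z ϱ a Q c) (m : ℕ) :
    ∃ K : ℝ, ∀ s t, 0 ≤ s → s ≤ t → Real.exp (K * s) * c s m ≤ Real.exp (K * t) * c t m := by
  obtain ⟨K, hK⟩ := hF.exists_deriv_ge m
  refine ⟨K, fun s t hs hst => ?_⟩
  choose! d hd hd' using hK
  have key := sub_le_of_deriv_le (f := fun x => -(Real.exp (K * x) * c x m))
    (f' := fun x => -(Real.exp (K * x) * (K * 1) * c x m + Real.exp (K * x) * d x)) (K := 0) hs hst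
    (fun x hx => ((((hasDerivAt_id x).const_mul K).exp.hasDerivWithinAt).mul
      (hd x (hs.trans hx.1))).neg) (fun x hx => ?_)
  · linarith
  · have := mul_le_mul_of_nonneg_left (hd' x (hs.trans hx.1)) (Real.exp_pos (K * x)).le
    linarith

/-- By the monotonicity of `exists_le_exp_mul`, a zero at time t propagates backwards to all earlier
times. -/
theorem deriv_eq_zero_of_eq_zero (hF : Flow γ C₁ C₂ zs B z ϱ a Q c) {m : ℕ} {s t : ℝ}
    (hs : 0 < s) (hst : s < t) (h0 : c t m = 0) :
    c s m = 0 ∧ ∀ d, HasDerivWithinAt (fun s => c s m) d (Set.Ici 0) s → d = 0 := by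
  obtain ⟨K, hK⟩ := hF.exists_le_exp_mul m
  have hz : ∀ x, 0 ≤ x → x ≤ t → c x m = 0 := fun x hx hxt => by
    have h1 := hK x t hx hxt
    rw [h0, mul_zero] at h1
    have h2 := Real.exp_pos (K * x)
    have h3 := hF.nonneg hx m
    nlinarith
  refine ⟨hz s hs.le hst.le, fun d hd => ?_⟩
  have h1 := hd.hasDerivAt (Ici_mem_nhds hs)
  have h2 : HasDerivAt (fun s => c s m) 0 s := by
    refine (hasDerivAt_const s (0 : ℝ)).congr_of_eventuallyEq ?_
    filter_upwards [Ioo_mem_nhds hs hst] with x hx using hz x hx.1.le hx.2.le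
  exact h1.unique h2

/-- Without monomers all fluxes are nonpositive, and a vanishing monomer derivative forces each of
them to be zero. Then every density vanishes, contradicting positive mass. -/
theorem pos_zero (hF : Flow γ C₁ C₂ zs B z ϱ a Q c) {t : ℝ} (ht : 0 < t) : 0 < c t 0 := by
  refine lt_of_le_of_ne (hF.nonneg ht.le 0) fun h0 => ?_
  have hs : 0 < t / 2 := by positivity
  obtain ⟨h1, h2⟩ := hF.deriv_eq_zero_of_eq_zero hs (by linarith) h0.symm
  have h3 := h2 _ (hF.sol.deriv_zero _ hs.le)
  have hle : ∀ k, flux a Q (c (t / 2)) k ≤ 0 := fun k => by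
    have := hF.flux_le hs.le k
    rwa [h1, zero_mul, mul_zero] at this
  have h4 : ∑' k, flux a Q (c (t / 2)) k ≤ 0 := tsum_nonpos hle
  have h5 : ∑' k, -flux a Q (c (t / 2)) k = 0 := by
    rw [tsum_neg]; linarith [hle 0]
  have h6 : HasSum (fun k => -flux a Q (c (t / 2)) k) 0 := by
    rw [← h5]; exact (hF.summable_flux hs.le).neg.hasSum
  rw [hasSum_zero_iff_of_nonneg fun k => neg_nonneg.2 (hle k)] at h6
  have h7 : ∀ k, c (t / 2) k = 0 := by
    intro k
    cases k with
    | zero => exact h1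
    | succ k =>
      have h8 : flux a Q (c (t / 2)) k = 0 := by simpa using congrFun h6 k
      rw [flux, h1, zero_mul, zero_sub] at h8
      have ha := hF.rate_pos k
      have hr := hF.profile.zs_pos.trans_le (hF.profile.ratio_mem k).1
      rcases mul_eq_zero.1 h8 with h | h
      · exact absurd h ha.ne'
      · exact (mul_eq_zero.1 (neg_eq_zero.1 h)).resolve_left hr.ne'
  have h9 := hF.hasMass hs.le
  simp only [h7, mul_zero] at h9
  exact hF.profile.rho_pos.ne (hasSum_zero.unique h9)

theorem pos (hF : Flow γ C₁ C₂ zs B z ϱ a Q c) {t : ℝ} (ht : 0 < t) (n : ℕ) : 0 < c t n := by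
  induction n generalizing t with
  | zero => exact hF.pos_zero ht
  | succ m ih =>
    refine lt_of_le_of_ne (hF.nonneg ht.le _) fun h0 => ?_
    have hs : 0 < t / 2 := by positivity
    obtain ⟨h1, h2⟩ := hF.deriv_eq_zero_of_eq_zero hs (by linarith) h0.symm
    have h3 := h2 _ (hF.sol.deriv_succ _ hs.le m)
    have h4 := hF.flux_le hs.le (m + 1)
    rw [h1, mul_zero, mul_zero] at h4
    have h5 : flux a Q (c (t / 2)) m = a m * (c (t / 2) 0 * c (t / 2) m) := by
      rw [flux, h1, mul_zero, sub_zero]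
    have h6 : 0 < a m * (c (t / 2) 0 * c (t / 2) m) :=
      mul_pos (hF.rate_pos m) (mul_pos (hF.pos_zero hs) (ih hs))
    linarith

/-- The powers of z cancel in the logarithms, leaving `sq_sqrt_sub_sqrt_le_mul_log`. -/
theorem dissip_le_flux_mul (hF : Flow γ C₁ C₂ zs B z ϱ a Q c) {t : ℝ} (ht : 0 < t) (n : ℕ) :
    dissip a Q (c t) n ≤ flux a Q (c t) n * (Real.log (c t 0 / (Q 0 * z ^ (0 + 1))) +
      Real.log (c t n / (Q n * z ^ (n + 1))) -
      Real.log (c t (n + 1) / (Q (n + 1) * z ^ (n + 1 + 1)))) := by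
  have h0 := hF.pos ht 0
  have hn := hF.pos ht n
  have hn' := hF.pos ht (n + 1)
  have hq := hF.profile.Q_pos n
  have hq' := hF.profile.Q_pos (n + 1)
  have hz := hF.profile.z_pos
  have h := sq_sqrt_sub_sqrt_le_mul_log (x := c t 0 * c t n / Q n)
    (y := c t (n + 1) / Q (n + 1)) (by positivity) (by positivity)
  have e1 : flux a Q (c t) n =
      a n * Q n * (c t 0 * c t n / Q n - c t (n + 1) / Q (n + 1)) := by
    rw [flux]; field_simp
  have e2 : Real.log (c t 0 / (Q 0 * z ^ (0 + 1))) + Real.log (c t n / (Q n * z ^ (n + 1))) -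
      Real.log (c t (n + 1) / (Q (n + 1) * z ^ (n + 1 + 1))) =
      Real.log (c t 0 * c t n / Q n) - Real.log (c t (n + 1) / Q (n + 1)) := by
    rw [hF.profile.Q_zero, one_mul, zero_add, pow_one, Real.log_div h0.ne' hz.ne',
      Real.log_div hn.ne' (by positivity), Real.log_div hn'.ne' (by positivity),
      Real.log_div (by positivity) hq.ne', Real.log_div hn'.ne' hq'.ne',
      Real.log_mul hq.ne' (by positivity), Real.log_mul hq'.ne' (by positivity),
      Real.log_mul h0.ne' hn.ne', Real.log_pow, Real.log_pow]
    push_cast; ring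
  rw [e1, e2, dissip, mul_assoc (a n * Q n)]
  exact mul_le_mul_of_nonneg_left h (mul_pos (hF.rate_pos n) hq).le

/-- Truncating at N leaves two boundary terms: the flux out of the last size, and the monomers
exchanged with larger clusters. -/
theorem sum_by_parts {w l : ℕ → ℝ} (hw : Summable w) (N : ℕ) :
    ∑ n ∈ Finset.range N, (w n - w (n + 1)) * l (n + 1) + (-w 0 - ∑' k, w k) * l 0 =
      -∑ n ∈ Finset.range N, w n * (l 0 + l n - l (n + 1)) - w N * l N -
        l 0 * ∑' k, w (k + N) := by
  induction N with
  | zero => simp; ring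
  | succ N ih =>
    have h := ((summable_nat_add_iff N).2 hw).tsum_eq_zero_add
    simp only [zero_add] at h
    have h' : ∑' k, w (k + (N + 1)) = ∑' k, w (k + 1 + N) := by
      congr 1; ext k; congr 1; omega
    rw [Finset.sum_range_succ, Finset.sum_range_succ, h']
    rw [h] at ih
    linarith

/-- Controls the boundary term at the last size. If the logarithm is nonnegative only detachment
counts and the linear bound applies; if it is negative only attachment counts, and -c log (c/E) ≤ E
since the entropy density is nonnegative. -/
theorem exists_neg_flux_mul_log_le (hF : Flow γ C₁ C₂ zs B z ϱ a Q c) :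
    ∃ K : ℝ, 0 ≤ K ∧ ∀ t, 0 < t → ∀ n : ℕ,
      -(flux a Q (c t) n * Real.log (c t n / (Q n * z ^ (n + 1)))) ≤
        K * (((n : ℝ) + 1) ^ 2 * c t (n + 1) + ((n : ℝ) + 1) * (Q n * z ^ (n + 1))) := by
  obtain ⟨K, hK, hlog⟩ := hF.profile.exists_log_le
  have hB := hF.profile.B_pos
  have hϱ := hF.profile.rho_pos
  have hC₂ := hF.C₂_pos
  have hz := hF.profile.z_pos
  refine ⟨C₂ * (B * K + ϱ), by positivity, fun t ht n => ?_⟩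
  have han := hF.rates.le_linear hF.γ_lt.le hF.C₂_pos n
  have ha0 := hF.rate_pos n
  have hcn := hF.pos ht n
  have hcn' := hF.pos ht (n + 1)
  have hE := hF.profile.eq_pos n
  have hlogn := hlog (c t n) z n hcn.le (hF.le_mass ht.le n) (by linarith)
  set E := Q n * z ^ (n + 1) with hEdef
  set l := Real.log (c t n / E) with hl
  have key : -(flux a Q (c t) n * l) ≤
      a n * (B * K * (((n : ℝ) + 1) * c t (n + 1)) + ϱ * E) := by
    rcases le_or_gt 0 l with h0 | h0
    · have h1 := mul_le_mul_of_nonneg_right (hF.le_flux ht.le n) h0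
      have h2 := mul_le_mul_of_nonneg_left hlogn
        (by positivity : 0 ≤ a n * B * c t (n + 1))
      have h3 : 0 ≤ a n * (ϱ * E) := by positivity
      linarith
    · have h1 := mul_le_mul_of_nonneg_right (hF.flux_le ht.le n) (neg_nonneg.2 h0.le)
      have h2 := ent_nonneg hcn.le hE
      have h3 : c t n * (-l) ≤ E := by unfold ent at h2; linarith
      have h4 : c t 0 * (c t n * (-l)) ≤ ϱ * E :=
        mul_le_mul (hF.le_mass ht.le 0) h3 (mul_nonneg hcn.le (neg_nonneg.2 h0.le)) hϱ.le
      have h5 := mul_le_mul_of_nonneg_left h4 ha0.le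
      have h6 : 0 ≤ a n * (B * K * (((n : ℝ) + 1) * c t (n + 1))) := by positivity
      linarith
  refine key.trans ?_
  have h7 : 0 ≤ B * K * (((n : ℝ) + 1) * c t (n + 1)) + ϱ * E := by positivity
  refine (mul_le_mul_of_nonneg_right han h7).trans ?_
  have h8 : 0 ≤ C₂ * ϱ * (((n : ℝ) + 1) ^ 2 * c t (n + 1)) := by positivity
  have h9 : 0 ≤ C₂ * (B * K) * (((n : ℝ) + 1) * E) := by positivity
  linarith

/-- Dissipation of the truncated entropies, up to an error that tends to zero uniformly on compact
time intervals. -/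
theorem exists_entropy_deriv (hF : Flow γ C₁ C₂ zs B z ϱ a Q c) {s T A lam : ℝ} (hs : 0 < s)
    (hlam : 0 < lam) (hexp : ∀ t ∈ Set.Icc 0 T, ∀ n : ℕ, c t n ≤ A * Real.exp (-lam * n)) :
    ∃ δ : ℕ → ℝ, Tendsto δ atTop (𝓝 0) ∧ ∀ N, ∀ t ∈ Set.Icc s T, ∃ d,
      HasDerivWithinAt (fun τ => ∑ n ∈ Finset.range (N + 1), ent (c τ n) (Q n * z ^ (n + 1))) d
        (Set.Ici 0) t ∧ d ≤ -∑ n ∈ Finset.range N, dissip a Q (c t) n + δ N := by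
  obtain ⟨K, hK0, hK⟩ := hF.exists_neg_flux_mul_log_le
  obtain ⟨δ, hδ0, hδ⟩ := hF.sol.exists_flux_bound hF.profile hF.rates hF.γ_nonneg hF.γ_lt
    hF.C₁_pos hF.C₂_pos T
  obtain ⟨k, hk⟩ := hF.exists_le_exp_mul 0
  have hz := hF.profile.z_pos
  -- A positive lower bound for the monomer density on [s, T], from monotonicity of exp (k t) c 0;
  -- it bounds the logarithm that multiplies the remainder of the flux series.
  set lo : ℝ := Real.exp (-|k| * |T|) * (Real.exp (k * s) * c s 0) with hlo
  have hlo0 : 0 < lo := by have := hF.pos hs 0; positivity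
  set L := |Real.log (lo / z)| + |Real.log (ϱ / z)| with hL
  have hlog0 : ∀ t ∈ Set.Icc s T, |Real.log (c t 0 / (Q 0 * z ^ (0 + 1)))| ≤ L := by
    intro t ht
    have ht0 : 0 < t := hs.trans_le ht.1
    have h0 := hF.pos ht0 0
    have h1 : lo ≤ c t 0 := by
      have := hk s t hs.le ht.1
      calc lo ≤ Real.exp (-|k| * |T|) * (Real.exp (k * t) * c t 0) := by rw [hlo]; gcongr
        _ = Real.exp (-|k| * |T| + k * t) * c t 0 := by rw [← mul_assoc, ← Real.exp_add]
        _ ≤ 1 * c t 0 := by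
          refine mul_le_mul_of_nonneg_right (Real.exp_le_one_iff.2 ?_) h0.le
          have h2 : k * t ≤ |k| * |T| := by
            refine (le_abs_self _).trans ?_
            rw [abs_mul]
            refine mul_le_mul_of_nonneg_left ?_ (abs_nonneg _)
            rw [abs_of_pos ht0]; exact ht.2.trans (le_abs_self _)
          linarith
        _ = c t 0 := one_mul _
    rw [hF.profile.Q_zero, one_mul, zero_add, pow_one]
    have e1 : Real.log (lo / z) ≤ Real.log (c t 0 / z) :=
      Real.log_le_log (by positivity) (by gcongr)
    have e2 : Real.log (c t 0 / z) ≤ Real.log (ϱ / z) :=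
      Real.log_le_log (by positivity) (by have := hF.le_mass ht0.le 0; gcongr)
    rw [abs_le, hL]
    have := neg_abs_le (Real.log (lo / z))
    have := le_abs_self (Real.log (ϱ / z))
    have := abs_nonneg (Real.log (lo / z))
    have := abs_nonneg (Real.log (ϱ / z))
    constructor <;> linarith
  refine ⟨fun N => K * (((N : ℝ) + 1) ^ 2 * (A * Real.exp (-lam * (N + 1 : ℕ))) +
    ((N : ℝ) + 1) * (Q N * z ^ (N + 1))) + L * δ N, ?_, fun N t ht => ?_⟩
  · have h1 : Tendsto (fun N : ℕ => ((N : ℝ) + 1) ^ 2 * (A * Real.exp (-lam * (N + 1 : ℕ)))) atTop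
        (𝓝 0) := by
      have := ((Real.summable_pow_mul_exp_neg_nat_mul 2 hlam).tendsto_atTop_zero.comp
        (tendsto_add_atTop_nat 1)).const_mul A
      rw [mul_zero] at this
      refine this.congr fun N => ?_
      simp only [Function.comp]; push_cast; ring
    have h2 := hF.profile.mass.summable.tendsto_atTop_zero
    simpa using ((h1.add h2).const_mul K).add (hδ0.const_mul L)
  · have ht0 : 0 < t := hs.trans_le ht.1
    have htT : t ∈ Set.Icc 0 T := ⟨ht0.le, ht.2⟩
    set l : ℕ → ℝ := fun n => Real.log (c t n / (Q n * z ^ (n + 1))) with hl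
    refine ⟨∑ n ∈ Finset.range N, (flux a Q (c t) n - flux a Q (c t) (n + 1)) * l (n + 1) +
      (-flux a Q (c t) 0 - ∑' k, flux a Q (c t) k) * l 0, ?_, ?_⟩
    · simp only [Finset.sum_range_succ']
      refine (HasDerivWithinAt.fun_sum fun n _ => ?_).add ?_
      · rw [mul_comm _ (l (n + 1))]
        exact (hasDerivAt_ent (hF.pos ht0 (n + 1)) (hF.profile.eq_pos (n + 1))).comp_hasDerivWithinAt
          t (hF.sol.deriv_succ t ht0.le n)
      · rw [mul_comm _ (l 0)]
        exact (hasDerivAt_ent (hF.pos ht0 0) (hF.profile.eq_pos 0)).comp_hasDerivWithinAt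
          t (hF.sol.deriv_zero t ht0.le)
    · rw [sum_by_parts (hF.summable_flux ht0.le)]
      have h1 : ∑ n ∈ Finset.range N, dissip a Q (c t) n ≤
          ∑ n ∈ Finset.range N, flux a Q (c t) n * (l 0 + l n - l (n + 1)) :=
        Finset.sum_le_sum fun n _ => hF.dissip_le_flux_mul ht0 n
      have h2 := hK t ht0 N
      have h3 : K * (((N : ℝ) + 1) ^ 2 * c t (N + 1) + ((N : ℝ) + 1) * (Q N * z ^ (N + 1))) ≤
          K * (((N : ℝ) + 1) ^ 2 * (A * Real.exp (-lam * (N + 1 : ℕ))) +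
            ((N : ℝ) + 1) * (Q N * z ^ (N + 1))) := by
        have := hexp t htT (N + 1)
        gcongr
      have h4 : -(l 0 * ∑' k, flux a Q (c t) (k + N)) ≤ L * δ N := by
        have hsum := (hδ t htT).1
        have hs' : Summable fun k => ‖flux a Q (c t) (k + N)‖ := (summable_nat_add_iff N).2 hsum
        have h5 := norm_tsum_le_tsum_norm hs'
        have h6 := (hδ t htT).2 N
        simp only [Real.norm_eq_abs] at h5
        refine (neg_le_abs _).trans ?_
        rw [abs_mul]
        exact mul_le_mul (hlog0 t ht) (h5.trans h6) (abs_nonneg _)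
          ((abs_nonneg _).trans (hlog0 t ht))
      have h2' : -(flux a Q (c t) N * l N) ≤ _ := h2
      linarith

/-- The entropy inequality. -/
theorem entropy_add_le (hF : Flow γ C₁ C₂ zs B z ϱ a Q c) {s T A lam : ℝ} (hs : 0 < s)
    (hsT : s ≤ T) (hlam : 0 < lam)
    (hexp : ∀ t ∈ Set.Icc 0 T, ∀ n : ℕ, c t n ≤ A * Real.exp (-lam * n)) {Φ φ : ℝ → ℝ}
    {η : ℕ → ℝ} (hΦ : ∀ t ∈ Set.Icc s T, HasDerivWithinAt Φ (φ t) (Set.Ici 0) t)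
    (hη : Tendsto η atTop (𝓝 0)) (hφ : ∀ᶠ N in atTop, ∀ t ∈ Set.Icc s T,
      φ t ≤ ∑ n ∈ Finset.range N, dissip a Q (c t) n + η N) :
    entropy Q z (c T) + (Φ T - Φ s) ≤ entropy Q z (c s) := by
  obtain ⟨δ, hδ0, hδ⟩ := hF.exists_entropy_deriv hs hlam hexp
  obtain ⟨_, _, hent⟩ := hF.profile.exists_entropy_le
  have hT : 0 < T := hs.trans_le hsT
  -- `Φ` stands in for the time integral of the dissipation: only its derivative is compared with
  -- truncated dissipations, so the dissipation itself is never integrated.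
  have key : ∀ᶠ N in atTop,
      (∑ n ∈ Finset.range (N + 1), ent (c T n) (Q n * z ^ (n + 1)) + Φ T) -
      (∑ n ∈ Finset.range (N + 1), ent (c s n) (Q n * z ^ (n + 1)) + Φ s) ≤
        (δ N + η N) * (T - s) := by
    filter_upwards [hφ] with N hN
    choose! d hd hd' using hδ N
    refine sub_le_of_deriv_le (f := fun τ => ∑ n ∈ Finset.range (N + 1),
      ent (c τ n) (Q n * z ^ (n + 1)) + Φ τ) (f' := fun τ => d τ + φ τ) hs.le hsT
      (fun t ht => (hd t ht).add (hΦ t ht)) (fun t ht => ?_)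
    have := hd' t ht
    have := hN t ht
    linarith
  have l1 : ∀ t, 0 ≤ t → Tendsto (fun N => ∑ n ∈ Finset.range (N + 1),
      ent (c t n) (Q n * z ^ (n + 1)) + Φ t) atTop (𝓝 (entropy Q z (c t) + Φ t)) := fun t ht =>
    ((hent (c t) (hF.sol.nonneg t ht) (hF.hasMass ht)).1.hasSum.tendsto_sum_nat.comp
      (tendsto_add_atTop_nat 1)).add_const _
  have l2 : Tendsto (fun N => (δ N + η N) * (T - s)) atTop (𝓝 0) := by
    simpa using (hδ0.add hη).mul_const (T - s)
  have := le_of_tendsto_of_tendsto ((l1 T hT.le).sub (l1 s hs.le)) l2 key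
  linarith

end Flow

/-! ### Propagation of exponential moments, uniformly in time -/

/-- Truncated exponential moments, weighted by the attachment rates. -/
noncomputable def weightedMoment (a c : ℕ → ℝ) (lam : ℝ) (N : ℕ) : ℝ :=
  ∑ k ∈ Finset.range N, Real.exp (lam * k) / a k * tail c (k + 1)

/-- The time derivative of `weightedMoment`, where `lam'` is the derivative of `lam`. -/
noncomputable def weightedMomentDeriv (a Q c : ℕ → ℝ) (lam lam' : ℝ) (N : ℕ) : ℝ :=
  ∑ k ∈ Finset.range N, (lam' * k * (Real.exp (lam * k) / a k) * tail c (k + 1) +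
    Real.exp (lam * k) / a k * flux a Q c k)

/-- The derivative of tail (k + 1) is the single flux k, proportional to `a k`; the weight 1 / a k
cancels the unbounded rate. -/
theorem Flow.hasDerivWithinAt_weightedMoment {γ C₁ C₂ zs B z ϱ : ℝ} {a Q : ℕ → ℝ}
    {c : ℝ → ℕ → ℝ} (hF : Flow γ C₁ C₂ zs B z ϱ a Q c) {lam : ℝ → ℝ} {lam' t : ℝ} (ht : 0 ≤ t)
    (hlam : HasDerivWithinAt lam lam' (Set.Ici 0) t) (N : ℕ) :
    HasDerivWithinAt (fun s => weightedMoment a (c s) (lam s) N)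
      (weightedMomentDeriv a Q (c t) (lam t) lam' N) (Set.Ici 0) t := by
  refine HasDerivWithinAt.fun_sum fun k _ => ?_
  have h1 := ((hlam.mul_const (k : ℝ)).exp.div_const (a k)).mul
    (hF.sol.hasDerivWithinAt_tail_succ hF.profile hF.rates hF.γ_nonneg hF.γ_lt hF.C₁_pos
      hF.C₂_pos ht k)
  refine h1.congr_deriv ?_
  ring

section
variable {γ C₁ C₂ zs B z ϱ : ℝ} {Q : ℕ → ℝ}

theorem tendsto_div_add_one_rpow (hγ0 : 0 ≤ γ) (hγ1 : γ < 1) :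
    Tendsto (fun k : ℕ => (k : ℝ) / ((k : ℝ) + 1) ^ γ) atTop atTop := by
  have h1 : Tendsto (fun k : ℕ => ((k : ℝ) + 1) ^ (1 - γ) - 1) atTop atTop :=
    tendsto_atTop_add_const_right _ _ ((tendsto_rpow_atTop (by linarith)).comp
      (tendsto_atTop_add_const_right _ (1 : ℝ) (tendsto_natCast_atTop_atTop (R := ℝ))))
  refine tendsto_atTop_mono (fun k => ?_) h1
  have hk : (1 : ℝ) ≤ ((k : ℝ) + 1) ^ γ :=
    Real.one_le_rpow (by linarith [k.cast_nonneg (α := ℝ)]) hγ0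
  have hk0 : (0 : ℝ) < (k : ℝ) + 1 := by positivity
  rw [le_div_iff₀ (by positivity), sub_mul, ← Real.rpow_add hk0]
  simp only [sub_add_cancel, Real.rpow_one, one_mul]
  linarith

theorem exp_div_mul_flux_le (hQ : Profile zs B z ϱ Q) {a c : ℕ → ℝ} (ha : ∀ n, 0 < a n)
    (hc : ∀ n, 0 ≤ c n) (lam : ℝ) (k : ℕ) :
    Real.exp (lam * k) / a k * flux a Q c k ≤
      Real.exp (lam * k) * (c 0 * c k - zs * c (k + 1)) := by
  have h := mul_le_mul_of_nonneg_right (hQ.ratio_mem k).1 (hc (k + 1))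
  have e : Real.exp (lam * k) / a k * flux a Q c k =
      Real.exp (lam * k) * (c 0 * c k - Q k / Q (k + 1) * c (k + 1)) := by
    have := (ha k).ne'
    rw [flux]; field_simp
  rw [e]
  exact mul_le_mul_of_nonneg_left (by linarith) (Real.exp_pos _).le

/-- Decreasing the exponent at any positive speed controls the growth of the weighted moments. -/
theorem Profile.exists_weightedMomentDeriv_le (hQ : Profile zs B z ϱ Q) (hγ0 : 0 ≤ γ)
    (hγ1 : γ < 1) (hC₁ : 0 < C₁) (hC₂ : 0 < C₂) {η μ₀ : ℝ} (hη : 0 < η) :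
    ∃ K : ℝ, 0 ≤ K ∧ ∀ a c : ℕ → ℝ, Rates γ C₁ C₂ a → (∀ n, 0 ≤ c n) →
      HasSum (fun n : ℕ => ((n : ℝ) + 1) * c n) ϱ → ∀ (lam lam' : ℝ) (N : ℕ), lam ≤ μ₀ →
      lam' ≤ -η → weightedMomentDeriv a Q c lam lam' N ≤ K := by
  have hϱ := hQ.rho_pos
  -- Lowering the exponent at speed η gains η k / a k, which tends to infinity since γ < 1. Beyond J
  -- it beats the growth factor ϱ exp μ₀; the sizes below J contribute the constant.
  obtain ⟨J, hJ⟩ := ((tendsto_div_add_one_rpow hγ0 hγ1).eventually_ge_atTop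
    (ϱ * Real.exp μ₀ * C₂ / η)).exists_forall_of_atTop
  set g : ℕ → ℝ := fun k =>
    if k ∈ Finset.range J then Real.exp (μ₀ * k) * ϱ * (ϱ * Real.exp μ₀) else 0 with hg
  have hg0 : ∀ k, 0 ≤ g k := fun k => by
    simp only [hg]; split_ifs <;> positivity
  have hgs : HasSum g (∑ k ∈ Finset.range J, g k) :=
    hasSum_sum_of_ne_finset_zero fun k hk => if_neg hk
  refine ⟨∑ k ∈ Finset.range J, g k + ϱ * ϱ, add_nonneg (Finset.sum_nonneg fun k _ => hg0 k)
    (by positivity), fun a c ha hc hm lam lam' N hlam hlam' => ?_⟩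
  have hs := summable_of_hasMass hc hm
  have hap := ha.pos hγ0 hC₁
  have ht0 := tail_nonneg hc
  have htϱ := tail_le_of_hasMass hc hm
  have hz := hQ.zs_pos
  have h1 : weightedMomentDeriv a Q c lam lam' N ≤
      ∑ k ∈ Finset.range N, (-(η * k * (Real.exp (lam * k) / a k) * tail c (k + 1)) +
        ϱ * (Real.exp (lam * k) * tail c k)) := by
    refine Finset.sum_le_sum fun k _ => add_le_add ?_ ?_
    · have h2 : 0 ≤ (k : ℝ) * (Real.exp (lam * k) / a k) * tail c (k + 1) := by
        have := ht0 (k + 1); have := hap k; positivity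
      have := mul_le_mul_of_nonneg_right hlam' h2
      linarith
    · refine (exp_div_mul_flux_le hQ hap hc lam k).trans ?_
      have h3 : c 0 * c k - zs * c (k + 1) ≤ ϱ * tail c k := by
        have := mul_le_mul (le_of_hasMass' hc hm 0) (le_tail hc hs k) (hc k) hϱ.le
        have := mul_nonneg hz.le (hc (k + 1))
        linarith
      have := mul_le_mul_of_nonneg_left h3 (Real.exp_pos (lam * k)).le
      linarith
  have h2 : ∑ k ∈ Finset.range N, Real.exp (lam * k) * tail c k ≤
      ∑ k ∈ Finset.range N, Real.exp μ₀ * Real.exp (lam * k) * tail c (k + 1) + ϱ := by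
    have h3 : ∑ k ∈ Finset.range N, Real.exp (lam * k) * tail c k ≤
        ∑ k ∈ Finset.range (N + 1), Real.exp (lam * k) * tail c k := by
      rw [Finset.sum_range_succ]
      have := mul_nonneg (Real.exp_pos (lam * N)).le (ht0 N)
      linarith
    refine h3.trans ?_
    rw [Finset.sum_range_succ']
    refine add_le_add (Finset.sum_le_sum fun k _ => ?_) ?_
    · refine mul_le_mul_of_nonneg_right ?_ (ht0 _)
      rw [← Real.exp_add, Real.exp_le_exp]; push_cast; linarith
    · simpa using htϱ 0
  have h4 : ∀ k : ℕ, -(η * k * (Real.exp (lam * k) / a k) * tail c (k + 1)) +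
      ϱ * (Real.exp μ₀ * Real.exp (lam * k) * tail c (k + 1)) ≤ g k := by
    intro k
    have e : -(η * k * (Real.exp (lam * k) / a k) * tail c (k + 1)) +
      ϱ * (Real.exp μ₀ * Real.exp (lam * k) * tail c (k + 1)) =
      (Real.exp (lam * k) * tail c (k + 1)) * (ϱ * Real.exp μ₀ - η * (k / a k)) := by ring
    have hp : 0 ≤ Real.exp (lam * k) * tail c (k + 1) := mul_nonneg (Real.exp_pos _).le (ht0 _)
    have hak := hap k
    rw [e]
    simp only [hg]
    split_ifs with hk
    · have h5 : ϱ * Real.exp μ₀ - η * (k / a k) ≤ ϱ * Real.exp μ₀ := by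
        have : 0 ≤ η * (k / a k) := by positivity
        linarith
      refine (mul_le_mul_of_nonneg_left h5 hp).trans ?_
      have h6 : lam * k ≤ μ₀ * k := mul_le_mul_of_nonneg_right hlam k.cast_nonneg
      have := htϱ (k + 1)
      have := ht0 (k + 1)
      gcongr
    · refine mul_nonpos_of_nonneg_of_nonpos hp ?_
      have h5 := hJ k (by simpa using hk)
      rw [div_le_iff₀ hη] at h5
      have h6 : (k : ℝ) / ((k : ℝ) + 1) ^ γ ≤ C₂ * (k / a k) := by
        rw [div_le_iff₀ (by positivity), mul_div_assoc', div_mul_eq_mul_div, le_div_iff₀ hak]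
        have := mul_le_mul_of_nonneg_left (ha.upper k) (k.cast_nonneg (α := ℝ))
        linarith
      have h7 := mul_le_mul_of_nonneg_right h6 hη.le
      have h8 : ϱ * Real.exp μ₀ * C₂ ≤ η * (k / a k) * C₂ := by linarith
      have := le_of_mul_le_mul_right h8 hC₂
      linarith
  have h5 : ∑ k ∈ Finset.range N, (-(η * k * (Real.exp (lam * k) / a k) * tail c (k + 1)) +
      ϱ * (Real.exp μ₀ * Real.exp (lam * k) * tail c (k + 1))) ≤ ∑ k ∈ Finset.range J, g k :=
    (Finset.sum_le_sum fun k _ => h4 k).trans (sum_le_hasSum _ (fun k _ => hg0 k) hgs)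
  rw [Finset.sum_add_distrib, ← Finset.mul_sum] at h1 h5
  have h6 := mul_le_mul_of_nonneg_left h2 hϱ.le
  linarith

/-- When the monomer density is subcritical, the weighted moments are damped. -/
theorem Profile.weightedMomentDeriv_le_of_subcritical (hQ : Profile zs B z ϱ Q) (hγ0 : 0 ≤ γ)
    (hC₁ : 0 < C₁) {a c : ℕ → ℝ} (ha : Rates γ C₁ C₂ a) (hc : ∀ n, 0 ≤ c n)
    (hm : HasSum (fun n : ℕ => ((n : ℝ) + 1) * c n) ϱ) {lam lam' lam₁ ε : ℝ} (hlam₁ : 0 < lam₁)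
    (hlam : lam₁ ≤ lam) (hlam' : lam' ≤ 0) (hε : 0 < ε) (hc0 : c 0 + ε ≤ zs * Real.exp (-lam))
    (N : ℕ) :
    weightedMomentDeriv a Q c lam lam' N ≤ zs * ϱ + ε * (Real.exp (lam * N) * tail c N) -
      ε * C₁ * lam₁ * weightedMoment a c lam N := by
  have hs := summable_of_hasMass hc hm
  have hap := ha.pos hγ0 hC₁
  have ht0 := tail_nonneg hc
  have hz := hQ.zs_pos
  set S := ∑ k ∈ Finset.range N, Real.exp (lam * k) * c k with hS
  set U := ∑ k ∈ Finset.range N, Real.exp (lam * k) * tail c (k + 1) with hU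
  have hshift : ∀ f : ℕ → ℝ, Real.exp lam * ∑ k ∈ Finset.range N, Real.exp (lam * k) * f (k + 1) =
      ∑ k ∈ Finset.range N, Real.exp (lam * k) * f k + Real.exp (lam * N) * f N - f 0 := by
    intro f
    have h1 := Finset.sum_range_succ (fun k : ℕ => Real.exp (lam * k) * f k) N
    have h2 := Finset.sum_range_succ' (fun k : ℕ => Real.exp (lam * k) * f k) N
    have h3 : ∑ k ∈ Finset.range N, Real.exp (lam * (k + 1 : ℕ)) * f (k + 1) =
        Real.exp lam * ∑ k ∈ Finset.range N, Real.exp (lam * k) * f (k + 1) := by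
      rw [Finset.mul_sum]
      refine Finset.sum_congr rfl fun k _ => ?_
      rw [← mul_assoc, ← Real.exp_add]; congr 2; push_cast; ring
    rw [← h3]
    simp only [Nat.cast_zero, mul_zero, Real.exp_zero, one_mul] at h2
    linarith
  -- By the index shift, (exp lam - 1) U is at most S plus the boundary term, so the moment of `c`
  -- dominates that of its tails.
  have hmom : C₁ * lam₁ * weightedMoment a c lam N ≤ S + Real.exp (lam * N) * tail c N := by
    have h1 : C₁ * weightedMoment a c lam N ≤ U := by
      rw [weightedMoment, Finset.mul_sum]
      refine Finset.sum_le_sum fun k _ => ?_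
      rw [div_mul_eq_mul_div, mul_div_assoc', div_le_iff₀ (hap k)]
      have := mul_le_mul_of_nonneg_right (ha.const_le hγ0 hC₁ k)
        (mul_nonneg (Real.exp_pos (lam * k)).le (ht0 (k + 1)))
      linarith
    have h2 := hshift (tail c)
    have h3 : ∑ k ∈ Finset.range N, Real.exp (lam * k) * tail c k = S + U := by
      rw [hS, hU, ← Finset.sum_add_distrib]
      refine Finset.sum_congr rfl fun k _ => ?_
      rw [tail_eq_add hs k]; ring
    have hU0 : 0 ≤ U := Finset.sum_nonneg fun k _ => mul_nonneg (Real.exp_pos _).le (ht0 _)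
    have h4 : lam₁ * U ≤ (Real.exp lam - 1) * U := by
      refine mul_le_mul_of_nonneg_right ?_ hU0
      linarith [Real.add_one_le_exp lam]
    have h5 := mul_le_mul_of_nonneg_left h1 hlam₁.le
    have h6 := ht0 0
    rw [h3] at h2
    linarith
  have h1 : weightedMomentDeriv a Q c lam lam' N ≤
      ∑ k ∈ Finset.range N, Real.exp (lam * k) * (c 0 * c k - zs * c (k + 1)) := by
    refine Finset.sum_le_sum fun k _ => ?_
    have h2 : 0 ≤ (k : ℝ) * (Real.exp (lam * k) / a k) * tail c (k + 1) := by
      have := ht0 (k + 1); have := hap k; positivity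
    have := mul_nonpos_of_nonpos_of_nonneg hlam' h2
    have := exp_div_mul_flux_le hQ hap hc lam k
    linarith
  have h2 : ∑ k ∈ Finset.range N, Real.exp (lam * k) * (c 0 * c k - zs * c (k + 1)) =
      c 0 * S - zs * ∑ k ∈ Finset.range N, Real.exp (lam * k) * c (k + 1) := by
    rw [hS, Finset.mul_sum, Finset.mul_sum, ← Finset.sum_sub_distrib]
    exact Finset.sum_congr rfl fun k _ => by ring
  have h3 := hshift c
  have he : Real.exp (-lam) * Real.exp lam = 1 := by rw [← Real.exp_add]; simp
  have hS0 : 0 ≤ S := Finset.sum_nonneg fun k _ => mul_nonneg (Real.exp_pos _).le (hc _)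
  -- Shifting the index turns detachment into at least zs exp (-lam) S, up to a monomer term. This
  -- exceeds attachment c 0 * S by ε S, which is the damping.
  have h4 : zs * ∑ k ∈ Finset.range N, Real.exp (lam * k) * c (k + 1) ≥
      zs * Real.exp (-lam) * (S - c 0) := by
    have h5 : zs * ∑ k ∈ Finset.range N, Real.exp (lam * k) * c (k + 1) =
        zs * Real.exp (-lam) * (Real.exp lam *
          ∑ k ∈ Finset.range N, Real.exp (lam * k) * c (k + 1)) := by
      linear_combination
        -(zs * ∑ k ∈ Finset.range N, Real.exp (lam * k) * c (k + 1)) * he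
    rw [h5, h3]
    refine mul_le_mul_of_nonneg_left ?_ (by positivity)
    have := mul_nonneg (Real.exp_pos (lam * N)).le (hc N)
    linarith
  have h5 : zs * Real.exp (-lam) * c 0 ≤ zs * ϱ := by
    have h6 : Real.exp (-lam) ≤ 1 := Real.exp_le_one_iff.2 (by linarith)
    have h7 := le_of_hasMass' hc hm 0
    have := mul_le_mul h6 h7 (hc 0) zero_le_one
    have := mul_le_mul_of_nonneg_left this hz.le
    linarith
  have h6 := mul_le_mul_of_nonneg_right hc0 hS0
  have h7 := mul_le_mul_of_nonneg_left hmom hε.le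
  linarith

/-- The at most linear factor `a k` is absorbed by giving up d in the exponent. -/
theorem tail_le_of_weighted {a c : ℕ → ℝ} (ha : Rates γ C₁ C₂ a) (hγ0 : 0 ≤ γ) (hγ1 : γ ≤ 1)
    (hC₁ : 0 < C₁) (hC₂ : 0 < C₂) (hc : ∀ n, 0 ≤ c n)
    (hm : HasSum (fun n : ℕ => ((n : ℝ) + 1) * c n) ϱ) {lam d G : ℝ} (hd : 0 < d) (hG : 0 ≤ G)
    (h : ∀ k : ℕ, Real.exp (lam * k) / a k * tail c (k + 1) ≤ G) (n : ℕ) :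
    tail c n ≤ (ϱ + G * C₂ * Real.exp lam / d) * Real.exp (-(lam - d) * n) := by
  have hϱ0 : 0 ≤ ϱ := (tail_nonneg hc 0).trans (tail_le_of_hasMass hc hm 0)
  cases n with
  | zero =>
    have : 0 ≤ G * C₂ * Real.exp lam / d := by positivity
    have := tail_le_of_hasMass hc hm 0
    simp only [Nat.cast_zero, mul_zero, Real.exp_zero, mul_one]
    linarith
  | succ k =>
    have hak := ha.pos hγ0 hC₁ k
    have h1 := h k
    rw [div_mul_eq_mul_div, div_le_iff₀ hak] at h1
    have h2 := ha.le_linear hγ1 hC₂ k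
    have h3 : d * ((k : ℝ) + 1) ≤ Real.exp (d * ((k : ℝ) + 1)) := by
      linarith [Real.add_one_le_exp (d * ((k : ℝ) + 1))]
    have h4 : Real.exp (lam * k) * tail c (k + 1) ≤
        G * C₂ / d * Real.exp (d * ((k : ℝ) + 1)) := by
      calc Real.exp (lam * k) * tail c (k + 1) ≤ G * a k := h1
        _ ≤ G * (C₂ * ((k : ℝ) + 1)) := by gcongr
        _ = G * C₂ / d * (d * ((k : ℝ) + 1)) := by field_simp
        _ ≤ _ := by gcongr
    have h5 : tail c (k + 1) =
        Real.exp (-(lam * k)) * (Real.exp (lam * k) * tail c (k + 1)) := by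
      rw [← mul_assoc, ← Real.exp_add]; simp
    have h6 : Real.exp (-(lam * k)) * (G * C₂ / d * Real.exp (d * ((k : ℝ) + 1))) =
        G * C₂ * Real.exp lam / d * Real.exp (-(lam - d) * (k + 1 : ℕ)) := by
      have : Real.exp (-(lam * k)) * Real.exp (d * ((k : ℝ) + 1)) =
          Real.exp lam * Real.exp (-(lam - d) * (k + 1 : ℕ)) := by
        rw [← Real.exp_add, ← Real.exp_add]; congr 1; push_cast; ring
      linear_combination (G * C₂ / d) * this
    rw [h5]
    refine (mul_le_mul_of_nonneg_left h4 (Real.exp_pos _).le).trans ?_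
    rw [h6]
    refine mul_le_mul_of_nonneg_right ?_ (Real.exp_pos _).le
    linarith

theorem weightedMoment_le_of_tail_le {a c : ℕ → ℝ} (hC₁ : 0 < C₁) (ha : ∀ n, C₁ ≤ a n)
    (hc : ∀ n, 0 ≤ c n) {μ lam M : ℝ} (hM : 0 ≤ M) (hμ : 0 ≤ μ) (hlam : lam < μ)
    (h : ∀ n : ℕ, tail c n ≤ M * Real.exp (-μ * n)) (N : ℕ) :
    weightedMoment a c lam N ≤ M / C₁ * ∑' n : ℕ, ((n : ℝ) + 1) * Real.exp (-(μ - lam) * n) := by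
  have hs := (summable_mul_exp_neg (show 0 < μ - lam by linarith)).mul_left (M / C₁)
  rw [← tsum_mul_left]
  refine (Finset.sum_le_sum fun k _ => ?_).trans
    (hs.sum_le_tsum (Finset.range N) fun k _ => by positivity)
  have h1 := h (k + 1)
  have hk : (0 : ℝ) ≤ k := k.cast_nonneg
  calc Real.exp (lam * k) / a k * tail c (k + 1)
      ≤ Real.exp (lam * k) / C₁ * (M * Real.exp (-μ * (k + 1 : ℕ))) := by
        have := tail_nonneg hc (k + 1)
        have := ha k
        gcongr
    _ = M / C₁ * Real.exp (lam * k + -μ * (k + 1 : ℕ)) := by rw [Real.exp_add]; ring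
    _ ≤ M / C₁ * (1 * Real.exp (-(μ - lam) * k)) := by
      rw [one_mul]
      refine mul_le_mul_of_nonneg_left (Real.exp_le_exp.2 ?_) (by positivity)
      push_cast; linarith
    _ ≤ M / C₁ * (((k : ℝ) + 1) * Real.exp (-(μ - lam) * k)) := by gcongr; linarith

end

namespace Flow

variable {γ C₁ C₂ zs B z ϱ : ℝ} {a Q : ℕ → ℝ} {c : ℝ → ℕ → ℝ}

theorem le_weightedMoment (hF : Flow γ C₁ C₂ zs B z ϱ a Q c) {t : ℝ} (ht : 0 ≤ t) (lam : ℝ)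
    {k N : ℕ} (hk : k < N) :
    Real.exp (lam * k) / a k * tail (c t) (k + 1) ≤ weightedMoment a (c t) lam N :=
  Finset.single_le_sum (f := fun k : ℕ => Real.exp (lam * k) / a k * tail (c t) (k + 1))
    (fun k _ => mul_nonneg (div_pos (Real.exp_pos _) (hF.rate_pos k)).le
      (tail_nonneg (hF.sol.nonneg t ht) _)) (Finset.mem_range.2 hk)

/-- Exponential moments are propagated on bounded time intervals. -/
theorem exists_local_exp (hF : Flow γ C₁ C₂ zs B z ϱ a Q c) {μ lam M T : ℝ} (hM : 0 ≤ M)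
    (hμ : 0 ≤ μ) (hlam : lam < μ) (hT : 0 ≤ T)
    (h0 : ∀ n : ℕ, tail (c 0) n ≤ M * Real.exp (-μ * n)) :
    ∃ A : ℝ, ∀ t ∈ Set.Icc 0 T, ∀ n : ℕ, tail (c t) n ≤ A * Real.exp (-lam * n) := by
  -- One third of the gap keeps the initial moment finite, one is spent lowering the exponent on [0,
  -- T], one is lost in `tail_le_of_weighted`.
  set d := (μ - lam) / 3 with hd
  have hd0 : 0 < d := by rw [hd]; linarith
  set η := d / (T + 1) with hη
  have hη0 : 0 < η := by positivity
  obtain ⟨K, hK0, hK⟩ := hF.profile.exists_weightedMomentDeriv_le hF.γ_nonneg hF.γ_lt hF.C₁_pos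
    hF.C₂_pos (μ₀ := μ - d) hη0
  set S := M / C₁ * ∑' n : ℕ, ((n : ℝ) + 1) * Real.exp (-(μ - (μ - d)) * n) with hS
  have hC₁ := hF.C₁_pos
  have hS0 : 0 ≤ S := mul_nonneg (by positivity) (tsum_nonneg fun n => by positivity)
  refine ⟨ϱ + (S + K * T) * C₂ * Real.exp (μ - 2 * d) / d, fun t ht n => ?_⟩
  have hG : 0 ≤ S + K * T := by positivity
  have e : lam = μ - 2 * d - d := by rw [hd]; ring
  rw [e]
  refine tail_le_of_weighted hF.rates hF.γ_nonneg hF.γ_lt.le hF.C₁_pos hF.C₂_pos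
    (hF.sol.nonneg t ht.1) (hF.hasMass ht.1) hd0 hG (fun k => ?_) n
  have hder : ∀ s, HasDerivWithinAt (fun s => μ - d - η * s) (-η) (Set.Ici 0) s := fun s => by
    simpa using (((hasDerivAt_id s).const_mul η).const_sub (μ - d)).hasDerivWithinAt
  have h1 := sub_le_of_deriv_le (f := fun s => weightedMoment a (c s) (μ - d - η * s) (k + 1))
    le_rfl ht.1 (fun s hs => hF.hasDerivWithinAt_weightedMoment hs.1 (hder s) (k + 1))
    (K := K) (fun s hs => hK a (c s) hF.rates (hF.sol.nonneg s hs.1) (hF.hasMass hs.1) _ _ _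
      (by have := mul_nonneg hη0.le hs.1; linarith) le_rfl)
  have h2 := weightedMoment_le_of_tail_le hF.C₁_pos (hF.rates.const_le hF.γ_nonneg hF.C₁_pos)
    (hF.sol.nonneg 0 le_rfl) hM hμ (show μ - d < μ by linarith) h0 (k + 1)
  have h3 := hF.le_weightedMoment ht.1 (μ - d - η * t) (Nat.lt_succ_self k)
  simp only [mul_zero, sub_zero] at h1
  have h4 : K * t ≤ K * T := mul_le_mul_of_nonneg_left ht.2 hK0
  have h5 : Real.exp ((μ - 2 * d) * k) / a k * tail (c t) (k + 1) ≤
      Real.exp ((μ - d - η * t) * k) / a k * tail (c t) (k + 1) := by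
    have := hF.rate_pos k
    have := tail_nonneg (hF.sol.nonneg t ht.1) (k + 1)
    have h6 : η * t ≤ d := by
      rw [hη, div_mul_eq_mul_div, div_le_iff₀ (by positivity)]
      exact mul_le_mul_of_nonneg_left (by linarith [ht.2]) hd0.le
    have h7 : (μ - 2 * d) * k ≤ (μ - d - η * t) * k :=
      mul_le_mul_of_nonneg_right (by linarith) k.cast_nonneg
    gcongr
  linarith

end Flow

namespace Flow

variable {γ C₁ C₂ zs B z ϱ : ℝ} {a Q : ℕ → ℝ} {c : ℝ → ℕ → ℝ}

/-- Nothing is known at negative times; freezing the time at 0 gives a function continuous on the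
whole line, convenient for integration. -/
theorem continuous_monomer (hF : Flow γ C₁ C₂ zs B z ϱ a Q c) :
    Continuous fun t => c (max t 0) 0 := by
  have h : ContinuousOn (fun t => c t 0) (Set.Ici 0) := fun t ht =>
    (hF.sol.deriv_zero t ht).continuousWithinAt
  exact h.comp_continuous (by fun_prop) fun t => le_max_right t 0

/-- A solution spends only a bounded amount of time at supercritical monomer densities. -/
theorem integral_le (hF : Flow γ C₁ C₂ zs B z ϱ a Q c) {χ : ℝ → ℝ} {ε H₁ lam : ℝ} {N₀ : ℕ}
    (hχ : Continuous χ) (hχ1 : ∀ x, χ x ≤ 1) (hε : 0 < ε) (hlam : 0 < lam)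
    (hexp : ∀ T, 0 ≤ T → ∃ A, ∀ t ∈ Set.Icc 0 T, ∀ n : ℕ, c t n ≤ A * Real.exp (-lam * n))
    (hH : ∀ t, 0 ≤ t → entropy Q z (c t) ≤ H₁)
    (hdis : ∀ t, 0 ≤ t → ε * χ (c t 0) ≤ ∑ n ∈ Finset.range N₀, dissip a Q (c t) n)
    {T : ℝ} (hT : 0 ≤ T) : ∫ t in (0 : ℝ)..T, χ (c (max t 0) 0) ≤ H₁ / ε := by
  obtain ⟨_, _, hent⟩ := hF.profile.exists_entropy_le
  have hH0 : ∀ t, 0 ≤ t → 0 ≤ entropy Q z (c t) := fun t ht =>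
    (hent (c t) (hF.sol.nonneg t ht) (hF.hasMass ht)).2.1
  have hcont : Continuous fun t => χ (c (max t 0) 0) := hχ.comp hF.continuous_monomer
  set I : ℝ → ℝ := fun T => ∫ t in (0 : ℝ)..T, χ (c (max t 0) 0) with hI
  have hIder : ∀ t, HasDerivAt I (χ (c (max t 0) 0)) t := fun t =>
    intervalIntegral.integral_hasDerivAt_right (hcont.intervalIntegrable _ _)
      hcont.aestronglyMeasurable.stronglyMeasurableAtFilter hcont.continuousAt
  have hIle : ∀ s, 0 ≤ s → I s ≤ s := fun s hs => by
    have := sub_le_of_deriv_le (f := I) le_rfl hs (fun t _ => (hIder t).hasDerivWithinAt)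
      (fun t _ => hχ1 _)
    simp only [hI, intervalIntegral.integral_same] at this ⊢
    linarith
  rcases hT.eq_or_lt with rfl | hT
  · have := (hH0 0 le_rfl).trans (hH 0 le_rfl)
    rw [intervalIntegral.integral_same]; positivity
  obtain ⟨A, hA⟩ := hexp T hT.le
  -- The entropy inequality starts at positive times, where the densities are positive; [0, s]
  -- contributes at most s because χ ≤ 1.
  have key : ∀ s, 0 < s → s ≤ T → I T ≤ H₁ / ε + s := by
    intro s hs hsT
    have h := hF.entropy_add_le hs hsT hlam hA (Φ := fun t => ε * I t)
      (φ := fun t => ε * χ (c (max t 0) 0)) (η := fun _ => 0)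
      (fun t _ => ((hIder t).const_mul ε).hasDerivWithinAt) tendsto_const_nhds
      (by
        filter_upwards [eventually_ge_atTop N₀] with N hN t ht
        have ht0 : 0 ≤ t := hs.le.trans ht.1
        rw [max_eq_left ht0, add_zero]
        refine (hdis t ht0).trans (Finset.sum_le_sum_of_subset_of_nonneg
          (Finset.range_mono hN) fun n _ _ => ?_)
        exact hF.profile.dissip_nonneg (fun n => (hF.rate_pos n).le) _ _)
    have h1 := hH0 T hT.le
    have h2 := hH s hs.le
    have h3 : I T - I s ≤ H₁ / ε := by rw [le_div_iff₀ hε]; linarith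
    linarith [hIle s hs.le]
  refine le_of_forall_pos_le_add fun s hs => ?_
  rcases le_total s T with h | h
  · exact key s hs h
  · exact (key T hT le_rfl).trans (by linarith)

end Flow

section
variable {γ C₁ C₂ zs B z ϱ : ℝ} {Q : ℕ → ℝ}

/-- Exponential moments of solutions are propagated uniformly in time. -/
theorem Profile.exists_uniform_exp (hQ : Profile zs B z ϱ Q) (hγ0 : 0 ≤ γ) (hγ1 : γ < 1)
    (hC₁ : 0 < C₁) (hC₂ : 0 < C₂) {μ M : ℝ} (hμ : 0 < μ) (hM : 0 ≤ M) :
    ∃ lam A : ℝ, 0 < lam ∧ 0 ≤ A ∧ ∀ (a : ℕ → ℝ) (c : ℝ → ℕ → ℝ),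
      Flow γ C₁ C₂ zs B z ϱ a Q c → (∀ n : ℕ, tail (c 0) n ≤ M * Real.exp (-μ * n)) →
      ∀ t, 0 ≤ t → ∀ n : ℕ, tail (c t) n ≤ A * Real.exp (-lam * n) := by
  have hz := hQ.z_pos
  have hzs := hQ.zs_pos
  have hϱ := hQ.rho_pos
  obtain ⟨H₁, hH₁, hH⟩ := hQ.exists_entropy_le
  -- Four levels below zs: dissipation is bounded below above z + δ, the cut-off χ reaches 1 at z +
  -- 2δ, and μ₀ is small enough that z + 3δ ≤ zs exp (-μ₀), leaving a margin δ for damping.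
  set δ := (zs - z) / 4 with hδ
  have hδ0 : 0 < δ := by rw [hδ]; linarith [hQ.z_lt]
  obtain ⟨N₀, ε, hε, hlarge⟩ := hQ.exists_le_dissip_of_large hC₁ hδ0
  have hlogpos : 0 < Real.log (zs / (z + 3 * δ)) := by
    refine Real.log_pos ?_
    rw [one_lt_div (by positivity)]; linarith
  set μ₀ := min (μ / 2) (Real.log (zs / (z + 3 * δ))) with hμ₀
  have hμ₀0 : 0 < μ₀ := lt_min (by positivity) hlogpos
  have hμ₀μ : μ₀ ≤ μ / 2 := min_le_left _ _
  have hμ₀z : z + 3 * δ ≤ zs * Real.exp (-μ₀) := by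
    have h1 : Real.exp μ₀ ≤ zs / (z + 3 * δ) := by
      rw [← Real.exp_log (show 0 < zs / (z + 3 * δ) by positivity)]
      exact Real.exp_le_exp.2 (min_le_right _ _)
    rw [le_div_iff₀ (by positivity)] at h1
    have h2 : Real.exp (-μ₀) * Real.exp μ₀ = 1 := by rw [← Real.exp_add]; simp
    have h3 := mul_le_mul_of_nonneg_left h1 (Real.exp_pos (-μ₀)).le
    calc z + 3 * δ = Real.exp (-μ₀) * Real.exp μ₀ * (z + 3 * δ) := by rw [h2, one_mul]
      _ ≤ _ := by linarith
  set T₀ := H₁ / ε with hT₀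
  have hT₀0 : 0 < T₀ := by positivity
  -- With supercritical time at most T₀, the exponent loses at most μ₀/2 in total.
  set η := μ₀ / 2 / T₀ with hη
  have hη0 : 0 < η := by positivity
  obtain ⟨K, hK0, hK⟩ := hQ.exists_weightedMomentDeriv_le hγ0 hγ1 hC₁ hC₂ (μ₀ := μ₀) hη0
  set χ : ℝ → ℝ := fun x => max 0 (min 1 ((x - (z + δ)) / δ)) with hχ
  have hχc : Continuous χ := by simp only [hχ]; fun_prop
  have hχ0 : ∀ x, 0 ≤ χ x := fun x => le_max_left _ _
  have hχ1 : ∀ x, χ x ≤ 1 := fun x => max_le zero_le_one (min_le_left _ _)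
  have hχlow : ∀ x, x < z + δ → χ x = 0 := fun x hx => by
    refine max_eq_left ((min_le_right _ _).trans ?_)
    exact div_nonpos_of_nonpos_of_nonneg (by linarith) hδ0.le
  have hχhigh : ∀ x, z + 2 * δ ≤ x → χ x = 1 := fun x hx => by
    have : 1 ≤ (x - (z + δ)) / δ := by rw [le_div_iff₀ hδ0]; linarith
    simp only [hχ, min_eq_left this]
    exact max_eq_right zero_le_one
  set S := M / C₁ * ∑' n : ℕ, ((n : ℝ) + 1) * Real.exp (-(μ - μ₀) * n) with hS
  have hS0 : 0 ≤ S := mul_nonneg (by positivity) (tsum_nonneg fun n => by positivity)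
  set κ := δ * C₁ * (μ₀ / 2) with hκ
  have hκ0 : 0 < κ := by positivity
  -- Above this level the damping κ times the moment exceeds the sources zs ϱ + 1, and the initial
  -- moment lies below it.
  set G₀ := max S ((zs * ϱ + 1) / κ) with hG₀
  have hG₀0 : 0 ≤ G₀ := hS0.trans (le_max_left _ _)
  have hG : 0 ≤ G₀ + K * T₀ := by positivity
  refine ⟨μ₀ / 2 - μ₀ / 4, ϱ + (G₀ + K * T₀) * C₂ * Real.exp (μ₀ / 2) / (μ₀ / 4), by linarith,
    by positivity, fun a c hF h0 T hT n => ?_⟩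
  have ha1 := hF.rates.const_le hγ0 hC₁
  refine tail_le_of_weighted hF.rates hγ0 hγ1.le hC₁ hC₂ (hF.sol.nonneg T hT) (hF.hasMass hT)
    (show 0 < μ₀ / 4 by positivity) hG (fun k => ?_) n
  have hlocal : ∀ T, 0 ≤ T → ∃ A, ∀ t ∈ Set.Icc 0 T, ∀ n : ℕ,
      tail (c t) n ≤ A * Real.exp (-(3 / 4 * μ) * n) := fun T hT =>
    hF.exists_local_exp hM hμ.le (by linarith) hT h0
  have hlocal' : ∀ T, 0 ≤ T → ∃ A, ∀ t ∈ Set.Icc 0 T, ∀ n : ℕ,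
      c t n ≤ A * Real.exp (-(3 / 4 * μ) * n) := fun T hT => by
    obtain ⟨A, hA⟩ := hlocal T hT
    exact ⟨A, fun t ht n => (le_tail (hF.sol.nonneg t ht.1) (hF.sol.summable_coeff ht.1) n).trans
      (hA t ht n)⟩
  set I : ℝ → ℝ := fun T => ∫ t in (0 : ℝ)..T, χ (c (max t 0) 0) with hI
  have hcont : Continuous fun t => χ (c (max t 0) 0) := hχc.comp hF.continuous_monomer
  have hIder : ∀ t, HasDerivAt I (χ (c (max t 0) 0)) t := fun t =>
    intervalIntegral.integral_hasDerivAt_right (hcont.intervalIntegrable _ _)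
      hcont.aestronglyMeasurable.stronglyMeasurableAtFilter hcont.continuousAt
  have hIle : ∀ t, 0 ≤ t → I t ≤ T₀ := fun t ht =>
    hF.integral_le hχc hχ1 hε (show 0 < 3 / 4 * μ by positivity) hlocal'
      (fun s hs => (hH (c s) (hF.sol.nonneg s hs) (hF.hasMass hs)).2.2) (N₀ := N₀)
      (fun s hs => by
        rcases lt_or_ge (c s 0) (z + δ) with h | h
        · rw [hχlow _ h, mul_zero]
          exact Finset.sum_nonneg fun n _ =>
            hF.profile.dissip_nonneg (fun n => (hF.rate_pos n).le) _ _
        · refine le_trans ?_ (hlarge a (c s) ha1 (hF.sol.nonneg s hs) (hF.hasMass hs) h)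
          exact mul_le_of_le_one_right hε.le (hχ1 _)) ht
  have hI0 : ∀ t, 0 ≤ t → 0 ≤ I t := fun t ht =>
    intervalIntegral.integral_nonneg ht fun s _ => hχ0 _
  set lam : ℝ → ℝ := fun t => μ₀ - η * I t with hlam
  have hlamder : ∀ t, HasDerivAt lam (-(η * χ (c (max t 0) 0))) t := fun t =>
    ((hIder t).const_mul η).const_sub μ₀
  have hlamle : ∀ t, 0 ≤ t → lam t ≤ μ₀ := fun t ht => by
    have := mul_nonneg hη0.le (hI0 t ht); simp only [hlam]; linarith
  have hlamge : ∀ t, 0 ≤ t → μ₀ / 2 ≤ lam t := fun t ht => by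
    have h1 := mul_le_mul_of_nonneg_left (hIle t ht) hη0.le
    have h2 : η * T₀ = μ₀ / 2 := by rw [hη]; field_simp
    simp only [hlam]; linarith
  obtain ⟨A, hA⟩ := hlocal T hT
  have htend : Tendsto (fun N : ℕ => δ * (A * Real.exp (-(3 / 4 * μ - μ₀) * N))) atTop (𝓝 0) := by
    have := Real.summable_pow_mul_exp_neg_nat_mul 0 (show 0 < 3 / 4 * μ - μ₀ by linarith)
    simp only [pow_zero, one_mul] at this
    simpa using (this.tendsto_atTop_zero.const_mul A).const_mul δ
  -- On [0, T] the local decay rate 3μ/4 exceeds μ₀, so the boundary term is at most 1 for large N.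
  -- N may depend on T and on the solution; the final bound does not.
  obtain ⟨N, hN, hkN⟩ := ((htend.eventually_le_const zero_lt_one).and
    (eventually_gt_atTop k)).exists
  -- Subtracting K I compensates the growth at supercritical times, so the barrier G₀ holds for the
  -- difference.
  have hbar := le_of_deriv_nonpos_above (T := T) (A := G₀)
    (f := fun t => weightedMoment a (c t) (lam t) N - K * I t)
    (fun t ht => (hF.hasDerivWithinAt_weightedMoment ht.1 (hlamder t).hasDerivWithinAt N).sub
      ((hIder t).const_mul K).hasDerivWithinAt) ?_ ?_ T ⟨hT, le_rfl⟩
  · have h1 := hF.le_weightedMoment hT (lam T) hkN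
    have h2 := mul_le_mul_of_nonneg_left (hIle T hT) hK0
    have h3 : Real.exp (μ₀ / 2 * k) / a k * tail (c T) (k + 1) ≤
        Real.exp (lam T * k) / a k * tail (c T) (k + 1) := by
      have := hF.rate_pos k
      have := tail_nonneg (hF.sol.nonneg T hT) (k + 1)
      have := hlamge T hT
      gcongr
    linarith
  · have h1 : I 0 = 0 := intervalIntegral.integral_same
    have h2 : lam 0 = μ₀ := by simp only [hlam, h1, mul_zero, sub_zero]
    simp only [h1, h2, mul_zero, sub_zero]
    exact (weightedMoment_le_of_tail_le hC₁ ha1 (hF.sol.nonneg 0 le_rfl) hM hμ.le (by linarith)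
      h0 N).trans (le_max_left _ _)
  · intro t ht hGt
    have hct := hF.sol.nonneg t ht.1
    have hmt := hF.hasMass ht.1
    simp only [max_eq_left ht.1]
    rcases le_or_gt (z + 2 * δ) (c t 0) with h | h
    · rw [hχhigh _ h, mul_one, mul_one]
      linarith [hK a (c t) hF.rates hct hmt (lam t) (-η) N (hlamle t ht.1) le_rfl]
    · have h1 : c t 0 + δ ≤ zs * Real.exp (-lam t) := by
        have : zs * Real.exp (-μ₀) ≤ zs * Real.exp (-lam t) :=
          mul_le_mul_of_nonneg_left (Real.exp_le_exp.2 (neg_le_neg (hlamle t ht.1))) hzs.le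
        linarith
      have h2 := hQ.weightedMomentDeriv_le_of_subcritical hγ0 hC₁ hF.rates hct hmt
        (show 0 < μ₀ / 2 by positivity) (hlamge t ht.1)
        (neg_nonpos.2 (mul_nonneg hη0.le (hχ0 (c t 0)))) hδ0 h1 N
      have h3 : δ * (Real.exp (lam t * N) * tail (c t) N) ≤ 1 := by
        refine le_trans ?_ hN
        refine mul_le_mul_of_nonneg_left ?_ hδ0.le
        have h4 := hA t ht N
        have h5 : Real.exp (lam t * N) ≤ Real.exp (μ₀ * N) := by
          have := hlamle t ht.1; gcongr
        have h6 := tail_nonneg hct N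
        calc Real.exp (lam t * N) * tail (c t) N
            ≤ Real.exp (μ₀ * N) * (A * Real.exp (-(3 / 4 * μ) * N)) := by gcongr
          _ = A * Real.exp (μ₀ * N + -(3 / 4 * μ) * N) := by rw [Real.exp_add]; ring
          _ = _ := by congr 2; ring
      have h4 : (zs * ϱ + 1) / κ ≤ weightedMoment a (c t) (lam t) N := by
        have := mul_nonneg hK0 (hI0 t ht.1)
        have := le_max_right S ((zs * ϱ + 1) / κ)
        linarith
      rw [div_le_iff₀ hκ0, hκ] at h4
      have h5 := mul_nonneg hK0 (hχ0 (c t 0))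
      linarith

end

/-! ### Stretched exponential decay -/

/-- Integration of a differential inequality with a logarithmic correction. -/
theorem exists_stretched_exponential_decay {γ K₁ K₂ ε : ℝ} (hγ0 : 0 ≤ γ) (hγ1 : γ < 1)
    (hK₁ : 0 < K₁) (hK₂ : 0 < K₂) (hε : 0 < ε) :
    ∃ K C : ℝ, 0 < K ∧ 0 < C ∧ ∀ f : ℝ → ℝ, (∀ t, 0 < t → K₂ * f t ≤ Real.exp (-1)) →
      (∀ s t, 0 < s → s ≤ t → 0 < f t → f t + (t - s) *
        min (K₁ * f t / |Real.log (K₂ * f t)| ^ (1 - γ)) ε ≤ f s) →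
      ∀ t, 0 < t → f t ≤ C * Real.exp (-K * t ^ (1 / (2 - γ))) := by
  set F₀ := Real.exp (-1) / K₂ with hF₀
  have hF₀0 : 0 < F₀ := by positivity
  set κ := min (K₁ * F₀ / 4) ε with hκ
  have hκ0 : 0 < κ := lt_min (by positivity) hε
  set A := F₀ / κ with hA
  have hA0 : 0 < A := by positivity
  have h2γ : 0 < 2 - γ := by linarith
  refine ⟨Real.log 2 * (1 / A) ^ (1 / (2 - γ)), 4 * F₀, by
    have := Real.log_pos one_lt_two; positivity, by positivity, fun f hf hdiss => ?_⟩
  have hfle : ∀ t, 0 < t → f t ≤ F₀ := fun t ht => by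
    rw [hF₀, le_div_iff₀ hK₂]; linarith [hf t ht]
  -- The entropy halves between consecutive times A (n + 1)^(2-γ). Otherwise the logarithm stays
  -- below 2 (n + 1), and dissipation over a gap of length at least A (n + 1)^(1-γ) would use up all
  -- of F₀ 2^(-n).
  have hclaim : ∀ n : ℕ, ∀ t, A * ((n : ℝ) + 1) ^ (2 - γ) ≤ t → f t ≤ F₀ * (1 / 2) ^ n := by
    intro n
    induction n with
    | zero =>
      intro t ht
      have : 0 < t := lt_of_lt_of_le (by positivity) ht
      simpa using hfle t this
    | succ n ih =>
      intro t ht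
      by_contra! hlt
      set s := A * ((n : ℝ) + 1) ^ (2 - γ) with hs
      have hn : (0 : ℝ) < (n : ℝ) + 1 := by positivity
      have hs0 : 0 < s := by positivity
      have hgap : A * ((n : ℝ) + 1) ^ (1 - γ) ≤ t - s := by
        have e1 : ∀ x : ℝ, 0 < x → x ^ (2 - γ) = x * x ^ (1 - γ) := fun x hx => by
          rw [show 2 - γ = 1 + (1 - γ) by ring, Real.rpow_add hx, Real.rpow_one]
        have e2 : ((n : ℝ) + 1) ^ (1 - γ) ≤ ((n : ℝ) + 2) ^ (1 - γ) :=
          Real.rpow_le_rpow hn.le (by linarith) (by linarith)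
        have e3 : s + A * ((n : ℝ) + 1) ^ (1 - γ) ≤ A * (((n + 1 : ℕ) : ℝ) + 1) ^ (2 - γ) := by
          have e4 : ((n + 1 : ℕ) : ℝ) + 1 = (n : ℝ) + 2 := by push_cast; ring
          rw [hs, e4, e1 _ hn, e1 _ (by positivity), ← mul_add]
          refine mul_le_mul_of_nonneg_left ?_ hA0.le
          have := mul_le_mul_of_nonneg_left e2 (by positivity : (0 : ℝ) ≤ (n : ℝ) + 2)
          linarith
        linarith
      have hft : 0 < f t := lt_trans (by positivity) hlt
      have hts : 0 ≤ t - s := le_trans (by positivity) hgap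
      have h1 := hdiss s t hs0 (by linarith) hft
      have h2 := ih s le_rfl
      have hlogneg : Real.log (K₂ * f t) ≤ -1 := by
        have := Real.log_le_log (by positivity) (hf t (by linarith))
        rwa [Real.log_exp] at this
      have hlog : |Real.log (K₂ * f t)| ≤ 2 * ((n : ℝ) + 1) := by
        rw [abs_of_neg (by linarith)]
        have h3 : Real.exp (-1) * (1 / 2) ^ (n + 1) ≤ K₂ * f t := by
          calc Real.exp (-1) * (1 / 2) ^ (n + 1) = K₂ * (F₀ * (1 / 2) ^ (n + 1)) := by
                rw [hF₀]; field_simp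
            _ ≤ _ := by gcongr
        have h4 := Real.log_le_log (by positivity) h3
        rw [Real.log_mul (by positivity) (by positivity), Real.log_exp, Real.log_pow, one_div,
          Real.log_inv] at h4
        push_cast at h4
        have h5 := Real.log_two_lt_d9
        nlinarith [n.cast_nonneg (α := ℝ)]
      have hlogpos : 0 < |Real.log (K₂ * f t)| := abs_pos.2 (by linarith)
      have hΨ : κ * (1 / 2) ^ n / ((n : ℝ) + 1) ^ (1 - γ) ≤
          min (K₁ * f t / |Real.log (K₂ * f t)| ^ (1 - γ)) ε := by
        refine le_min ?_ ?_
        · have h3 : |Real.log (K₂ * f t)| ^ (1 - γ) ≤ 2 * ((n : ℝ) + 1) ^ (1 - γ) := by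
            calc |Real.log (K₂ * f t)| ^ (1 - γ) ≤ (2 * ((n : ℝ) + 1)) ^ (1 - γ) :=
                  Real.rpow_le_rpow hlogpos.le hlog (by linarith)
              _ = 2 ^ (1 - γ) * ((n : ℝ) + 1) ^ (1 - γ) := Real.mul_rpow zero_le_two hn.le
              _ ≤ 2 ^ (1 : ℝ) * ((n : ℝ) + 1) ^ (1 - γ) := by
                gcongr
                · exact one_le_two
                · linarith
              _ = _ := by rw [Real.rpow_one]
          have h4 : K₁ * (F₀ * (1 / 2) ^ (n + 1)) ≤ K₁ * f t := by gcongr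
          calc κ * (1 / 2) ^ n / ((n : ℝ) + 1) ^ (1 - γ)
              ≤ K₁ * F₀ / 4 * (1 / 2) ^ n / ((n : ℝ) + 1) ^ (1 - γ) := by
                gcongr; exact min_le_left _ _
            _ = K₁ * (F₀ * (1 / 2) ^ (n + 1)) / (2 * ((n : ℝ) + 1) ^ (1 - γ)) := by
                rw [pow_succ]; field_simp; ring
            _ ≤ _ := by gcongr
        · have h3 : (1 : ℝ) ≤ ((n : ℝ) + 1) ^ (1 - γ) :=
            Real.one_le_rpow (by linarith [n.cast_nonneg (α := ℝ)]) (by linarith)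
          rw [div_le_iff₀ (by positivity)]
          have h4 : ((1 : ℝ) / 2) ^ n ≤ 1 := pow_le_one₀ (by norm_num) (by norm_num)
          calc κ * (1 / 2) ^ n ≤ ε * 1 := by
                gcongr; exact min_le_right _ _
            _ ≤ _ := by gcongr
      have h3 : F₀ * (1 / 2) ^ n ≤
          (t - s) * min (K₁ * f t / |Real.log (K₂ * f t)| ^ (1 - γ)) ε := by
        calc F₀ * (1 / 2) ^ n = A * ((n : ℝ) + 1) ^ (1 - γ) *
              (κ * (1 / 2) ^ n / ((n : ℝ) + 1) ^ (1 - γ)) := by rw [hA]; field_simp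
          _ ≤ _ := by gcongr
      linarith
  intro t ht
  set x := (t / A) ^ (1 / (2 - γ)) with hx
  have hx0 : 0 ≤ x := by positivity
  have hexp : 4 * F₀ * Real.exp (-(Real.log 2 * (1 / A) ^ (1 / (2 - γ))) * t ^ (1 / (2 - γ))) =
      F₀ * (2 : ℝ) ^ (2 - x) := by
    have e1 : (1 / A) ^ (1 / (2 - γ)) * t ^ (1 / (2 - γ)) = x := by
      rw [← Real.mul_rpow (by positivity) ht.le, hx]; congr 1; ring
    rw [neg_mul, mul_assoc (Real.log 2), e1, Real.rpow_sub two_pos, Real.rpow_def_of_pos two_pos x,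
      Real.exp_neg]
    norm_num
    ring
  rw [hexp]
  rcases lt_or_ge x 1 with h1 | h1
  · refine (hfle t ht).trans (le_mul_of_one_le_right hF₀0.le ?_)
    exact Real.one_le_rpow one_le_two (by linarith)
  -- Rounding down, together with the offset n + 1 in the claim, gives m > x - 2; this is the factor
  -- 4 in the constant.
  · obtain ⟨m, hm⟩ : ∃ m, ⌊x⌋₊ = m + 1 := ⟨⌊x⌋₊ - 1, by
      have := Nat.le_floor (show ((1 : ℕ) : ℝ) ≤ x by simpa using h1); omega⟩
    have h2 : ((m : ℝ) + 1) ≤ x := by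
      have := Nat.floor_le hx0; rw [hm] at this; exact_mod_cast this
    have h3 : x < (m : ℝ) + 2 := by
      have := Nat.lt_floor_add_one x; rw [hm] at this; push_cast at this; linarith
    have h4 : A * ((m : ℝ) + 1) ^ (2 - γ) ≤ t := by
      have := Real.rpow_le_rpow (by positivity) h2 h2γ.le
      rw [hx, ← Real.rpow_mul (by positivity), one_div_mul_cancel h2γ.ne', Real.rpow_one,
        le_div_iff₀ hA0] at this
      linarith
    refine (hclaim m t h4).trans (mul_le_mul_of_nonneg_left ?_ hF₀0.le)
    have : ((1 : ℝ) / 2) ^ m = (2 : ℝ) ^ (-(m : ℝ)) := by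
      rw [Real.rpow_neg zero_le_two, Real.rpow_natCast, one_div, inv_pow]
    rw [this]
    exact Real.rpow_le_rpow_of_exponent_le one_le_two (by linarith)

/-- In this range the logarithm is negative, so its absolute value decreases as the argument grows.
Used to bound the dissipation on a time interval by the entropy at its end. -/
theorem mul_div_abs_log_rpow_mono {γ K₁ K₂ x y : ℝ} (hγ1 : γ < 1) (hK₁ : 0 < K₁) (hK₂ : 0 < K₂)
    (hx : 0 < x) (hxy : x ≤ y) (hy : K₂ * y ≤ Real.exp (-1)) :
    K₁ * x / |Real.log (K₂ * x)| ^ (1 - γ) ≤ K₁ * y / |Real.log (K₂ * y)| ^ (1 - γ) := by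
  have hy0 := hx.trans_le hxy
  have h1 : Real.log (K₂ * y) ≤ -1 := by
    have := Real.log_le_log (by positivity) hy
    rwa [Real.log_exp] at this
  have h2 : Real.log (K₂ * x) ≤ Real.log (K₂ * y) :=
    Real.log_le_log (by positivity) (by gcongr)
  have h3 : |Real.log (K₂ * y)| ≤ |Real.log (K₂ * x)| := by
    rw [abs_of_neg (by linarith), abs_of_neg (by linarith)]; linarith
  have h4 : 0 < |Real.log (K₂ * y)| := abs_pos.2 (by linarith)
  have h5 : |Real.log (K₂ * y)| ^ (1 - γ) ≤ |Real.log (K₂ * x)| ^ (1 - γ) :=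
    Real.rpow_le_rpow h4.le h3 (by linarith)
  gcongr

section
variable {γ C₁ C₂ zs B z ϱ : ℝ} {Q : ℕ → ℝ}

/-- A summable majorant independent of time, so that truncating the dissipation costs an error
uniform in time. -/
theorem Flow.dissip_le {a : ℕ → ℝ} {c : ℝ → ℕ → ℝ} (hF : Flow γ C₁ C₂ zs B z ϱ a Q c)
    {A lam t : ℝ} (hlam : 0 < lam) (ht : 0 ≤ t)
    (hexp : ∀ n : ℕ, c t n ≤ A * Real.exp (-lam * n)) (n : ℕ) :
    dissip a Q (c t) n ≤ C₂ * (ϱ + B) * A * (((n : ℝ) + 1) * Real.exp (-lam * n)) := by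
  have hq := hF.profile.Q_pos n
  have hq' := hF.profile.Q_pos (n + 1)
  have han := hF.rate_pos n
  have h0 := hF.nonneg ht 0
  have hn := hF.nonneg ht n
  have hn' := hF.nonneg ht (n + 1)
  have hB := hF.profile.B_pos
  have hϱ := hF.profile.rho_pos
  have hC₂ := hF.C₂_pos
  have h1 := sq_sqrt_sub_sqrt_le_add (x := c t 0 * c t n / Q n) (y := c t (n + 1) / Q (n + 1))
    (by positivity) (by positivity)
  have hA : 0 ≤ A := by have := hexp 0; simp at this; linarith
  have e2 : A * Real.exp (-lam * (n + 1 : ℕ)) ≤ A * Real.exp (-lam * n) := by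
    refine mul_le_mul_of_nonneg_left (Real.exp_le_exp.2 ?_) hA
    push_cast; linarith
  calc dissip a Q (c t) n
      ≤ a n * Q n * (c t 0 * c t n / Q n + c t (n + 1) / Q (n + 1)) := by unfold dissip; gcongr
    _ = a n * (c t 0 * c t n + Q n / Q (n + 1) * c t (n + 1)) := by field_simp
    _ ≤ (C₂ * ((n : ℝ) + 1)) * (ϱ * (A * Real.exp (-lam * n)) + B * (A * Real.exp (-lam * n))) := by
        have := hF.rates.le_linear hF.γ_lt.le hF.C₂_pos n
        have := hF.le_mass ht 0
        have := hexp n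
        have := (hexp (n + 1)).trans e2
        have := (hF.profile.ratio_mem n).2
        gcongr
    _ = _ := by ring

/-- Convergence to equilibrium at a stretched exponential rate. -/
theorem Profile.exists_decay (hQ : Profile zs B z ϱ Q) (hγ0 : 0 ≤ γ) (hγ1 : γ < 1)
    (hC₁ : 0 < C₁) (hC₂ : 0 < C₂) {μ M : ℝ} (hμ : 0 < μ) (hM : 0 ≤ M) :
    ∃ K C : ℝ, 0 < K ∧ 0 < C ∧ ∀ (a : ℕ → ℝ) (c : ℝ → ℕ → ℝ),
      Flow γ C₁ C₂ zs B z ϱ a Q c → (∀ n : ℕ, tail (c 0) n ≤ M * Real.exp (-μ * n)) →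
      ∀ t, 0 ≤ t → entropy Q z (c t) ≤ C * Real.exp (-K * t ^ (1 / (2 - γ))) := by
  obtain ⟨H₁, hH₁, hH⟩ := hQ.exists_entropy_le
  obtain ⟨lam, A, hlam, hA, hexp⟩ := hQ.exists_uniform_exp hγ0 hγ1 hC₁ hC₂ hμ hM
  obtain ⟨K₁, K₂, ε, hK₁, hK₂, hε, hsmall, hfun⟩ :=
    hQ.exists_functional_inequality (C₂ := C₂) hγ0 hγ1 hC₁ hlam hA
  obtain ⟨K, C, hK, hC, hdecay⟩ := exists_stretched_exponential_decay hγ0 hγ1 hK₁ hK₂ hε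
  -- `hdecay` covers positive times only; H₁ takes care of t = 0.
  refine ⟨K, C + H₁, hK, by positivity, fun a c hF h0 t ht => ?_⟩
  have hstate : ∀ t, 0 ≤ t → State ϱ lam A (c t) := fun t ht =>
    ⟨hF.sol.nonneg t ht, hF.hasMass ht, fun n =>
      (le_tail (hF.sol.nonneg t ht) (hF.sol.summable_coeff ht) n).trans (hexp a c hF h0 t ht n)⟩
  have hsm : ∀ t, 0 ≤ t → K₂ * entropy Q z (c t) ≤ Real.exp (-1) := fun t ht =>
    hsmall _ (hF.sol.nonneg t ht) (hF.hasMass ht)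
  rcases ht.eq_or_lt with rfl | ht
  · have h1 := (hH (c 0) (hF.sol.nonneg 0 le_rfl) hF.mass_zero).2.2
    rw [Real.zero_rpow (one_div_pos.2 (show 0 < 2 - γ by linarith)).ne']
    simp only [mul_zero, Real.exp_zero, mul_one]
    linarith
  refine le_trans (hdecay (fun t => entropy Q z (c t)) (fun t ht => hsm t ht.le)
    (fun s t hs hst hpos => ?_) t ht) ?_
  · have hanti : ∀ τ ∈ Set.Icc s t, entropy Q z (c t) ≤ entropy Q z (c τ) := fun τ hτ => by
      have := hF.entropy_add_le (hs.trans_le hτ.1) hτ.2 hlam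
        (fun x hx => (hstate x hx.1).decay) (Φ := fun _ => 0) (φ := fun _ => 0) (η := fun _ => 0)
        (fun x _ => hasDerivWithinAt_const _ _ _) tendsto_const_nhds
        (Eventually.of_forall fun N x hx => by
          rw [add_zero]
          exact Finset.sum_nonneg fun n _ =>
            hF.profile.dissip_nonneg (fun n => (hF.rate_pos n).le) _ _)
      simpa using this
    set κ := min (K₁ * entropy Q z (c t) / |Real.log (K₂ * entropy Q z (c t))| ^ (1 - γ)) ε
    set g : ℕ → ℝ := fun n => C₂ * (ϱ + B) * A * (((n : ℝ) + 1) * Real.exp (-lam * n)) with hg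
    have hgs : Summable g := (summable_mul_exp_neg hlam).mul_left _
    have h := hF.entropy_add_le hs hst hlam (fun x hx => (hstate x hx.1).decay)
      (Φ := fun x => κ * x) (φ := fun _ => κ) (η := fun N => ∑' n, g (n + N))
      (fun x _ => by simpa using ((hasDerivAt_id x).const_mul κ).hasDerivWithinAt)
      (tendsto_sum_nat_add g) (Eventually.of_forall fun N x hx => ?_)
    · linarith
    · have hx0 : 0 ≤ x := hs.le.trans hx.1
      have hd0 : ∀ n, 0 ≤ dissip a Q (c x) n :=
        hF.profile.dissip_nonneg (fun n => (hF.rate_pos n).le) _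
      have hdle := hF.dissip_le hlam hx0 (hstate x hx0).decay
      have hds : Summable (dissip a Q (c x)) := Summable.of_nonneg_of_le hd0 hdle hgs
      have h1 := hfun a (c x) hF.rates (hstate x hx0) (∑' n, dissip a Q (c x) n)
        (fun N => hds.sum_le_tsum _ fun n _ => hd0 n) (hpos.trans_le (hanti x hx))
      have h2 : κ ≤ ∑' n, dissip a Q (c x) n := by
        refine le_trans (min_le_min ?_ le_rfl) h1
        exact mul_div_abs_log_rpow_mono hγ1 hK₁ hK₂ hpos (hanti x hx) (hsm x hx0)
      rw [← hds.sum_add_tsum_nat_add N] at h2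
      have h3 : ∑' n, dissip a Q (c x) (n + N) ≤ ∑' n, g (n + N) :=
        Summable.tsum_le_tsum (fun n => hdle _) ((summable_nat_add_iff N).2 hds)
          ((summable_nat_add_iff N).2 hgs)
      linarith
  · refine mul_le_mul_of_nonneg_right (by linarith) (Real.exp_pos _).le

end

/-! ### Translation between positive cluster sizes and shifted indices -/

section transfer

theorem hasSum_succPNat {α : Type*} [AddCommMonoid α] [TopologicalSpace α] {f : ℕ+ → α} {x : α} :
    HasSum (fun n : ℕ => f n.succPNat) x ↔ HasSum f x :=
  Equiv.pnatEquivNat.symm.hasSum_iff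

theorem summable_succPNat {α : Type*} [AddCommMonoid α] [TopologicalSpace α] {f : ℕ+ → α} :
    Summable (fun n : ℕ => f n.succPNat) ↔ Summable f :=
  Equiv.pnatEquivNat.symm.summable_iff

theorem tsum_succPNat {α : Type*} [AddCommMonoid α] [TopologicalSpace α] (f : ℕ+ → α) :
    ∑' n : ℕ, f n.succPNat = ∑' i, f i :=
  Equiv.pnatEquivNat.symm.tsum_eq f

theorem succPNat_add_one (n : ℕ) : n.succPNat + 1 = (n + 1).succPNat := rfl

theorem succPNat_cast (n : ℕ) : ((n.succPNat : ℕ) : ℝ) = (n : ℝ) + 1 := by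
  rw [Nat.succPNat_coe]; push_cast; rfl

theorem summable_and_tsum_le_of_ofReal {f : ℕ → ℝ} (hf : ∀ n, 0 ≤ f n) {M : ℝ≥0}
    (h : ∑' n, ENNReal.ofReal (f n) ≤ M) : Summable f ∧ ∑' n, f n ≤ M := by
  have hs : Summable f := by
    have h1 := ENNReal.summable_toReal (h.trans_lt ENNReal.coe_lt_top).ne
    simpa only [ENNReal.toReal_ofReal (hf _)] using h1
  refine ⟨hs, ?_⟩
  rw [← ENNReal.ofReal_tsum_of_nonneg hf hs] at h
  exact (ENNReal.ofReal_le_iff_le_toReal ENNReal.coe_ne_top).1 h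

theorem tail_le_of_expMoment_le {μ : ℝ} {M : ℝ≥0} {c : ℕ+ → ℝ} (hc : ∀ i, 0 ≤ c i) (hμ : 0 ≤ μ)
    (h : expMoment μ c ≤ M) (n : ℕ) :
    tail (fun n => c n.succPNat) n ≤ M * Real.exp (-μ * n) := by
  rw [expMoment, ← tsum_succPNat] at h
  obtain ⟨hs, hle⟩ := summable_and_tsum_le_of_ofReal
    (fun n => mul_nonneg (Real.exp_pos _).le (hc _)) h
  have h1 : ∀ m : ℕ, c (m + n).succPNat ≤
      Real.exp (μ * ((m + n).succPNat : ℕ)) * c (m + n).succPNat * Real.exp (-μ * n) := by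
    intro m
    have e : Real.exp (μ * ((m + n).succPNat : ℕ)) * c (m + n).succPNat * Real.exp (-μ * n) =
        Real.exp (μ * ((m : ℝ) + 1)) * c (m + n).succPNat := by
      rw [mul_right_comm, ← Real.exp_add, succPNat_cast]; congr 2; push_cast; ring
    rw [e]
    exact le_mul_of_one_le_left (hc _) (Real.one_le_exp (by positivity))
  have hs' := ((summable_nat_add_iff n).2 hs).mul_right (Real.exp (-μ * n))
  have h2 := Summable.tsum_le_tsum h1 (Summable.of_nonneg_of_le (fun m => hc _) h1 hs') hs'
  rw [tsum_mul_right] at h2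
  refine h2.trans (mul_le_mul_of_nonneg_right (le_trans ?_ hle) (Real.exp_pos _).le)
  rw [← hs.sum_add_tsum_nat_add n]
  exact le_add_of_nonneg_left
    (Finset.sum_nonneg fun m _ => mul_nonneg (Real.exp_pos _).le (hc _))

end transfer

theorem hasMass_iff {c : ℕ+ → ℝ} {ϱ : ℝ} :
    HasMass c ϱ ↔ HasSum (fun n : ℕ => ((n : ℝ) + 1) * c n.succPNat) ϱ := by
  rw [HasMass, ← hasSum_succPNat]
  simp only [succPNat_cast]

theorem hasMass_equilibrium_iff {Q : ℕ+ → ℝ} {z ϱ : ℝ} :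
    HasMass (fun i => Q i * z ^ (i : ℕ)) ϱ ↔
      HasSum (fun n : ℕ => ((n : ℝ) + 1) * (Q n.succPNat * z ^ (n + 1))) ϱ := by
  rw [hasMass_iff]; rfl

section coefficients
variable {γ C₁ C₂ zs ϱ : ℝ} {α a b : ℕ+ → ℝ}

theorem IsAdmissibleProfile.exists_ratio_le (hα : IsAdmissibleProfile α) :
    ∃ A : ℝ, ∀ i, α i ≤ A * α (i + 1) := by
  have ht : Tendsto Nat.succPNat atTop atTop := tendsto_atTop.2 fun b => by
    filter_upwards [eventually_ge_atTop (b : ℕ)] with n hn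
    rw [← PNat.coe_le_coe, Nat.succPNat_coe]; omega
  have h := (hα.tendsto_ratio.inv₀ one_ne_zero).comp ht
  obtain ⟨A, hA⟩ := h.bddAbove_range
  refine ⟨A, fun i => ?_⟩
  have h1 := hA ⟨i.natPred, rfl⟩
  simp only [Function.comp, PNat.succPNat_natPred, inv_div] at h1
  rwa [div_le_iff₀ (hα.pos _)] at h1

theorem IsAdmissibleCoeff.balance_succPNat (hab : IsAdmissibleCoeff γ C₁ C₂ zs α a b) (n : ℕ) :
    detailedBalance a b n.succPNat = α n.succPNat / zs ^ n := by
  rw [hab.balance_eq, Nat.succPNat_coe]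
  have : (1 - ((n.succ : ℕ) : ℤ)) = -(n : ℤ) := by push_cast; ring
  rw [this, zpow_neg, zpow_natCast]; ring

/-- By continuity the finite sum still exceeds ϱ at some y < zs. On [0, y] the series converges
uniformly, and the intermediate value theorem applies. A finite sum in the hypothesis allows
infinite critical mass. -/
theorem exists_hasSum_eq_of_lt_sum {Q : ℕ → ℝ} {A zs ϱ : ℝ} (hzs : 0 < zs) (hQ : ∀ n, 0 < Q n)
    (hA : ∀ n, Q n * zs ^ n ≤ A) (hϱ : 0 < ϱ) {N : ℕ}
    (hN : ϱ < ∑ n ∈ Finset.range N, ((n : ℝ) + 1) * (Q n * zs ^ (n + 1))) :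
    ∃ z, 0 < z ∧ z < zs ∧ HasSum (fun n : ℕ => ((n : ℝ) + 1) * (Q n * z ^ (n + 1))) ϱ := by
  have hcont : Continuous fun y : ℝ => ∑ n ∈ Finset.range N, ((n : ℝ) + 1) * (Q n * y ^ (n + 1)) := by
    fun_prop
  have hev : ∀ᶠ y in 𝓝[<] zs, 0 < y ∧ y < zs ∧
      ϱ < ∑ n ∈ Finset.range N, ((n : ℝ) + 1) * (Q n * y ^ (n + 1)) := by
    filter_upwards [nhdsWithin_le_nhds (lt_mem_nhds hzs), self_mem_nhdsWithin,
      nhdsWithin_le_nhds (hcont.continuousAt.eventually (lt_mem_nhds hN))] with y h1 h2 h3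
    exact ⟨h1, h2, h3⟩
  obtain ⟨y, hy0, hyz, hyN⟩ := hev.exists
  have hr1 : y / zs < 1 := (div_lt_one hzs).2 hyz
  have hr0 : 0 < y / zs := by positivity
  have hu : Summable fun n : ℕ => ((n : ℝ) + 1) * (Q n * y ^ (n + 1)) := by
    have h1 := summable_pow_mul_geometric_of_norm_lt_one 1
      (show ‖y / zs‖ < 1 by rwa [Real.norm_of_nonneg hr0.le])
    have h2 : Summable fun n : ℕ => A * y * (((n : ℝ) + 1) * (y / zs) ^ n) := by
      refine ((h1.add (summable_geometric_of_lt_one hr0.le hr1)).mul_left (A * y)).congr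
        fun n => ?_
      ring
    refine Summable.of_nonneg_of_le (fun n => by have := hQ n; positivity) (fun n => ?_) h2
    have h3 : Q n * y ^ (n + 1) = Q n * zs ^ n * (y * (y / zs) ^ n) := by
      rw [div_pow]; field_simp; ring
    rw [h3]
    have h4 := mul_le_mul_of_nonneg_right (hA n)
      (by positivity : 0 ≤ ((n : ℝ) + 1) * (y * (y / zs) ^ n))
    linarith
  set f : ℝ → ℝ := fun x => ∑' n : ℕ, ((n : ℝ) + 1) * (Q n * x ^ (n + 1)) with hf
  have hle : ∀ n : ℕ, ∀ x ∈ Set.Icc 0 y,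
      ‖((n : ℝ) + 1) * (Q n * x ^ (n + 1))‖ ≤ ((n : ℝ) + 1) * (Q n * y ^ (n + 1)) := by
    intro n x hx
    have := hQ n
    have := hx.1
    rw [Real.norm_of_nonneg (by positivity)]
    have := hx.2
    gcongr
  have hfc : ContinuousOn f (Set.Icc 0 y) :=
    continuousOn_tsum (fun n => by fun_prop) hu hle
  have hf0 : f 0 = 0 := by simp [hf]
  have hfy : ϱ ≤ f y := hyN.le.trans (hu.sum_le_tsum _ fun n _ => by have := hQ n; positivity)
  obtain ⟨z, hz, hfz⟩ := intermediate_value_Icc hy0.le hfc ⟨hf0.trans_le hϱ.le, hfy⟩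
  refine ⟨z, lt_of_le_of_ne hz.1 ?_, hz.2.trans_lt hyz, ?_⟩
  · rintro rfl; rw [hf0] at hfz; exact hϱ.ne hfz
  · rw [← hfz]
    exact (Summable.of_norm_bounded hu fun n => hle n z hz).hasSum

theorem IsAdmissibleCoeff.exists_profile (hab : IsAdmissibleCoeff γ C₁ C₂ zs α a b)
    (hα : IsAdmissibleProfile α) (hzs : 0 < zs) (hϱ : 0 < ϱ)
    (hlt : ENNReal.ofReal ϱ < criticalMass (detailedBalance a b)) :
    ∃ B z, Profile zs B z ϱ fun n => detailedBalance a b n.succPNat := by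
  set Q : ℕ → ℝ := fun n => detailedBalance a b n.succPNat with hQdef
  have hQ : ∀ n, Q n = α n.succPNat / zs ^ n := hab.balance_succPNat
  have hpos : ∀ n, 0 < Q n := fun n => by rw [hQ]; have := hα.pos n.succPNat; positivity
  have hA : ∀ n, Q n * zs ^ n ≤ α 1 := fun n => by
    rw [hQ, div_mul_cancel₀ _ (by positivity)]
    exact hα.antitone one_le
  obtain ⟨A, hratio⟩ := hα.exists_ratio_le
  have hN : ∃ N : ℕ, ϱ < ∑ n ∈ Finset.range N, ((n : ℝ) + 1) * (Q n * zs ^ (n + 1)) := by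
    rw [criticalMass, hab.criticalDensity_eq, ← tsum_succPNat, ENNReal.tsum_eq_iSup_nat,
      lt_iSup_iff] at hlt
    obtain ⟨N, hN⟩ := hlt
    refine ⟨N, (ENNReal.ofReal_lt_ofReal_iff_of_nonneg hϱ.le).1 (hN.trans_eq ?_)⟩
    rw [ENNReal.ofReal_sum_of_nonneg fun n _ => by have := hpos n; positivity]
    refine Finset.sum_congr rfl fun n _ => ?_
    rw [ENNReal.ofReal_mul (by positivity), ENNReal.ofReal_mul (hpos n).le,
      ENNReal.ofReal_pow hzs.le, ← succPNat_cast, ENNReal.ofReal_natCast, mul_assoc]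
    rfl
  obtain ⟨N, hN⟩ := hN
  obtain ⟨z, hz0, hzlt, hz⟩ := exists_hasSum_eq_of_lt_sum hzs hpos hA hϱ hN
  refine ⟨A * zs, z, hz0, hzlt, detailedBalance_one a b, hpos, fun n => ?_, fun n => ?_, hz⟩
  · rw [hQ, hQ, pow_succ, ← mul_div_assoc, mul_comm zs, mul_div_mul_right _ _ hzs.ne']
    have h : α (n + 1).succPNat ≤ α n.succPNat :=
      hα.antitone (by rw [← succPNat_add_one]; exact (PNat.lt_add_right _ _).le)
    gcongr
  · have h := hratio n.succPNat
    rw [succPNat_add_one] at h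
    rw [hQ, hQ, pow_succ, div_le_iff₀ (by positivity)]
    have e : A * zs * (α (n + 1).succPNat / (zs ^ n * zs)) * zs ^ n = A * α (n + 1).succPNat := by
      field_simp
    rw [e]; exact h

/-- The reason why constants built from one admissible pair serve all of them. -/
theorem IsAdmissibleCoeff.detailedBalance_eq {a' b' : ℕ+ → ℝ}
    (hab : IsAdmissibleCoeff γ C₁ C₂ zs α a b) (hab' : IsAdmissibleCoeff γ C₁ C₂ zs α a' b') :
    detailedBalance a b = detailedBalance a' b' :=
  funext fun i => (hab.balance_eq i).trans (hab'.balance_eq i).symm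

theorem IsAdmissibleCoeff.rates (hab : IsAdmissibleCoeff γ C₁ C₂ zs α a b) :
    Rates γ C₁ C₂ fun n => a n.succPNat :=
  ⟨fun n => by rw [← succPNat_cast]; exact hab.lower_bound _,
    fun n => by rw [← succPNat_cast]; exact hab.upper_bound _⟩

theorem netRate_succPNat (hab : IsAdmissibleCoeff γ C₁ C₂ zs α a b) (hQ : ∀ i, 0 < detailedBalance a b i)
    (c : ℕ+ → ℝ) (n : ℕ) : netRate a b c n.succPNat =
      flux (fun n => a n.succPNat) (fun n => detailedBalance a b n.succPNat)
        (fun n => c n.succPNat) n := by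
  have ha := (hab.a_pos n.succPNat).ne'
  have hb := (hab.b_pos (n.succPNat + 1)).ne'
  have hq := (hQ n.succPNat).ne'
  have e := detailedBalance_succ a b n.succPNat
  simp only [netRate, flux]
  rw [← succPNat_add_one, e]
  have e1 : (Nat.succPNat 0) = 1 := rfl
  rw [e1]
  field_simp

theorem IsSolution.sol {c : ℝ → ℕ+ → ℝ} (hc : IsSolution a b c)
    (hab : IsAdmissibleCoeff γ C₁ C₂ zs α a b) (hQ : ∀ i, 0 < detailedBalance a b i) :
    Sol (fun n => a n.succPNat) (fun n => detailedBalance a b n.succPNat)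
      fun t n => c t n.succPNat := by
  have hmass : ∀ T, ∃ R : ℝ≥0, ∀ t ∈ Set.Icc 0 T,
      Summable (fun n : ℕ => ((n : ℝ) + 1) * c t n.succPNat) ∧
      ∑' n : ℕ, ((n : ℝ) + 1) * c t n.succPNat ≤ R := fun T => by
    obtain ⟨R, hR⟩ := hc.mass_bounded T
    refine ⟨R, fun t ht => summable_and_tsum_le_of_ofReal
      (fun n => mul_nonneg (by positivity) (hc.nonneg t ht.1 _)) ?_⟩
    have h := hR t ht
    rw [← tsum_succPNat] at h
    simpa only [succPNat_cast] using h
  have hflux := fun t => netRate_succPNat hab hQ (c t)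
  refine ⟨fun t ht n => hc.nonneg t ht _, fun t ht => ?_, fun T => ?_, fun t ht n => ?_,
    fun t ht => ?_⟩
  · obtain ⟨R, hR⟩ := hmass t
    exact (hR t ⟨ht, le_rfl⟩).1
  · obtain ⟨R, hR⟩ := hmass T
    exact ⟨R, R.2, fun t ht => (hR t ht).2⟩
  · have h := hc.deriv_succ t ht n.succPNat
    rw [succPNat_add_one] at h
    rwa [hflux, hflux] at h
  · have h := hc.deriv_one t ht
    rw [← tsum_succPNat, show (1 : ℕ+) = Nat.succPNat 0 from rfl] at h
    simp only [hflux] at h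
    exact h

theorem lowerDissipation_eq (a Q c : ℕ+ → ℝ) : lowerDissipation a Q c =
    ∑' n : ℕ, ENNReal.ofReal (dissip (fun n => a n.succPNat) (fun n => Q n.succPNat)
      (fun n => c n.succPNat) n) := by
  rw [lowerDissipation, ← tsum_succPNat]; rfl

theorem Profile.relFreeEnergy_eq {B z : ℝ} {Q : ℕ+ → ℝ}
    (hQ : Profile zs B z ϱ fun n => Q n.succPNat) {c : ℕ+ → ℝ} (hc : ∀ i, 0 ≤ c i)
    (hm : HasMass c ϱ) : RelFreeEnergyConverges Q ϱ c ∧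
      relFreeEnergy Q ϱ c = entropy (fun n => Q n.succPNat) z fun n => c n.succPNat := by
  have hQpos : ∀ i, 0 < Q i := fun i => by
    have := hQ.Q_pos i.natPred
    rwa [PNat.succPNat_natPred] at this
  have hz := equilibriumDensity_eq hQpos hQ.z_pos.le (hasMass_equilibrium_iff.2 hQ.mass)
  obtain ⟨_, _, h⟩ := hQ.exists_entropy_le
  obtain ⟨hs, -⟩ := h (fun n => c n.succPNat) (fun n => hc _) (hasMass_iff.1 hm)
  have heq : Summable fun i : ℕ+ => z ^ (i : ℕ) * Q i := by
    rw [← summable_succPNat]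
    exact hQ.summable_eq.congr fun n => by rw [Nat.succPNat_coe, mul_comm]
  have hterm : ∀ n : ℕ, relFreeEnergyTerm Q z c n.succPNat =
      ent (c n.succPNat) (Q n.succPNat * z ^ (n + 1)) - Q n.succPNat * z ^ (n + 1) := fun n => by
    rw [relFreeEnergyTerm, ent, Nat.succPNat_coe, mul_comm (z ^ _)]; ring
  refine ⟨⟨?_, ?_⟩, ?_⟩
  · rw [hz, ← summable_succPNat]
    exact (hs.sub hQ.summable_eq).congr fun n => (hterm n).symm
  · rw [hz]; exact heq
  · rw [relFreeEnergy, hz, ← tsum_succPNat, ← tsum_succPNat fun i : ℕ+ => z ^ (i : ℕ) * Q i]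
    simp only [hterm, Nat.succPNat_coe, mul_comm (z ^ _)]
    rw [hs.tsum_sub hQ.summable_eq, entropy]
    exact sub_add_cancel _ _

end coefficients

/-- Extended-valued form of the functional inequality: infinite dissipation is trivial, zero entropy
makes the quotient 0, and otherwise the logarithm is at most -1, so the denominator is positive. -/
theorem min_div_le_of_forall_sum_le {γ K₁ K₂ ε H : ℝ} {d : ℕ → ℝ} (hK₂ : 0 < K₂)
    (hd : ∀ n, 0 ≤ d n) (hH : 0 ≤ H) (hsmall : K₂ * H ≤ Real.exp (-1))
    (h : ∀ D, (∀ N, ∑ n ∈ Finset.range N, d n ≤ D) → 0 < H →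
      min (K₁ * H / |Real.log (K₂ * H)| ^ (1 - γ)) ε ≤ D) :
    min (ENNReal.ofReal (K₁ * H) / ENNReal.ofReal (|Real.log (K₂ * H)| ^ (1 - γ)))
      (ENNReal.ofReal ε) ≤ ∑' n, ENNReal.ofReal (d n) := by
  rcases hH.eq_or_lt with rfl | hH
  · refine (min_le_left _ _).trans ?_
    simp
  have hlog : Real.log (K₂ * H) ≤ -1 := by
    have := Real.log_le_log (by positivity) hsmall
    rwa [Real.log_exp] at this
  have hlog0 : 0 < |Real.log (K₂ * H)| ^ (1 - γ) :=
    Real.rpow_pos_of_pos (abs_pos.2 (by linarith)) _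
  rw [← ENNReal.ofReal_div_of_pos hlog0, ← ENNReal.ofReal_min]
  by_cases htop : ∑' n, ENNReal.ofReal (d n) = ⊤
  · rw [htop]; exact le_top
  lift ∑' n, ENNReal.ofReal (d n) to ℝ≥0 using htop with D hD
  obtain ⟨hs, hle⟩ := summable_and_tsum_le_of_ofReal hd hD.ge
  exact ENNReal.ofReal_le_coe.2
    (h D (fun N => (hs.sum_le_tsum _ fun n _ => hd n).trans hle) hH)

end BeckerDoring

/-! ### The theorem -/

theorem theorem1p4 (γ C₁ C₂ zs : ℝ) (hγ0 : 0 ≤ γ) (hγ1 : γ < 1) (hC₁ : 0 < C₁) (hC₂ : 0 < C₂)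
    (hzs : 0 < zs) (α : ℕ+ → ℝ) (hα : BeckerDoring.IsAdmissibleProfile α)
    (ϱ : ℝ) (hϱ : 0 < ϱ) (μ : ℝ) (hμ : 0 < μ) (M : ℝ≥0) :
    -- functional inequality
    (∃ K₁ K₂ ε : ℝ, 0 < K₁ ∧ 0 < K₂ ∧ 0 < ε ∧
      ∀ a b : ℕ+ → ℝ, BeckerDoring.IsAdmissibleCoeff γ C₁ C₂ zs α a b →
      ENNReal.ofReal ϱ < BeckerDoring.criticalMass (BeckerDoring.detailedBalance a b) →
      ∀ c : ℕ+ → ℝ, (∀ i, 0 < c i) → BeckerDoring.HasMass c ϱ →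
        BeckerDoring.expMoment μ c ≤ M →
        BeckerDoring.RelFreeEnergyConverges (BeckerDoring.detailedBalance a b) ϱ c ∧
        min
          (ENNReal.ofReal
              (K₁ * BeckerDoring.relFreeEnergy (BeckerDoring.detailedBalance a b) ϱ c) /
            ENNReal.ofReal
              (|Real.log
                (K₂ * BeckerDoring.relFreeEnergy (BeckerDoring.detailedBalance a b) ϱ c)|
                ^ (1 - γ)))
          (ENNReal.ofReal ε)
        ≤ BeckerDoring.lowerDissipation a (BeckerDoring.detailedBalance a b) c) ∧
    -- rate of convergence
    (∃ K : ℝ, 0 < K ∧ ∀ H₀ : ℝ, ∃ C : ℝ, 0 < C ∧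
      ∀ a b : ℕ+ → ℝ, BeckerDoring.IsAdmissibleCoeff γ C₁ C₂ zs α a b →
      ENNReal.ofReal ϱ < BeckerDoring.criticalMass (BeckerDoring.detailedBalance a b) →
      ∀ c : ℝ → ℕ+ → ℝ, BeckerDoring.IsSolution a b c → BeckerDoring.HasMass (c 0) ϱ →
        BeckerDoring.expMoment μ (c 0) ≤ M →
        BeckerDoring.relFreeEnergy (BeckerDoring.detailedBalance a b) ϱ (c 0) ≤ H₀ →
        ∀ t : ℝ, 0 ≤ t →
          BeckerDoring.RelFreeEnergyConverges (BeckerDoring.detailedBalance a b) ϱ (c t) ∧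
          BeckerDoring.relFreeEnergy (BeckerDoring.detailedBalance a b) ϱ (c t)
            ≤ C * Real.exp (-K * t ^ (1 / (2 - γ)))) := by
  open BeckerDoring in
  -- The constants must precede the coefficients. Any one admissible pair fixes Q and z; without
  -- such a pair everything is vacuous.
  by_cases hex : ∃ a₀ b₀ : ℕ+ → ℝ, IsAdmissibleCoeff γ C₁ C₂ zs α a₀ b₀ ∧
      ENNReal.ofReal ϱ < criticalMass (detailedBalance a₀ b₀)
  swap
  · exact ⟨⟨1, 1, 1, one_pos, one_pos, one_pos, fun a b hab hlt => absurd ⟨a, b, hab, hlt⟩ hex⟩,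
      1, one_pos, fun _ => ⟨1, one_pos, fun a b hab hlt => absurd ⟨a, b, hab, hlt⟩ hex⟩⟩
  obtain ⟨a₀, b₀, hab₀, hlt₀⟩ := hex
  obtain ⟨B, z, hQ⟩ := hab₀.exists_profile hα hzs hϱ hlt₀
  have hQpos : ∀ i, 0 < detailedBalance a₀ b₀ i := fun i => by
    have := hQ.Q_pos i.natPred
    rwa [PNat.succPNat_natPred] at this
  constructor
  · obtain ⟨K₁, K₂, ε, hK₁, hK₂, hε, hsmall, hfun⟩ :=
      hQ.exists_functional_inequality (C₂ := C₂) hγ0 hγ1 hC₁ hμ M.2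
    refine ⟨K₁, K₂, ε, hK₁, hK₂, hε, fun a b hab _ c hc hm hexp => ?_⟩
    rw [hab.detailedBalance_eq hab₀]
    have hc0 : ∀ i, 0 ≤ c i := fun i => (hc i).le
    have hm' := hasMass_iff.1 hm
    obtain ⟨hconv, heq⟩ := hQ.relFreeEnergy_eq hc0 hm
    have hstate : State ϱ μ M fun n => c n.succPNat := ⟨fun n => hc0 _, hm', fun n =>
      (le_tail (fun n => hc0 _) (summable_of_hasMass (fun n => hc0 _) hm') n).trans
        (tail_le_of_expMoment_le hc0 hμ.le hexp n)⟩
    obtain ⟨_, _, hent⟩ := hQ.exists_entropy_le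
    refine ⟨hconv, ?_⟩
    rw [heq, lowerDissipation_eq]
    exact min_div_le_of_forall_sum_le hK₂
      (hQ.dissip_nonneg (fun n => (hab.a_pos _).le) _) (hent _ hstate.nonneg hm').2.1
      (hsmall _ hstate.nonneg hm') (hfun _ _ hab.rates hstate)
  · obtain ⟨K, C, hK, hC, hdecay⟩ := hQ.exists_decay hγ0 hγ1 hC₁ hC₂ hμ M.2
    refine ⟨K, hK, fun _ => ⟨C, hC, fun a b hab _ c hc hm hexp _ t ht => ?_⟩⟩
    have hbal := hab.detailedBalance_eq hab₀
    have hsol := hc.sol hab (fun i => by rw [hbal]; exact hQpos i)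
    rw [hbal] at hsol ⊢
    have hF : Flow γ C₁ C₂ zs B z ϱ _ _ _ :=
      ⟨hγ0, hγ1, hC₁, hC₂, hQ, hab.rates, hsol, hasMass_iff.1 hm⟩
    obtain ⟨hconv, heq⟩ := hQ.relFreeEnergy_eq (hc.nonneg t ht) (hasMass_iff.2 (hF.hasMass ht))
    refine ⟨hconv, ?_⟩
    rw [heq]
    exact hdecay _ _ hF (tail_le_of_expMoment_le (hc.nonneg 0 le_rfl) hμ.le hexp) t ht
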